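/- For $\beta\in\mathbb R$ let $\mathcal F'_\beta$ denote the equation $u_t+xu_y=|x|^\beta u_{xx}$ for $u=u(t,x,y)$. A \emph{domain for} $\beta$ is a nonempty connected open set $\Omega\subseteq\mathbb R^3_{t,x,y}$ on which $|x|^\beta$ is smooth, i.e. $x\neq0$ on $\Omega$ unless $\beta\in\{0,2,4,\dots\}$. For a domain $\Omega$ for $\beta$, let $\mathfrak g_\beta$ be the space of all smooth vector fields $Q=\tau\partial_t+\xi^x\partial_x+\xi^y\partial_y+\eta\partial_u$ on $\Omega\times\mathbb R_u$ (components depending on $t,x,y,u$) that satisfy the infinitesimal invariance criterion: $Q_{(2)}\big(u_t+xu_y-|x|^\beta u_{xx}\big)=0$ at every second-order jet over $\Omega$ satisfying $u_t+xu_y=|x|^\beta u_{xx}$, where $Q_{(2)}$ is the second prolongation of $Q$ ($\mathfrak g_\beta$ is the maximal Lie invariance algebra of $\mathcal F'_\beta$). Put \[ \mathcal P^t=\partial_t,\quad \mathcal P^y=\partial_y,\quad \mathcal I=u\partial_u,\quad \mathcal D^\beta=(2-\beta)t\partial_t+x\partial_x+(3-\beta)y\partial_y,\quad \mathcal Z(f)=f(t,x,y)\partial_u,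 \] \[ \mathfrak g^{\rm gen}_\beta=\langle\mathcal P^t,\mathcal P^y,\mathcal I,\mathcal D^\beta,\mathcal Z(f)\rangle, \] where $f$ runs through the smooth solutions of $\mathcal F'_\beta$ on $\Omega$. The usual equivalence pseudogroup $G^\sim$ of the class $\{\mathcal F'_\beta\mid\beta\in\mathbb R\}$ consists of the transformations $(t,x,y,u,\beta)\mapsto(\Phi(t,x,y,u),b(\beta))$, where $b$ is a diffeomorphism of $\mathbb R$ and $\Phi$ is a smooth point transformation with smooth inverse between nonempty open subsets of $\{x\ne0\}\subset\mathbb R^4$ that maps $\mathcal F'_\beta$ to $\mathcal F'_{b(\beta)}$ for every $\beta\in\mathbb R$. Values $\beta,\beta'$ are called \emph{locally equivalent} if $b(\beta)=\beta'$ for some element of $G^\sim$, and \emph{globally equivalent} if moreover this element can be chosen with $\Phi$ a diffeomorphism of the whole region $\{x\neq0\}$ onto itself. Then: (i) On every nonempty connected open $\Omega\subseteq\{x\ne0\}$, the kernel Lie invariance algebra $\bigcap_{\beta\in\mathbb R}\mathfrak g_\beta$ equals $\langle\partial_t,\partial_y,u\partial_u,(tx-y)\partial_u,x\partial_u,\partial_u\rangle$,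 and this span is closed under the Lie bracket. (ii) For every $\beta$ and every domain $\Omega$ for $\beta$, the space $\mathfrak g^{\rm gen}_\beta$ is a Lie algebra and $\mathfrak g^{\rm gen}_\beta\subseteq\mathfrak g_\beta$; moreover, $\mathfrak g_\beta=\mathfrak g^{\rm gen}_\beta$ if and only if $\beta\in\mathbb R\setminus\{0,2,3,5\}$. (iii) Modulo $G^\sim$-equivalence one may take $\beta\in(-\infty,5/2]$: every $\beta\in\mathbb R$ is globally equivalent to some $\beta'\le5/2$, and this $\beta'$ is the only value in $(-\infty,5/2]$ to which $\beta$ is locally equivalent. (iv) A complete list of $G^\sim$-inequivalent essential Lie symmetry extensions in the class is given by the following two cases, in which, on every domain for the respective $\beta$, $\mathfrak g_\beta$ is a Lie algebra and the sums are direct sums of vector spaces: \[ \beta=2\colon\ \ \mathfrak g_2=\mathfrak g^{\rm gen}_2\dotplus\langle\mathcal K_2\rangle,\qquad \mathcal K_2=2xy\partial_x+y^2\partial_y-xu\partial_u\ne0; \] \[ \beta=0\colon\ \ \mathfrak g_0=\mathfrak g^{\rm gen}_0\dotplus\langle\mathcal K_0,\mathcal P^3,\mathcal P^2,\mathcal P^1\rangle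 \] with the linearly independent vector fields \[ \mathcal K_0=t^2\partial_t+(tx+3y)\partial_x+3ty\partial_y-(x^2+2t)u\partial_u,\quad \mathcal P^3=3t^2\partial_x+t^3\partial_y+3(y-tx)u\partial_u, \] \[ \mathcal P^2=2t\partial_x+t^2\partial_y-xu\partial_u,\quad \mathcal P^1=\partial_x+t\partial_y. \] That is, every $\beta$ for which $\mathfrak g^{\rm gen}_\beta\subsetneq\mathfrak g_\beta$ over some domain for $\beta$ is globally equivalent to $0$ or to $2$, and $0$ and $2$ are not locally equivalent. -/

import Mathlib

open Set Filter
open scoped Topology ContDiff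

/-! # Lie symmetries of `u_t + x u_y = |x|^β u_xx`

Conventions: the base space has coordinates `(t, x, y)`, the total space `((t, x, y), u)`. -/

namespace Kolmogorov

/-- The space of the independent variables `(t, x, y)`. -/
abbrev BaseSpace : Type := ℝ × ℝ × ℝ

/-- The space of all variables `((t, x, y), u)`. -/
abbrev TotalSpace : Type := BaseSpace × ℝ

/-- `∂f/∂t`. -/
noncomputable def dT (f : BaseSpace → ℝ) (p : BaseSpace) : ℝ := fderiv ℝ f p (1, 0, 0)

/-- `∂f/∂x`. -/
noncomputable def dX (f : BaseSpace → ℝ) (p : BaseSpace) : ℝ := fderiv ℝ f p (0, 1, 0)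

/-- `∂f/∂y`. -/
noncomputable def dY (f : BaseSpace → ℝ) (p : BaseSpace) : ℝ := fderiv ℝ f p (0, 0, 1)

/-- `u_t + x u_y = |x|^β u_xx` at the point `p = (t, x, y)`. -/
def SatisfiesAt (β : ℝ) (u : BaseSpace → ℝ) (p : BaseSpace) : Prop :=
  dT u p + p.2.1 * dY u p = |p.2.1| ^ β * dX (dX u) p

/-- A domain (nonempty connected open set) of the space of `(t, x, y)` on which the coefficient
`|x|^β` is smooth: the domain may meet the plane `x = 0` only if `β` is one of `0, 2, 4, …`. -/
structure IsDomainFor (β : ℝ) (Ω : TopologicalSpace.Opens BaseSpace) : Prop where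
  isConnected : IsConnected (Ω : Set BaseSpace)
  regular : ∀ p ∈ Ω, p.2.1 = 0 → ∃ n : ℕ, β = 2 * n

/-- The part of the total space that lies over `Ω`. -/
def cyl (Ω : Set BaseSpace) : Set TotalSpace := Ω ×ˢ (univ : Set ℝ)

/-! ## Smooth solutions and smooth vector fields

A function on `Ω` and a vector field on `cyl Ω` are represented by their extensions by zero, so
that objects that agree on the domain are equal. -/

/-- Smooth solutions on `Ω` of the equation with parameter `β`. -/
def solutions (β : ℝ) (Ω : Set BaseSpace) : Set (BaseSpace → ℝ) :=
  {f | (∀ p, p ∉ Ω → f p = 0) ∧ ContDiffOn ℝ ∞ f Ω ∧ ∀ p ∈ Ω, SatisfiesAt β f p}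

/-- Smooth vector fields `τ ∂_t + ξ^x ∂_x + ξ^y ∂_y + η ∂_u` on `cyl Ω`; the value of a field at
a point is `((τ, ξ^x, ξ^y), η)`. -/
def smoothFields (Ω : Set BaseSpace) : Set (TotalSpace → TotalSpace) :=
  {V | (∀ z, z ∉ cyl Ω → V z = 0) ∧ ContDiffOn ℝ ∞ V (cyl Ω)}

/-- The restriction to `cyl Ω` of the field with the given components, which are functions
of `t x y u`. -/
noncomputable def field (Ω : Set BaseSpace) (τ ξx ξy η : ℝ → ℝ → ℝ → ℝ → ℝ) : TotalSpace → TotalSpace :=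
  (cyl Ω).indicator fun z =>
    ((τ z.1.1 z.1.2.1 z.1.2.2 z.2, ξx z.1.1 z.1.2.1 z.1.2.2 z.2, ξy z.1.1 z.1.2.1 z.1.2.2 z.2),
      η z.1.1 z.1.2.1 z.1.2.2 z.2)

/-! ## The infinitesimal invariance criterion -/

/-- The characteristic `Q[u] = η - τ u_t - ξ^x u_x - ξ^y u_y`, evaluated on a function `u`. -/
noncomputable def characteristic (V : TotalSpace → TotalSpace) (u : BaseSpace → ℝ) (q : BaseSpace) : ℝ :=
  (V (q, u q)).2 - (V (q, u q)).1.1 * dT u q - (V (q, u q)).1.2.1 * dX u q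
    - (V (q, u q)).1.2.2 * dY u q

/-- The coefficient `η^t = D_t Q[u] + τ u_tt + ξ^x u_tx + ξ^y u_ty` of the prolonged field. -/
noncomputable def etaT (V : TotalSpace → TotalSpace) (u : BaseSpace → ℝ) (p : BaseSpace) : ℝ :=
  dT (characteristic V u) p + (V (p, u p)).1.1 * dT (dT u) p
    + (V (p, u p)).1.2.1 * dX (dT u) p + (V (p, u p)).1.2.2 * dY (dT u) p

/-- The coefficient `η^y = D_y Q[u] + τ u_ty + ξ^x u_xy + ξ^y u_yy` of the prolonged field. -/
noncomputable def etaY (V : TotalSpace → TotalSpace) (u : BaseSpace → ℝ) (p : BaseSpace) : ℝ :=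
  dY (characteristic V u) p + (V (p, u p)).1.1 * dT (dY u) p
    + (V (p, u p)).1.2.1 * dX (dY u) p + (V (p, u p)).1.2.2 * dY (dY u) p

/-- The coefficient `η^xx = D_x² Q[u] + τ u_txx + ξ^x u_xxx + ξ^y u_xxy` of the prolonged field. -/
noncomputable def etaXX (V : TotalSpace → TotalSpace) (u : BaseSpace → ℝ) (p : BaseSpace) : ℝ :=
  dX (dX (characteristic V u)) p + (V (p, u p)).1.1 * dT (dX (dX u)) p
    + (V (p, u p)).1.2.1 * dX (dX (dX u)) p + (V (p, u p)).1.2.2 * dY (dX (dX u)) p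

/-- The second prolongation of `V` applied to `u_t + x u_y - |x|^β u_xx`, at the jet of `u`
at `p`. -/
noncomputable def prolongedAction (β : ℝ) (V : TotalSpace → TotalSpace) (u : BaseSpace → ℝ) (p : BaseSpace) : ℝ :=
  etaT V u p + p.2.1 * etaY V u p + (V (p, u p)).1.2.1 * dY u p
    - |p.2.1| ^ β * etaXX V u p
    - (V (p, u p)).1.2.1 * deriv (fun s : ℝ => |s| ^ β) p.2.1 * dX (dX u) p

/-- `V` is a Lie symmetry over `Ω`: the prolonged action vanishes at every second-order jet that
satisfies the equation. Jets are represented by smooth functions `u`, of which only the jet at `p`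
matters; in particular `u` has to satisfy the equation at the point `p` only. -/
def IsLieSymmetry (β : ℝ) (Ω : Set BaseSpace) (V : TotalSpace → TotalSpace) : Prop :=
  V ∈ smoothFields Ω ∧ ∀ u : BaseSpace → ℝ, ContDiff ℝ ∞ u → ∀ p ∈ Ω,
    SatisfiesAt β u p → prolongedAction β V u p = 0

/-! ### Lie symmetries form a linear space -/

lemma isOpen_cyl {Ω : Set BaseSpace} (h : IsOpen Ω) : IsOpen (cyl Ω) := h.prod isOpen_univ

lemma contDiff_dT {u : BaseSpace → ℝ} (h : ContDiff ℝ ∞ u) : ContDiff ℝ ∞ (dT u) :=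
  (h.fderiv_right (m := ∞) (by simp)).clm_apply contDiff_const

lemma contDiff_dX {u : BaseSpace → ℝ} (h : ContDiff ℝ ∞ u) : ContDiff ℝ ∞ (dX u) :=
  (h.fderiv_right (m := ∞) (by simp)).clm_apply contDiff_const

lemma contDiff_dY {u : BaseSpace → ℝ} (h : ContDiff ℝ ∞ u) : ContDiff ℝ ∞ (dY u) :=
  (h.fderiv_right (m := ∞) (by simp)).clm_apply contDiff_const

lemma contDiffOn_characteristic {Ω : Set BaseSpace} {V : TotalSpace → TotalSpace} (hV : V ∈ smoothFields Ω)
    {u : BaseSpace → ℝ} (hu : ContDiff ℝ ∞ u) : ContDiffOn ℝ ∞ (characteristic V u) Ω := by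
  have h : ContDiffOn ℝ ∞ (fun q : BaseSpace => V (q, u q)) Ω :=
    hV.2.comp (contDiff_id.prodMk hu).contDiffOn fun q hq => ⟨hq, mem_univ _⟩
  have h1 := h.fst
  exact ((h.snd.sub (h1.fst.mul (contDiff_dT hu).contDiffOn)).sub
    (h1.snd.fst.mul (contDiff_dX hu).contDiffOn)).sub
      (h1.snd.snd.mul (contDiff_dY hu).contDiffOn)

/-- `prolongedAction` is linear in the vector field. -/
lemma prolongedAction_comb {β : ℝ} {Ω : Set BaseSpace} (hΩ : IsOpen Ω) {V W : TotalSpace → TotalSpace}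
    (hV : V ∈ smoothFields Ω) (hW : W ∈ smoothFields Ω) (a b : ℝ) {u : BaseSpace → ℝ}
    (hu : ContDiff ℝ ∞ u) {p : BaseSpace} (hp : p ∈ Ω) :
    prolongedAction β (a • V + b • W) u p
      = a * prolongedAction β V u p + b * prolongedAction β W u p := by
  have hc : characteristic (a • V + b • W) u
      = a • characteristic V u + b • characteristic W u := by
    funext q
    simp only [characteristic, Pi.add_apply, Pi.smul_apply, Prod.fst_add, Prod.snd_add,
      Prod.smul_fst, Prod.smul_snd, smul_eq_mul]
    ring
  have hVc := contDiffOn_characteristic hV hu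
  have hWc := contDiffOn_characteristic hW hu
  have key : ∀ {f g : BaseSpace → ℝ}, ContDiffOn ℝ ∞ f Ω → ContDiffOn ℝ ∞ g Ω → ∀ q ∈ Ω, 
      fderiv ℝ (a • f + b • g) q = a • fderiv ℝ f q + b • fderiv ℝ g q := by
    intro f g hf hg q hq
    have hf' : DifferentiableAt ℝ f q :=
      (hf.contDiffAt (hΩ.mem_nhds hq)).differentiableAt (by simp)
    have hg' : DifferentiableAt ℝ g q :=
      (hg.contDiffAt (hΩ.mem_nhds hq)).differentiableAt (by simp)
    rw [fderiv_add (hf'.const_smul a) (hg'.const_smul b), fderiv_const_smul hf',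
      fderiv_const_smul hg']
  have hdX : ∀ {f : BaseSpace → ℝ}, ContDiffOn ℝ ∞ f Ω → ContDiffOn ℝ ∞ (dX f) Ω := fun hf =>
    (hf.fderiv_of_isOpen (m := ∞) hΩ (by simp)).clm_apply contDiffOn_const
  have hT : dT (a • characteristic V u + b • characteristic W u) p
      = a * dT (characteristic V u) p + b * dT (characteristic W u) p := by
    simp [dT, key hVc hWc p hp]
  have hY : dY (a • characteristic V u + b • characteristic W u) p
      = a * dY (characteristic V u) p + b * dY (characteristic W u) p := by
    simp [dY, key hVc hWc p hp]
  have hX : ∀ {f g : BaseSpace → ℝ}, ContDiffOn ℝ ∞ f Ω → ContDiffOn ℝ ∞ g Ω → ∀ q ∈ Ω,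
      dX (a • f + b • g) q = (a • dX f + b • dX g) q := by
    intro f g hf hg q hq
    simp [dX, key hf hg q hq]
  have hXX : dX (dX (a • characteristic V u + b • characteristic W u)) p
      = a * dX (dX (characteristic V u)) p + b * dX (dX (characteristic W u)) p := by
    have he : dX (a • characteristic V u + b • characteristic W u)
        =ᶠ[𝓝 p] (a • dX (characteristic V u) + b • dX (characteristic W u)) :=
      Filter.eventually_of_mem (hΩ.mem_nhds hp) (hX hVc hWc)
    have := hX (hdX hVc) (hdX hWc) p hp
    rw [show dX (dX (a • characteristic V u + b • characteristic W u)) p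
      = dX (a • dX (characteristic V u) + b • dX (characteristic W u)) p by
        unfold dX at he ⊢
        rw [he.fderiv_eq], this]
    simp
  simp only [prolongedAction, etaT, etaY, etaXX, hc, hT, hY, hXX, Pi.add_apply, Pi.smul_apply,
    Prod.fst_add, Prod.snd_add, Prod.smul_fst, Prod.smul_snd, smul_eq_mul]
  ring

lemma smoothFields_comb {Ω : Set BaseSpace} {V W : TotalSpace → TotalSpace}
    (hV : V ∈ smoothFields Ω) (hW : W ∈ smoothFields Ω) (a b : ℝ) :
    a • V + b • W ∈ smoothFields Ω :=
  ⟨fun z hz => by simp [hV.1 z hz, hW.1 z hz], (hV.2.const_smul a).add (hW.2.const_smul b)⟩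

lemma IsLieSymmetry.comb {β : ℝ} {Ω : Set BaseSpace} (hΩ : IsOpen Ω) {V W : TotalSpace → TotalSpace}
    (hV : IsLieSymmetry β Ω V) (hW : IsLieSymmetry β Ω W) (a b : ℝ) :
    IsLieSymmetry β Ω (a • V + b • W) :=
  ⟨smoothFields_comb hV.1 hW.1 a b, fun u hu p hp hs => by
    rw [prolongedAction_comb hΩ hV.1 hW.1 a b hu hp, hV.2 u hu p hp hs, hW.2 u hu p hp hs]
    ring⟩

lemma isLieSymmetry_zero (β : ℝ) (Ω : Set BaseSpace) : IsLieSymmetry β Ω 0 := by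
  refine ⟨⟨fun z _ => rfl, contDiffOn_const⟩, fun u _ p _ _ => ?_⟩
  have hc : characteristic 0 u = fun _ => 0 := by funext q; simp [characteristic]
  have h0 : dX (fun _ : BaseSpace => (0 : ℝ)) = fun _ => 0 := by funext q; simp [dX]
  simp [prolongedAction, etaT, etaY, etaXX, hc, h0, dT, dY]

/-- The linear space `𝔤_β` of all Lie symmetry vector fields cyl the open set `Ω` (the maximal
Lie invariance algebra). -/
noncomputable def maxInvarianceAlgebra (β : ℝ) (Ω : TopologicalSpace.Opens BaseSpace) :
    Submodule ℝ (TotalSpace → TotalSpace) where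
  carrier := {V | IsLieSymmetry β Ω V}
  zero_mem' := isLieSymmetry_zero β Ω
  add_mem' := fun {V W} hV hW => by
    have h := IsLieSymmetry.comb Ω.isOpen hV hW 1 1
    rwa [one_smul, one_smul] at h
  smul_mem' := fun c V hV => by
    have h := IsLieSymmetry.comb Ω.isOpen hV (isLieSymmetry_zero β Ω) c 0
    rwa [smul_zero, add_zero] at h

/-- The space is closed under the Lie bracket of vector fields, i.e. it is a Lie algebra. -/
def IsLieClosed (𝔞 : Submodule ℝ (TotalSpace → TotalSpace)) : Prop :=
  ∀ V ∈ 𝔞, ∀ W ∈ 𝔞, VectorField.lieBracket ℝ V W ∈ 𝔞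

/-! ## The vector fields of the classification -/

/-- `𝒫^t = ∂_t`. -/
noncomputable def Pt (Ω : Set BaseSpace) : TotalSpace → TotalSpace :=
  field Ω (fun _ _ _ _ => 1) (fun _ _ _ _ => 0) (fun _ _ _ _ => 0) (fun _ _ _ _ => 0)

/-- `𝒫^y = ∂_y`. -/
noncomputable def Py (Ω : Set BaseSpace) : TotalSpace → TotalSpace :=
  field Ω (fun _ _ _ _ => 0) (fun _ _ _ _ => 0) (fun _ _ _ _ => 1) (fun _ _ _ _ => 0)

/-- `ℐ = u ∂_u`. -/
noncomputable def fieldI (Ω : Set BaseSpace) : TotalSpace → TotalSpace :=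
  field Ω (fun _ _ _ _ => 0) (fun _ _ _ _ => 0) (fun _ _ _ _ => 0) (fun _ _ _ u => u)

/-- `𝒟^β = (2 - β) t ∂_t + x ∂_x + (3 - β) y ∂_y`. -/
noncomputable def fieldD (β : ℝ) (Ω : Set BaseSpace) : TotalSpace → TotalSpace :=
  field Ω (fun t _ _ _ => (2 - β) * t) (fun _ x _ _ => x) (fun _ _ y _ => (3 - β) * y)
    (fun _ _ _ _ => 0)

/-- `𝒵(f) = f(t, x, y) ∂_u`. -/
noncomputable def fieldZ (Ω : Set BaseSpace) (f : BaseSpace → ℝ) : TotalSpace → TotalSpace :=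
  field Ω (fun _ _ _ _ => 0) (fun _ _ _ _ => 0) (fun _ _ _ _ => 0) (fun t x y _ => f (t, x, y))

/-- `𝒦_2 = 2xy ∂_x + y² ∂_y - xu ∂_u`. -/
noncomputable def K2 (Ω : Set BaseSpace) : TotalSpace → TotalSpace :=
  field Ω (fun _ _ _ _ => 0) (fun _ x y _ => 2 * x * y) (fun _ _ y _ => y ^ 2)
    (fun _ x _ u => -(x * u))

/-- `𝒦_0 = t² ∂_t + (tx + 3y) ∂_x + 3ty ∂_y - (x² + 2t) u ∂_u`. -/
noncomputable def K0 (Ω : Set BaseSpace) : TotalSpace → TotalSpace :=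
  field Ω (fun t _ _ _ => t ^ 2) (fun t x y _ => t * x + 3 * y) (fun t _ y _ => 3 * t * y)
    (fun t x _ u => -((x ^ 2 + 2 * t) * u))

/-- `𝒫^3 = 3t² ∂_x + t³ ∂_y + 3(y - tx) u ∂_u`. -/
noncomputable def P3 (Ω : Set BaseSpace) : TotalSpace → TotalSpace :=
  field Ω (fun _ _ _ _ => 0) (fun t _ _ _ => 3 * t ^ 2) (fun t _ _ _ => t ^ 3)
    (fun t x y u => 3 * (y - t * x) * u)

/-- `𝒫^2 = 2t ∂_x + t² ∂_y - xu ∂_u`. -/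
noncomputable def P2 (Ω : Set BaseSpace) : TotalSpace → TotalSpace :=
  field Ω (fun _ _ _ _ => 0) (fun t _ _ _ => 2 * t) (fun t _ _ _ => t ^ 2)
    (fun _ x _ u => -(x * u))

/-- `𝒫^1 = ∂_x + t ∂_y`. -/
noncomputable def P1 (Ω : Set BaseSpace) : TotalSpace → TotalSpace :=
  field Ω (fun _ _ _ _ => 0) (fun _ _ _ _ => 1) (fun t _ _ _ => t) (fun _ _ _ _ => 0)

/-- `⟨∂_t, ∂_y, u ∂_u, (tx - y) ∂_u, x ∂_u, ∂_u⟩`. -/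
noncomputable def kernelSpan (Ω : Set BaseSpace) : Submodule ℝ (TotalSpace → TotalSpace) :=
  Submodule.span ℝ {Pt Ω, Py Ω, fieldI Ω, fieldZ Ω (fun p => p.1 * p.2.1 - p.2.2),
    fieldZ Ω (fun p => p.2.1), fieldZ Ω (fun _ => 1)}

/-- `𝔤^gen_β = ⟨𝒫^t, 𝒫^y, ℐ, 𝒟^β, 𝒵(f)⟩`, where `f` runs through the solutions on `Ω` of the
equation with parameter `β`. -/
noncomputable def genAlgebra (β : ℝ) (Ω : Set BaseSpace) :
    Submodule ℝ (TotalSpace → TotalSpace) :=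
  Submodule.span ℝ
    ({Pt Ω, Py Ω, fieldI Ω, fieldD β Ω} ∪ {Z | ∃ f ∈ solutions β Ω, Z = fieldZ Ω f})

/-! ## The equivalence group of the class -/

/-- The region `x ≠ 0` of the total space. -/
def regularRegion : Set TotalSpace := {z | z.1.2.1 ≠ 0}

/-- The point transformation `Φ` maps the equation with parameter `β` to the equation with
parameter `β'`: whenever `Φ` maps the graph of `v` near `p` into the graph of `v'` near `p'`, the
jet of `v` at `p` satisfies the former equation if and only if the jet of `v'` at `p'` satisfies
the latter one. -/
def MapsEquation (Φ : OpenPartialHomeomorph TotalSpace TotalSpace) (β β' : ℝ) : Prop :=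
  ∀ (v v' : BaseSpace → ℝ) (p p' : BaseSpace), ContDiffAt ℝ ∞ v p → ContDiffAt ℝ ∞ v' p' →
    (p, v p) ∈ Φ.source → Φ (p, v p) = (p', v' p') →
    (∀ᶠ q in 𝓝 p, (Φ (q, v q)).2 = v' (Φ (q, v q)).1) →
    (SatisfiesAt β v p ↔ SatisfiesAt β' v' p')

/-- The (usual) equivalence pseudogroup of the class of the equations `u_t + x u_y = |x|^β u_xx`,
where `β` runs through `ℝ`. Its elements are the transformations
`(t, x, y, u, β) ↦ (Φ(t, x, y, u), b(β))`, where `Φ` is a (local) point transformation in the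
region `x ≠ 0` that maps, for every `β`, the equation with parameter `β` to the equation with
parameter `b(β)`. -/
structure IsEquivTransformation (Φ : OpenPartialHomeomorph TotalSpace TotalSpace)
    (b : Equiv.Perm ℝ) : Prop where
  nonempty : Φ.source.Nonempty
  source_subset : Φ.source ⊆ regularRegion
  target_subset : Φ.target ⊆ regularRegion
  smooth : ContDiffOn ℝ ∞ Φ Φ.source
  smooth_symm : ContDiffOn ℝ ∞ Φ.symm Φ.target
  smooth_param : ContDiff ℝ ∞ b
  smooth_param_symm : ContDiff ℝ ∞ b.symm
  maps : ∀ β : ℝ, MapsEquation Φ β (b β)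

/-- The equations with parameters `β` and `β'` are related by an equivalence transformation of
the class, possibly defined only locally. -/
def LocallyEquivalent (β β' : ℝ) : Prop :=
  ∃ Φ b, IsEquivTransformation Φ b ∧ b β = β'

/-- The equations with parameters `β` and `β'` are related by an equivalence transformation of
the class that is a diffeomorphism of the entire region `x ≠ 0` onto itself. -/
def GloballyEquivalent (β β' : ℝ) : Prop :=
  ∃ Φ b, IsEquivTransformation Φ b ∧ Φ.source = regularRegion ∧ Φ.target = regularRegion ∧
    b β = β'

/-- The equation with parameter `β` admits an essential Lie symmetry extension: over some domain
its maximal Lie invariance algebra is greater than `𝔤^gen_β`. -/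
def HasEssentialExtension (β : ℝ) : Prop :=
  ∃ Ω : TopologicalSpace.Opens BaseSpace, IsDomainFor β Ω ∧
    genAlgebra β Ω < maxInvarianceAlgebra β Ω

end Kolmogorov

/-!
# Lie symmetries and equivalences of `u_t + x u_y = |x|^β u_xx`

*Symmetries.* In the prolonged action of a field on a jet, all third derivatives of `u` cancel
(`prolongedAction_eq`). Where `x ≠ 0`, the vanishing of the action at all jets that satisfy the
equation forces the components along `t, x, y` to be independent of `u` and the one along `u` to be
affine in `u`, and by continuity this holds on the whole domain
(`IsLieSymmetry.exists_affineField`). So a symmetry is given by five functions `τ, ξ, ζ, η₁, η₀` of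
`t, x, y`, which have to satisfy the determining equations. Among these, `τ_x = ζ_x = 0` and an
equation that expresses `ξ` as a polynomial in `x` of degree two, with coefficients that do not
depend on `x`. Substituting this polynomial into the remaining equations and comparing
coefficients of the powers of `x` (`coeffs_eq_zero`) gives `β ζ_t = 0`,
`(2 - β) ζ_y = (3 - β) τ_t` and `(β - 5) τ_y = 0`, and the values `0, 2, 3, 5` of `β` are those for
which the solution space is greater than that of the generic case (`SymmetryCoeffs.generic`,
`SymmetryCoeffs.two`, `SymmetryCoeffs.zero`; for `3` and `5` it suffices to exhibit one additional
field, `genAlgebra_ne_of_mem`). In each case the symmetries form an explicit family; brackets of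
its members have the required form because the symmetry criterion makes `η₁ f - V f` a solution
for every solution `f` and every symmetry `V` (`isSolutionOn_bracket`). The kernel consists of the
common symmetries of two generic equations (`iInf_maxInvarianceAlgebra`).

*Equivalences.* The transformation `(t, x, y, u) ↦ (σ y, 1 / x, σ t, u / x)`, with `σ` the sign of
`x`, maps the equation with parameter `β` to the one with parameter `5 - β`
(`globallyEquivalent_five_sub`). Conversely, `β ↦ β` and `β ↦ 5 - β` are the only maps of
parameters in the equivalence pseudogroup (`IsEquivTransformation.eq_or_eq_five_sub`), for the
following reason. For a function with prescribed value and differential at a point, the second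
derivative of its image along `x'` depends affinely on its second derivatives
(`IsEquivTransformation.jetRule`). The equations for all `β` are preserved at once, so this
dependence must be a linear one, on `u_xx` alone (`JetRule.apply`), and
`|x'| ^ (b β - b 0) = |x| ^ β`. Hence `x' = ± |x| ^ κ`, the functions `t'` and `y'` depend on `t`
and `y` only, and `∂_t + x ∂_y` is mapped to a multiple of `∂_t' + x' ∂_y'`, the factor being a
power of `|x|` (`transport_of_jetRule`). But for functions `P` and `Q` of `t` and `y` only,
`P + x Q` can be a multiple of a power of `|x|` only for the exponents `0` and `1`
(`exponent_eq_zero_or_one`); applied to `t'` and `y'`, this leaves `κ = 1` with `b β = β`, and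
`κ = -1` with `b β = 5 - β`.
-/

namespace Kolmogorov

/-! ### Directional derivatives of smooth functions -/

section Directional

variable {E : Type*} [NormedAddCommGroup E] [NormedSpace ℝ E]

/-- The derivative of `f` in the direction `e`. The operators `dT`, `dX`, `dY` are the special
cases of the three coordinate directions. -/
noncomputable def dd (e : E) (f : E → ℝ) (p : E) : ℝ := fderiv ℝ f p e

lemma ContDiffOn.differentiableAt' {F : Type*} [NormedAddCommGroup F] [NormedSpace ℝ F]
    {s : Set E} {f : E → F} (hf : ContDiffOn ℝ ∞ f s) (hs : IsOpen s) {p : E} (hp : p ∈ s) :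
    DifferentiableAt ℝ f p :=
  (hf.contDiffAt (hs.mem_nhds hp)).differentiableAt (by simp)

lemma ContDiffOn.dd {s : Set E} {f : E → ℝ} (hf : ContDiffOn ℝ ∞ f s) (hs : IsOpen s) (e : E) :
    ContDiffOn ℝ ∞ (dd e f) s :=
  (hf.fderiv_of_isOpen (m := ∞) hs (by simp)).clm_apply contDiffOn_const

lemma dd_add {f g : E → ℝ} {p : E} (e : E) (hf : DifferentiableAt ℝ f p)
    (hg : DifferentiableAt ℝ g p) :
    dd e (fun q => f q + g q) p = dd e f p + dd e g p := by
  simp [dd, fderiv_fun_add hf hg]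

lemma dd_sub {f g : E → ℝ} {p : E} (e : E) (hf : DifferentiableAt ℝ f p)
    (hg : DifferentiableAt ℝ g p) :
    dd e (fun q => f q - g q) p = dd e f p - dd e g p := by
  simp [dd, fderiv_fun_sub hf hg]

lemma dd_mul {f g : E → ℝ} {p : E} (e : E) (hf : DifferentiableAt ℝ f p)
    (hg : DifferentiableAt ℝ g p) :
    dd e (fun q => f q * g q) p = dd e f p * g p + f p * dd e g p := by
  simp [dd, fderiv_fun_mul hf hg]; ring

lemma dd_const_mul {f : E → ℝ} {p : E} (e : E) (c : ℝ) (hf : DifferentiableAt ℝ f p) :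
    dd e (fun q => c * f q) p = c * dd e f p := by
  simp [dd, fderiv_const_mul hf]

@[simp] lemma dd_const (e : E) (c : ℝ) (p : E) : dd e (fun _ => c) p = 0 := by simp [dd]

lemma dd_neg {f : E → ℝ} {p : E} (e : E) :
    dd e (fun q => - f q) p = - dd e f p := by
  simp [dd]

lemma dd_pow {f : E → ℝ} {p : E} (e : E) (n : ℕ) (hf : DifferentiableAt ℝ f p) :
    dd e (fun q => f q ^ n) p = n * f p ^ (n - 1) * dd e f p := by
  simp [dd, fderiv_fun_pow n hf]

lemma dd_congr {s : Set E} (hs : IsOpen s) {f g : E → ℝ} (h : EqOn f g s) (e : E) :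
    EqOn (dd e f) (dd e g) s := fun p hp => by
  have : f =ᶠ[𝓝 p] g := Filter.eventually_of_mem (hs.mem_nhds hp) h
  simp [dd, this.fderiv_eq]

lemma dd_eq_zero_of_eqOn {s : Set E} (hs : IsOpen s) {f : E → ℝ} {c : ℝ}
    (h : ∀ p ∈ s, f p = c) (e : E) {p : E} (hp : p ∈ s) : dd e f p = 0 := by
  rw [dd_congr hs (g := fun _ => c) h e hp, dd_const]

/-- Mixed directional derivatives commute. -/
lemma dd_comm {s : Set E} (hs : IsOpen s) {f : E → ℝ} (hf : ContDiffOn ℝ ∞ f s) (e e' : E)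
    {p : E} (hp : p ∈ s) : dd e (dd e' f) p = dd e' (dd e f) p := by
  have hc := hf.contDiffAt (hs.mem_nhds hp)
  have hd : DifferentiableAt ℝ (fderiv ℝ f) p :=
    (hc.fderiv_right (m := ∞) (by simp)).differentiableAt (by simp)
  have key : ∀ a b : E, dd a (dd b f) p = fderiv ℝ (fderiv ℝ f) p a b := by
    intro a b
    have : fderiv ℝ (fun q => fderiv ℝ f q b) p
        = (fderiv ℝ (fderiv ℝ f) p).flip b := by
      rw [fderiv_clm_apply hd (by fun_prop)]
      simp
    change fderiv ℝ (fun q => fderiv ℝ f q b) p a = _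
    rw [this]; rfl
  rw [key, key]
  refine hc.isSymmSndFDerivAt ?_ e e'
  rw [minSmoothness_of_isRCLikeNormedField]
  exact WithTop.coe_le_coe.2 (le_top : (2 : ℕ∞) ≤ ⊤)

end Directional

lemma dT_eq_dd : dT = dd (1, 0, 0) := rfl
lemma dX_eq_dd : dX = dd (0, 1, 0) := rfl
lemma dY_eq_dd : dY = dd (0, 0, 1) := rfl

lemma fderiv_apply_eq (f : BaseSpace → ℝ) (p w : BaseSpace) :
    fderiv ℝ f p w = w.1 * dT f p + w.2.1 * dX f p + w.2.2 * dY f p := by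
  have : w = w.1 • ((1, 0, 0) : BaseSpace) + w.2.1 • ((0, 1, 0) : BaseSpace)
      + w.2.2 • ((0, 0, 1) : BaseSpace) := by
    ext <;> simp
  conv_lhs => rw [this]
  simp only [map_add, map_smul, smul_eq_mul, dT, dX, dY]

section Coordinates

variable (e p : BaseSpace)

@[simp] lemma dd_t : dd e (fun q : BaseSpace => q.1) p = e.1 := by
  simp [dd, fderiv_fst]

@[simp] lemma dd_x : dd e (fun q : BaseSpace => q.2.1) p = e.2.1 := by
  have h : HasFDerivAt (fun q : BaseSpace => q.2.1)
      ((ContinuousLinearMap.fst ℝ ℝ ℝ).comp (ContinuousLinearMap.snd ℝ ℝ (ℝ × ℝ))) p :=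
    ((ContinuousLinearMap.fst ℝ ℝ ℝ).comp (ContinuousLinearMap.snd ℝ ℝ (ℝ × ℝ))).hasFDerivAt
  simp [dd, h.fderiv]

@[simp] lemma dd_y : dd e (fun q : BaseSpace => q.2.2) p = e.2.2 := by
  have h : HasFDerivAt (fun q : BaseSpace => q.2.2)
      ((ContinuousLinearMap.snd ℝ ℝ ℝ).comp (ContinuousLinearMap.snd ℝ ℝ (ℝ × ℝ))) p :=
    ((ContinuousLinearMap.snd ℝ ℝ ℝ).comp (ContinuousLinearMap.snd ℝ ℝ (ℝ × ℝ))).hasFDerivAt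
  simp [dd, h.fderiv]

end Coordinates

/-! ### Functions on a domain -/

/-- A smooth function whose three partial derivatives vanish on a connected open set is constant
there. -/
lemma exists_const_of_partials_eq_zero {Ω : Set BaseSpace} (ho : IsOpen Ω) (hc : IsConnected Ω)
    {f : BaseSpace → ℝ} (hf : ContDiffOn ℝ ∞ f Ω) (hT : ∀ p ∈ Ω, dT f p = 0)
    (hX : ∀ p ∈ Ω, dX f p = 0) (hY : ∀ p ∈ Ω, dY f p = 0) : ∃ c, ∀ p ∈ Ω, f p = c := by
  refine ho.exists_is_const_of_fderiv_eq_zero hc.isPreconnected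
    (fun p hp => (ContDiffOn.differentiableAt' hf ho hp).differentiableWithinAt) fun p hp => ?_
  ext1 <;> ext <;> simp [fderiv_apply_eq, hT p hp, hX p hp, hY p hp]

/-- The part of `Ω` outside of the plane `x = 0`. -/
def offPlane (Ω : Set BaseSpace) : Set BaseSpace := {p ∈ Ω | p.2.1 ≠ 0}

lemma isOpen_offPlane {Ω : Set BaseSpace} (ho : IsOpen Ω) : IsOpen (offPlane Ω) :=
  ho.inter (isOpen_ne.preimage (by fun_prop))

/-- A property of `x` that holds for all but finitely many `x` holds at points arbitrarily close
to any point of an open set, so that continuous identities extend from such points. -/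
lemma eq_zero_of_eq_zero_off {Ω : Set BaseSpace} (ho : IsOpen Ω) {F : Set ℝ} (hF : F.Finite)
    {f : BaseSpace → ℝ} (hf : ContinuousOn f Ω) (h : ∀ p ∈ Ω, p.2.1 ∉ F → f p = 0) :
    ∀ p ∈ Ω, f p = 0 := by
  intro p hp
  let c : ℝ → BaseSpace := fun s => (p.1, s, p.2.2)
  have hc : Continuous c := by fun_prop
  have hcp : c p.2.1 = p := rfl
  have hd : p.2.1 ∈ closure (Fᶜ : Set ℝ) := hF.countable.dense_compl ℝ p.2.1
  have hne : (𝓝[Fᶜ] p.2.1).NeBot := mem_closure_iff_nhdsWithin_neBot.1 hd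
  have h1 : Tendsto (fun s => f (c s)) (𝓝[Fᶜ] p.2.1) (𝓝 (f p)) := by
    have h2 : ContinuousAt f (c p.2.1) := hf.continuousAt (ho.mem_nhds hp)
    have h3 : ContinuousAt (f ∘ c) p.2.1 := h2.comp hc.continuousAt
    exact h3.tendsto.mono_left nhdsWithin_le_nhds
  have h4 : (fun s => f (c s)) =ᶠ[𝓝[Fᶜ] p.2.1] fun _ => 0 := by
    have h5 : ∀ᶠ s in 𝓝[Fᶜ] p.2.1, c s ∈ Ω :=
      (hc.continuousAt.eventually (ho.mem_nhds hp)).filter_mono nhdsWithin_le_nhds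
    filter_upwards [h5, self_mem_nhdsWithin] with s hs hs'
    exact h _ hs hs'
  exact tendsto_nhds_unique h1 ((tendsto_congr' h4).2 tendsto_const_nhds)

lemma eq_zero_of_eq_zero_offPlane {Ω : Set BaseSpace} (ho : IsOpen Ω)
    {f : BaseSpace → ℝ} (hf : ContinuousOn f Ω) (h : ∀ p ∈ offPlane Ω, f p = 0) :
    ∀ p ∈ Ω, f p = 0 :=
  eq_zero_of_eq_zero_off ho (finite_singleton 0) hf fun p hp hx => h p ⟨hp, hx⟩

/-- A polynomial of degree two in `x` that vanishes on an open set, with coefficients that do not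
depend on `x`, has zero coefficients. -/
lemma coeffs_eq_zero {Ω : Set BaseSpace} (ho : IsOpen Ω) {A B C : BaseSpace → ℝ}
    (hA : ContDiffOn ℝ ∞ A Ω) (hB : ContDiffOn ℝ ∞ B Ω) (hC : ContDiffOn ℝ ∞ C Ω)
    (hAx : ∀ p ∈ Ω, dX A p = 0) (hBx : ∀ p ∈ Ω, dX B p = 0) (hCx : ∀ p ∈ Ω, dX C p = 0)
    (h : ∀ p ∈ Ω, A p + p.2.1 * B p + p.2.1 ^ 2 * C p = 0) :
    ∀ p ∈ Ω, A p = 0 ∧ B p = 0 ∧ C p = 0 := by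
  rw [dX_eq_dd] at *
  have dA := fun p hp => ContDiffOn.differentiableAt' hA ho (p := p) hp
  have dB := fun p hp => ContDiffOn.differentiableAt' hB ho (p := p) hp
  have dC := fun p hp => ContDiffOn.differentiableAt' hC ho (p := p) hp
  have h1 : ∀ p ∈ Ω, B p + 2 * p.2.1 * C p = 0 := by
    intro p hp
    have := dd_eq_zero_of_eqOn ho h (0, 1, 0) hp
    have e1 := dA p hp
    have e2 := dB p hp
    have e3 := dC p hp
    simp (disch := fun_prop) only [dd_add, dd_mul, dd_pow, dd_x, hAx p hp, hBx p hp, hCx p hp]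
      at this
    norm_num at this
    linarith
  have h2 : ∀ p ∈ Ω, C p = 0 := by
    intro p hp
    have := dd_eq_zero_of_eqOn ho h1 (0, 1, 0) hp
    have e2 := dB p hp
    have e3 := dC p hp
    simp (disch := fun_prop) only [dd_add, dd_mul, dd_const, dd_x, hBx p hp, hCx p hp] at this
    norm_num at this
    linarith
  intro p hp
  have hC0 := h2 p hp
  have hB0 : B p = 0 := by simpa [hC0] using h1 p hp
  exact ⟨by simpa [hC0, hB0] using h p hp, hB0, hC0⟩

lemma dd_of_eqOn {Ω : Set BaseSpace} (ho : IsOpen Ω) {f g : BaseSpace → ℝ}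
    (h : ∀ p ∈ Ω, f p = g p) (e : BaseSpace) : ∀ p ∈ Ω, dd e f p = dd e g p :=
  fun _ hp => dd_congr ho h e hp

/-! ### The prolonged action in terms of total derivatives -/

/-- The prolonged action, when the components of the vector field are evaluated along the graph of
`u`. All derivatives of `u` of order three cancel, and only first total derivatives in `t`, `y`
and first and second ones in `x` of the components remain. -/
lemma prolongedAction_eq {β : ℝ} {Ω : Set BaseSpace} (ho : IsOpen Ω) {V : TotalSpace → TotalSpace}
    {u τ ξ ζ η : BaseSpace → ℝ} (hu : ContDiff ℝ ∞ u)
    (hV : ∀ q ∈ Ω, V (q, u q) = ((τ q, ξ q, ζ q), η q))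
    (hτ : ContDiffOn ℝ ∞ τ Ω) (hξ : ContDiffOn ℝ ∞ ξ Ω) (hζ : ContDiffOn ℝ ∞ ζ Ω)
    (hη : ContDiffOn ℝ ∞ η Ω) {p : BaseSpace} (hp : p ∈ Ω) :
    prolongedAction β V u p =
      (dT η p - dT τ p * dT u p - dT ξ p * dX u p - dT ζ p * dY u p)
      + p.2.1 * (dY η p - dY τ p * dT u p - dY ξ p * dX u p - dY ζ p * dY u p)
      + ξ p * dY u p
      - |p.2.1| ^ β * (dX (dX η) p - dX (dX τ) p * dT u p - dX (dX ξ) p * dX u p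
          - dX (dX ζ) p * dY u p - 2 * dX τ p * dX (dT u) p - 2 * dX ξ p * dX (dX u) p
          - 2 * dX ζ p * dX (dY u) p)
      - ξ p * deriv (fun s : ℝ => |s| ^ β) p.2.1 * dX (dX u) p := by
  have hu' : ContDiffOn ℝ ∞ u Set.univ := hu.contDiffOn
  have hQ : EqOn (characteristic V u)
      (fun q => η q - τ q * dT u q - ξ q * dX u q - ζ q * dY u q) Ω := by
    intro q hq
    simp only [characteristic, hV q hq]
  have comm : ∀ e e' : BaseSpace, dd e (dd e' u) = dd e' (dd e u) := fun e e' => by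
    funext q; exact dd_comm isOpen_univ hu' e e' (mem_univ q)
  have comm1 : ∀ e e' e'' q, dd e (dd e' (dd e'' u)) q = dd e' (dd e (dd e'' u)) q :=
    fun e e' e'' q => dd_comm isOpen_univ (ContDiffOn.dd hu' isOpen_univ e'') e e' (mem_univ q)
  have du : ∀ e q, DifferentiableAt ℝ (dd e u) q := fun e q =>
    ContDiffOn.differentiableAt' (ContDiffOn.dd hu' isOpen_univ e) isOpen_univ (mem_univ q)
  have ddu : ∀ e e' q, DifferentiableAt ℝ (dd e (dd e' u)) q := fun e e' q =>
    ContDiffOn.differentiableAt' (ContDiffOn.dd (ContDiffOn.dd hu' isOpen_univ e') isOpen_univ e)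
      isOpen_univ (mem_univ q)
  have d1 : ∀ e, EqOn (dd e (characteristic V u)) (fun q => dd e η q
      - (dd e τ q * dd (1, 0, 0) u q + τ q * dd e (dd (1, 0, 0) u) q)
      - (dd e ξ q * dd (0, 1, 0) u q + ξ q * dd e (dd (0, 1, 0) u) q)
      - (dd e ζ q * dd (0, 0, 1) u q + ζ q * dd e (dd (0, 0, 1) u) q)) Ω := by
    intro e q hq
    rw [dd_congr ho hQ e hq, dT_eq_dd, dX_eq_dd, dY_eq_dd]
    have e1 := ContDiffOn.differentiableAt' hτ ho hq
    have e2 := ContDiffOn.differentiableAt' hξ ho hq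
    have e3 := ContDiffOn.differentiableAt' hζ ho hq
    have e4 := ContDiffOn.differentiableAt' hη ho hq
    have e5 := du (1, 0, 0) q
    have e6 := du (0, 1, 0) q
    have e7 := du (0, 0, 1) q
    simp (disch := fun_prop) only [dd_sub, dd_mul]
  have d2 : dd (0, 1, 0) (dd (0, 1, 0) (characteristic V u)) p
      = dd (0, 1, 0) (dd (0, 1, 0) η) p
      - (dd (0, 1, 0) (dd (0, 1, 0) τ) p * dd (1, 0, 0) u p
          + 2 * dd (0, 1, 0) τ p * dd (0, 1, 0) (dd (1, 0, 0) u) p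
          + τ p * dd (0, 1, 0) (dd (0, 1, 0) (dd (1, 0, 0) u)) p)
      - (dd (0, 1, 0) (dd (0, 1, 0) ξ) p * dd (0, 1, 0) u p
          + 2 * dd (0, 1, 0) ξ p * dd (0, 1, 0) (dd (0, 1, 0) u) p
          + ξ p * dd (0, 1, 0) (dd (0, 1, 0) (dd (0, 1, 0) u)) p)
      - (dd (0, 1, 0) (dd (0, 1, 0) ζ) p * dd (0, 0, 1) u p
          + 2 * dd (0, 1, 0) ζ p * dd (0, 1, 0) (dd (0, 0, 1) u) p
          + ζ p * dd (0, 1, 0) (dd (0, 1, 0) (dd (0, 0, 1) u)) p) := by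
    rw [dd_congr ho (d1 (0, 1, 0)) (0, 1, 0) hp]
    have e1 := ContDiffOn.differentiableAt' hτ ho hp
    have e2 := ContDiffOn.differentiableAt' hξ ho hp
    have e3 := ContDiffOn.differentiableAt' hζ ho hp
    have f1 := ContDiffOn.differentiableAt' (ContDiffOn.dd hτ ho (0, 1, 0)) ho hp
    have f2 := ContDiffOn.differentiableAt' (ContDiffOn.dd hξ ho (0, 1, 0)) ho hp
    have f3 := ContDiffOn.differentiableAt' (ContDiffOn.dd hζ ho (0, 1, 0)) ho hp
    have f4 := ContDiffOn.differentiableAt' (ContDiffOn.dd hη ho (0, 1, 0)) ho hp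
    have e5 := du (1, 0, 0) p
    have e6 := du (0, 1, 0) p
    have e7 := du (0, 0, 1) p
    have g1 := ddu (0, 1, 0) (1, 0, 0) p
    have g2 := ddu (0, 1, 0) (0, 1, 0) p
    have g3 := ddu (0, 1, 0) (0, 0, 1) p
    simp (disch := fun_prop) only [dd_sub, dd_mul, dd_add]
    ring
  unfold prolongedAction etaT etaY etaXX
  simp only [hV p hp, dT_eq_dd, dX_eq_dd, dY_eq_dd, d1 _ hp, d2]
  rw [comm (0, 1, 0) (1, 0, 0), comm (0, 0, 1) (1, 0, 0), comm (0, 0, 1) (0, 1, 0),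
    comm1 (0, 1, 0) (1, 0, 0) (0, 1, 0) p, comm1 (0, 0, 1) (0, 1, 0) (0, 1, 0) p,
    comm (0, 0, 1) (0, 1, 0)]
  ring

/-- Every jet with `u_tt = u_ty = u_yy = 0` is the jet of a polynomial. -/
lemma exists_jet (p : BaseSpace) (u₀ ut ux uy uxx utx uxy : ℝ) :
    ∃ u : BaseSpace → ℝ, ContDiff ℝ ∞ u ∧ u p = u₀ ∧ dT u p = ut ∧ dX u p = ux ∧ dY u p = uy ∧
      dX (dX u) p = uxx ∧ dX (dT u) p = utx ∧ dX (dY u) p = uxy := by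
  let u : BaseSpace → ℝ := fun q => u₀ + ut * (q.1 - p.1) + ux * (q.2.1 - p.2.1)
    + uy * (q.2.2 - p.2.2) + uxx / 2 * (q.2.1 - p.2.1) ^ 2
    + utx * ((q.1 - p.1) * (q.2.1 - p.2.1)) + uxy * ((q.2.1 - p.2.1) * (q.2.2 - p.2.2))
  have h1 : ∀ e : BaseSpace, dd e u = fun q => ut * e.1 + ux * e.2.1 + uy * e.2.2
      + uxx * (q.2.1 - p.2.1) * e.2.1 + utx * (e.1 * (q.2.1 - p.2.1) + (q.1 - p.1) * e.2.1)
      + uxy * (e.2.1 * (q.2.2 - p.2.2) + (q.2.1 - p.2.1) * e.2.2) := by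
    intro e
    funext q
    simp (disch := fun_prop) only [u, dd_add, dd_sub, dd_mul, dd_pow, dd_const, dd_t, dd_x, dd_y]
    norm_num
    ring
  have h2 : ∀ e : BaseSpace, dd (0, 1, 0) (dd e u) p = uxx * e.2.1 + utx * e.1 + uxy * e.2.2 := by
    intro e
    rw [h1]
    simp (disch := fun_prop) only [dd_add, dd_sub, dd_mul, dd_const, dd_t, dd_x, dd_y]
    norm_num
  refine ⟨u, by fun_prop, by simp [u], ?_, ?_, ?_, ?_, ?_, ?_⟩
  · rw [dT_eq_dd, h1]; simp
  · rw [dX_eq_dd, h1]; simp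
  · rw [dY_eq_dd, h1]; simp
  · rw [dX_eq_dd, h2]; simp
  · rw [dX_eq_dd, dT_eq_dd, h2]; simp
  · rw [dX_eq_dd, dY_eq_dd, h2]; simp

/-! ### Fields that are affine in `u` and their determining equations -/

/-- The field `τ ∂_t + ξ ∂_x + ζ ∂_y + (η₁ u + η₀) ∂_u` over `Ω` with coefficients that depend on
`t, x, y` only. It is extended by zero, like all fields here. -/
noncomputable def affineField (Ω : Set BaseSpace) (τ ξ ζ η₁ η₀ : BaseSpace → ℝ) :
    TotalSpace → TotalSpace :=
  (cyl Ω).indicator fun z => ((τ z.1, ξ z.1, ζ z.1), η₁ z.1 * z.2 + η₀ z.1)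

lemma mem_cyl {Ω : Set BaseSpace} {z : TotalSpace} : z ∈ cyl Ω ↔ z.1 ∈ Ω := by simp [cyl]

lemma affineField_apply {Ω : Set BaseSpace} {τ ξ ζ η₁ η₀ : BaseSpace → ℝ} {z : TotalSpace}
    (hz : z.1 ∈ Ω) :
    affineField Ω τ ξ ζ η₁ η₀ z = ((τ z.1, ξ z.1, ζ z.1), η₁ z.1 * z.2 + η₀ z.1) :=
  indicator_of_mem (mem_cyl.2 hz) _

lemma affineField_congr {Ω : Set BaseSpace} {τ ξ ζ η₁ η₀ τ' ξ' ζ' η₁' η₀' : BaseSpace → ℝ}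
    (hτ : EqOn τ τ' Ω) (hξ : EqOn ξ ξ' Ω) (hζ : EqOn ζ ζ' Ω) (h₁ : EqOn η₁ η₁' Ω)
    (h₀ : EqOn η₀ η₀' Ω) : affineField Ω τ ξ ζ η₁ η₀ = affineField Ω τ' ξ' ζ' η₁' η₀' := by
  refine indicator_congr fun z hz => ?_
  have hz := mem_cyl.1 hz
  simp only [hτ hz, hξ hz, hζ hz, h₁ hz, h₀ hz]

lemma eqOn_of_affineField_eq {Ω : Set BaseSpace} {τ ξ ζ η₁ η₀ τ' ξ' ζ' η₁' η₀' : BaseSpace → ℝ}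
    (h : affineField Ω τ ξ ζ η₁ η₀ = affineField Ω τ' ξ' ζ' η₁' η₀') {p : BaseSpace} (hp : p ∈ Ω) :
    τ p = τ' p ∧ ξ p = ξ' p ∧ ζ p = ζ' p ∧ η₁ p = η₁' p ∧ η₀ p = η₀' p := by
  have h0 := congrFun h (p, 0)
  have h1 := congrFun h (p, 1)
  rw [affineField_apply (z := (p, 0)) hp, affineField_apply (z := (p, 0)) hp] at h0
  rw [affineField_apply (z := (p, 1)) hp, affineField_apply (z := (p, 1)) hp] at h1
  simp only [Prod.mk.injEq, mul_zero, zero_add, mul_one] at h0 h1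
  obtain ⟨⟨a, b, c⟩, d⟩ := h0
  exact ⟨a, b, c, by linarith [h1.2], d⟩

/-- The five coefficients of an affine field are smooth on `Ω`. -/
structure SmoothCoeffs (Ω : Set BaseSpace) (τ ξ ζ η₁ η₀ : BaseSpace → ℝ) : Prop where
  smooth_τ : ContDiffOn ℝ ∞ τ Ω
  smooth_ξ : ContDiffOn ℝ ∞ ξ Ω
  smooth_ζ : ContDiffOn ℝ ∞ ζ Ω
  smooth_η₁ : ContDiffOn ℝ ∞ η₁ Ω
  smooth_η₀ : ContDiffOn ℝ ∞ η₀ Ω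

lemma affineField_mem_smoothFields {Ω : Set BaseSpace} {τ ξ ζ η₁ η₀ : BaseSpace → ℝ}
    (h : SmoothCoeffs Ω τ ξ ζ η₁ η₀) : affineField Ω τ ξ ζ η₁ η₀ ∈ smoothFields Ω := by
  refine ⟨fun z hz => indicator_of_notMem hz _, ?_⟩
  have hm : MapsTo (Prod.fst : TotalSpace → BaseSpace) (cyl Ω) Ω := fun z hz => mem_cyl.1 hz
  have hc : ∀ {f : BaseSpace → ℝ}, ContDiffOn ℝ ∞ f Ω →
      ContDiffOn ℝ ∞ (fun z : TotalSpace => f z.1) (cyl Ω) := fun hf =>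
    hf.comp contDiff_fst.contDiffOn hm
  refine ContDiffOn.congr (f := fun z => ((τ z.1, ξ z.1, ζ z.1), η₁ z.1 * z.2 + η₀ z.1)) ?_
    fun z hz => affineField_apply (mem_cyl.1 hz)
  exact ((hc h.smooth_τ).prodMk ((hc h.smooth_ξ).prodMk (hc h.smooth_ζ))).prodMk
    (((hc h.smooth_η₁).mul contDiff_snd.contDiffOn).add (hc h.smooth_η₀))

/-- The prolonged action of an affine field as a polynomial in the jet of `u`. -/
lemma prolongedAction_affineField {β : ℝ} {Ω : Set BaseSpace} (ho : IsOpen Ω)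
    {τ ξ ζ η₁ η₀ : BaseSpace → ℝ} (h : SmoothCoeffs Ω τ ξ ζ η₁ η₀) {u : BaseSpace → ℝ}
    (hu : ContDiff ℝ ∞ u) {p : BaseSpace} (hp : p ∈ Ω) :
    prolongedAction β (affineField Ω τ ξ ζ η₁ η₀) u p =
      (dT η₁ p + p.2.1 * dY η₁ p - |p.2.1| ^ β * dX (dX η₁) p) * u p
      + (dT η₀ p + p.2.1 * dY η₀ p - |p.2.1| ^ β * dX (dX η₀) p)
      + η₁ p * (dT u p + p.2.1 * dY u p - |p.2.1| ^ β * dX (dX u) p)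
      - (dT τ p + p.2.1 * dY τ p - |p.2.1| ^ β * dX (dX τ) p) * dT u p
      - (dT ξ p + p.2.1 * dY ξ p + 2 * |p.2.1| ^ β * dX η₁ p - |p.2.1| ^ β * dX (dX ξ) p) * dX u p
      + (ξ p - dT ζ p - p.2.1 * dY ζ p + |p.2.1| ^ β * dX (dX ζ) p) * dY u p
      + (2 * |p.2.1| ^ β * dX ξ p - ξ p * deriv (fun s : ℝ => |s| ^ β) p.2.1) * dX (dX u) p
      + 2 * |p.2.1| ^ β * (dX τ p * dX (dT u) p + dX ζ p * dX (dY u) p) := by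
  have hu' : ContDiffOn ℝ ∞ u Ω := hu.contDiffOn
  rw [prolongedAction_eq (τ := τ) (ξ := ξ) (ζ := ζ) (η := fun q => η₁ q * u q + η₀ q) ho hu
    (fun q hq => affineField_apply (z := (q, u q)) hq) h.smooth_τ h.smooth_ξ h.smooth_ζ
    ((h.smooth_η₁.mul hu').add h.smooth_η₀) hp]
  have d1 : ∀ e, EqOn (dd e (fun q => η₁ q * u q + η₀ q))
      (fun q => dd e η₁ q * u q + η₁ q * dd e u q + dd e η₀ q) Ω := by
    intro e q hq
    have e1 := ContDiffOn.differentiableAt' h.smooth_η₁ ho hq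
    have e2 := ContDiffOn.differentiableAt' h.smooth_η₀ ho hq
    have e3 := ContDiffOn.differentiableAt' hu' ho hq
    simp (disch := fun_prop) only [dd_add, dd_mul]
  have d2 : dd (0, 1, 0) (dd (0, 1, 0) (fun q => η₁ q * u q + η₀ q)) p
      = dd (0, 1, 0) (dd (0, 1, 0) η₁) p * u p + 2 * (dd (0, 1, 0) η₁ p * dd (0, 1, 0) u p)
        + η₁ p * dd (0, 1, 0) (dd (0, 1, 0) u) p + dd (0, 1, 0) (dd (0, 1, 0) η₀) p := by
    rw [dd_congr ho (d1 _) _ hp]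
    have e1 := ContDiffOn.differentiableAt' h.smooth_η₁ ho hp
    have e3 := ContDiffOn.differentiableAt' hu' ho hp
    have f1 := ContDiffOn.differentiableAt' (ContDiffOn.dd h.smooth_η₁ ho (0, 1, 0)) ho hp
    have f2 := ContDiffOn.differentiableAt' (ContDiffOn.dd h.smooth_η₀ ho (0, 1, 0)) ho hp
    have f3 := ContDiffOn.differentiableAt' (ContDiffOn.dd hu' ho (0, 1, 0)) ho hp
    simp (disch := fun_prop) only [dd_add, dd_mul]
    ring
  simp only [dT_eq_dd, dX_eq_dd, dY_eq_dd, d1 _ hp, d2]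
  ring

/-- The determining equations for the Lie symmetries among the affine fields. -/
structure DeterminingEquations (β : ℝ) (Ω : Set BaseSpace) (τ ξ ζ η₁ η₀ : BaseSpace → ℝ) :
    Prop where
  τx : ∀ p ∈ Ω, dX τ p = 0
  ζx : ∀ p ∈ Ω, dX ζ p = 0
  uxx : ∀ p ∈ Ω, 2 * |p.2.1| ^ β * dX ξ p - ξ p * deriv (fun s : ℝ => |s| ^ β) p.2.1
    = |p.2.1| ^ β * (dT τ p + p.2.1 * dY τ p)
  uy : ∀ p ∈ Ω, ξ p = dT ζ p + p.2.1 * dY ζ p - p.2.1 * (dT τ p + p.2.1 * dY τ p)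
  ux : ∀ p ∈ Ω, dT ξ p + p.2.1 * dY ξ p + 2 * |p.2.1| ^ β * dX η₁ p
    = |p.2.1| ^ β * dX (dX ξ) p
  eq₁ : ∀ p ∈ Ω, SatisfiesAt β η₁ p
  eq₀ : ∀ p ∈ Ω, SatisfiesAt β η₀ p

lemma isLieSymmetry_affineField {β : ℝ} {Ω : Set BaseSpace} (ho : IsOpen Ω)
    {τ ξ ζ η₁ η₀ : BaseSpace → ℝ} (h : SmoothCoeffs Ω τ ξ ζ η₁ η₀)
    (hd : DeterminingEquations β Ω τ ξ ζ η₁ η₀) :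
    IsLieSymmetry β Ω (affineField Ω τ ξ ζ η₁ η₀) := by
  refine ⟨affineField_mem_smoothFields h, fun u hu p hp hs => ?_⟩
  rw [prolongedAction_affineField ho h hu hp]
  have t2 : dX (dX τ) p = 0 := dd_eq_zero_of_eqOn ho hd.τx _ hp
  have z2 : dX (dX ζ) p = 0 := dd_eq_zero_of_eqOn ho hd.ζx _ hp
  have h1 := hd.eq₁ p hp
  have h0 := hd.eq₀ p hp
  unfold SatisfiesAt at h1 h0 hs
  have hut : dT u p = |p.2.1| ^ β * dX (dX u) p - p.2.1 * dY u p := by linarith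
  have hux := hd.ux p hp
  rw [t2, z2, hd.τx p hp, hd.ζx p hp, hd.uxx p hp, hut, hd.uy p hp]
  linear_combination u p * h1 + h0 - dX u p * hux

/-- Away from the plane `x = 0`, the determining equations are also necessary; the two equations
without derivatives of `u` are necessary everywhere. -/
lemma IsLieSymmetry.determiningEquations {β : ℝ} {Ω : Set BaseSpace} (ho : IsOpen Ω)
    {τ ξ ζ η₁ η₀ : BaseSpace → ℝ} (h : SmoothCoeffs Ω τ ξ ζ η₁ η₀)
    (hL : IsLieSymmetry β Ω (affineField Ω τ ξ ζ η₁ η₀)) :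
    DeterminingEquations β (offPlane Ω) τ ξ ζ η₁ η₀ ∧
      (∀ p ∈ Ω, SatisfiesAt β η₁ p) ∧ ∀ p ∈ Ω, SatisfiesAt β η₀ p := by
  have ho' := isOpen_offPlane ho
  -- The action at an arbitrary jet that satisfies the equation.
  have key : ∀ p ∈ Ω, ∀ u₀ ux uy uxx utx uxy : ℝ,
      (dT η₁ p + p.2.1 * dY η₁ p - |p.2.1| ^ β * dX (dX η₁) p) * u₀
      + (dT η₀ p + p.2.1 * dY η₀ p - |p.2.1| ^ β * dX (dX η₀) p)
      - (dT τ p + p.2.1 * dY τ p - |p.2.1| ^ β * dX (dX τ) p)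
        * (|p.2.1| ^ β * uxx - p.2.1 * uy)
      - (dT ξ p + p.2.1 * dY ξ p + 2 * |p.2.1| ^ β * dX η₁ p - |p.2.1| ^ β * dX (dX ξ) p) * ux
      + (ξ p - dT ζ p - p.2.1 * dY ζ p + |p.2.1| ^ β * dX (dX ζ) p) * uy
      + (2 * |p.2.1| ^ β * dX ξ p - ξ p * deriv (fun s : ℝ => |s| ^ β) p.2.1) * uxx
      + 2 * |p.2.1| ^ β * (dX τ p * utx + dX ζ p * uxy) = 0 := by
    intro p hp u₀ ux uy uxx utx uxy
    obtain ⟨u, hu, h0, h1, h2, h3, h4, h5, h6⟩ :=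
      exists_jet p u₀ (|p.2.1| ^ β * uxx - p.2.1 * uy) ux uy uxx utx uxy
    have := hL.2 u hu p hp (by unfold SatisfiesAt; rw [h1, h3, h4]; ring)
    rw [prolongedAction_affineField ho h hu hp, h0, h1, h2, h3, h4, h5, h6] at this
    linear_combination this
  have hE0 : ∀ p ∈ Ω, SatisfiesAt β η₀ p := fun p hp => by
    have := key p hp 0 0 0 0 0 0
    unfold SatisfiesAt
    linear_combination this
  have hE1 : ∀ p ∈ Ω, SatisfiesAt β η₁ p := fun p hp => by
    have a := key p hp 0 0 0 0 0 0
    have b := key p hp 1 0 0 0 0 0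
    unfold SatisfiesAt
    linear_combination b - a
  have hpos : ∀ p ∈ offPlane Ω, |p.2.1| ^ β ≠ 0 := fun p hp =>
    (Real.rpow_pos_of_pos (abs_pos.2 hp.2) β).ne'
  have hτx : ∀ p ∈ offPlane Ω, dX τ p = 0 := fun p hp => by
    have a := key p hp.1 0 0 0 0 0 0
    have b := key p hp.1 0 0 0 0 1 0
    have : |p.2.1| ^ β * dX τ p = 0 := by linear_combination (b - a) / 2
    exact (mul_eq_zero.1 this).resolve_left (hpos p hp)
  have hζx : ∀ p ∈ offPlane Ω, dX ζ p = 0 := fun p hp => by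
    have a := key p hp.1 0 0 0 0 0 0
    have b := key p hp.1 0 0 0 0 0 1
    have : |p.2.1| ^ β * dX ζ p = 0 := by linear_combination (b - a) / 2
    exact (mul_eq_zero.1 this).resolve_left (hpos p hp)
  have hτxx : ∀ p ∈ offPlane Ω, dX (dX τ) p = 0 := fun p hp => dd_eq_zero_of_eqOn ho' hτx _ hp
  have hζxx : ∀ p ∈ offPlane Ω, dX (dX ζ) p = 0 := fun p hp => dd_eq_zero_of_eqOn ho' hζx _ hp
  refine ⟨⟨hτx, hζx, fun p hp => ?_, fun p hp => ?_, fun p hp => ?_,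
    fun p hp => hE1 p hp.1, fun p hp => hE0 p hp.1⟩, hE1, hE0⟩
  · have a := key p hp.1 0 0 0 0 0 0
    have b := key p hp.1 0 0 0 1 0 0
    rw [hτxx p hp] at a b
    linear_combination b - a
  · have a := key p hp.1 0 0 0 0 0 0
    have b := key p hp.1 0 0 1 0 0 0
    rw [hτxx p hp, hζxx p hp] at a b
    linear_combination b - a
  · have a := key p hp.1 0 0 0 0 0 0
    have b := key p hp.1 0 1 0 0 0 0
    linear_combination a - b

/-! ### Lie symmetries are affine in `u` -/

section Graph

variable {Ω : Set BaseSpace} {G : TotalSpace → ℝ} {u : BaseSpace → ℝ}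

lemma contDiffOn_comp_graph (hG : ContDiffOn ℝ ∞ G (cyl Ω)) (hu : ContDiff ℝ ∞ u) :
    ContDiffOn ℝ ∞ (fun q => G (q, u q)) Ω :=
  hG.comp (contDiff_id.prodMk hu).contDiffOn fun _ hq => mem_cyl.2 hq

/-- The total derivative of a function of `t, x, y, u` along a graph. -/
lemma dd_comp_graph (ho : IsOpen Ω) (hG : ContDiffOn ℝ ∞ G (cyl Ω)) (hu : ContDiff ℝ ∞ u)
    (e : BaseSpace) {p : BaseSpace} (hp : p ∈ Ω) :
    dd e (fun q => G (q, u q)) p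
      = dd (e, 0) G (p, u p) + dd (0, 1) G (p, u p) * dd e u p := by
  have h1 : HasFDerivAt G (fderiv ℝ G (p, u p)) (p, u p) :=
    (ContDiffOn.differentiableAt' hG (isOpen_cyl ho) (mem_cyl.2 hp)).hasFDerivAt
  have h2 : HasFDerivAt (fun q => (q, u q)) ((ContinuousLinearMap.id ℝ BaseSpace).prod
      (fderiv ℝ u p)) p :=
    (hasFDerivAt_id p).prodMk (hu.differentiable (by simp) p).hasFDerivAt
  have h3 : HasFDerivAt (fun q => G (q, u q)) _ p := h1.comp p h2
  have h4 : ((e, fderiv ℝ u p e) : TotalSpace) = (e, 0) + fderiv ℝ u p e • (0, 1) := by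
    ext <;> simp
  simp only [dd, h3.fderiv, ContinuousLinearMap.comp_apply, ContinuousLinearMap.prod_apply,
    ContinuousLinearMap.id_apply]
  rw [h4, map_add, map_smul, smul_eq_mul, mul_comm]

/-- The second total derivative along a graph. -/
lemma dd_dd_comp_graph (ho : IsOpen Ω) (hG : ContDiffOn ℝ ∞ G (cyl Ω)) (hu : ContDiff ℝ ∞ u)
    (e : BaseSpace) {p : BaseSpace} (hp : p ∈ Ω) :
    dd e (dd e (fun q => G (q, u q))) p
      = dd (e, 0) (dd (e, 0) G) (p, u p) + 2 * dd (e, 0) (dd (0, 1) G) (p, u p) * dd e u p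
        + dd (0, 1) (dd (0, 1) G) (p, u p) * dd e u p ^ 2
        + dd (0, 1) G (p, u p) * dd e (dd e u) p := by
  have hc := isOpen_cyl ho
  have h1 := ContDiffOn.dd hG hc (e, 0)
  have h2 := ContDiffOn.dd hG hc (0, 1)
  have hu' := ContDiffOn.dd hu.contDiffOn isOpen_univ (s := univ) e
  rw [dd_congr ho (fun q hq => dd_comp_graph ho hG hu e hq) e hp]
  have d1 := ContDiffOn.differentiableAt' (contDiffOn_comp_graph h1 hu) ho hp
  have d2 := ContDiffOn.differentiableAt' (contDiffOn_comp_graph h2 hu) ho hp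
  have d3 := ContDiffOn.differentiableAt' hu' isOpen_univ (mem_univ p)
  rw [dd_add _ d1 (d2.fun_mul d3), dd_mul _ d2 d3, dd_comp_graph ho h1 hu e hp,
    dd_comp_graph ho h2 hu e hp, dd_comm hc hG (0, 1) (e, 0) (mem_cyl.2 hp)]
  ring

lemma hasDerivAt_fiber (ho : IsOpen Ω) (hG : ContDiffOn ℝ ∞ G (cyl Ω)) {q : BaseSpace}
    (hq : q ∈ Ω) (s : ℝ) : HasDerivAt (fun s => G (q, s)) (dd (0, 1) G (q, s)) s := by
  have h1 : HasFDerivAt G (fderiv ℝ G (q, s)) (q, s) :=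
    (ContDiffOn.differentiableAt' hG (isOpen_cyl ho) (mem_cyl.2 hq)).hasFDerivAt
  have h2 : HasDerivAt (fun s : ℝ => ((q, s) : TotalSpace)) (0, 1) s :=
    (hasDerivAt_const s q).prodMk (hasDerivAt_id s)
  exact h1.comp_hasDerivAt s h2

lemma fiber_const (ho : IsOpen Ω) (hG : ContDiffOn ℝ ∞ G (cyl Ω)) {q : BaseSpace}
    (hq : q ∈ Ω) (h : ∀ s, dd (0, 1) G (q, s) = 0) (s : ℝ) : G (q, s) = G (q, 0) :=
  is_const_of_deriv_eq_zero (f := fun s => G (q, s))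
    (fun s => (hasDerivAt_fiber ho hG hq s).differentiableAt)
    (fun s => by rw [(hasDerivAt_fiber ho hG hq s).deriv, h s]) s 0

lemma fiber_affine (ho : IsOpen Ω) (hG : ContDiffOn ℝ ∞ G (cyl Ω)) {q : BaseSpace}
    (hq : q ∈ Ω) (h : ∀ s, dd (0, 1) (dd (0, 1) G) (q, s) = 0) (s : ℝ) :
    G (q, s) = (G (q, 1) - G (q, 0)) * s + G (q, 0) := by
  have h1 := fiber_const ho (ContDiffOn.dd hG (isOpen_cyl ho) (0, 1)) hq h
  have h2 : ∀ s, HasDerivAt (fun s => G (q, s) - dd (0, 1) G (q, 0) * s) 0 s := fun s => by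
    have := (hasDerivAt_fiber ho hG hq s).fun_sub ((hasDerivAt_id s).const_mul (dd (0, 1) G (q, 0)))
    rw [h1 s] at this
    simpa using this
  have h3 : ∀ s, G (q, s) - dd (0, 1) G (q, 0) * s = G (q, 0) - dd (0, 1) G (q, 0) * 0 :=
    fun s => is_const_of_deriv_eq_zero (fun s => (h2 s).differentiableAt)
      (fun s => (h2 s).deriv) s 0
  have a := h3 s
  have b := h3 1
  linear_combination a - s * b

end Graph

/-- The components of a Lie symmetry at points with `x ≠ 0`: those in the directions of
`t, x, y` do not depend on `u`, and the one in the direction of `u` is affine in `u`. -/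
lemma IsLieSymmetry.dd_fiber_eq_zero {β : ℝ} {Ω : Set BaseSpace} (ho : IsOpen Ω)
    {V : TotalSpace → TotalSpace} (hL : IsLieSymmetry β Ω V) {p : BaseSpace}
    (hp : p ∈ offPlane Ω) (u₀ : ℝ) :
    dd (0, 1) (fun z => (V z).1.1) (p, u₀) = 0 ∧ dd (0, 1) (fun z => (V z).1.2.1) (p, u₀) = 0 ∧
    dd (0, 1) (fun z => (V z).1.2.2) (p, u₀) = 0 ∧
    dd (0, 1) (dd (0, 1) (fun z => (V z).2)) (p, u₀) = 0 := by
  have ho' := isOpen_offPlane ho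
  set Ω' := offPlane Ω with hΩ'
  have hV : ContDiffOn ℝ ∞ V (cyl Ω') := hL.1.2.mono fun z hz => mem_cyl.2 (mem_cyl.1 hz).1
  set τ : TotalSpace → ℝ := fun z => (V z).1.1 with hτd
  set ξ : TotalSpace → ℝ := fun z => (V z).1.2.1 with hξd
  set ζ : TotalSpace → ℝ := fun z => (V z).1.2.2 with hζd
  set η : TotalSpace → ℝ := fun z => (V z).2 with hηd
  have hτ : ContDiffOn ℝ ∞ τ (cyl Ω') := hV.fst.fst
  have hξ : ContDiffOn ℝ ∞ ξ (cyl Ω') := hV.fst.snd.fst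
  have hζ : ContDiffOn ℝ ∞ ζ (cyl Ω') := hV.fst.snd.snd
  have hη : ContDiffOn ℝ ∞ η (cyl Ω') := hV.snd
  have hpos : ∀ p ∈ Ω', |p.2.1| ^ β ≠ 0 := fun p hp =>
    (Real.rpow_pos_of_pos (abs_pos.2 hp.2) β).ne'
  -- The action at a jet with `u_y = 0` that satisfies the equation.
  have jet : ∀ p ∈ Ω', ∀ u₀ ux uxx utx uxy : ℝ,
      (dd ((1, 0, 0), 0) η (p, u₀) + dd (0, 1) η (p, u₀) * (|p.2.1| ^ β * uxx)
        - (dd ((1, 0, 0), 0) τ (p, u₀) + dd (0, 1) τ (p, u₀) * (|p.2.1| ^ β * uxx))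
          * (|p.2.1| ^ β * uxx)
        - (dd ((1, 0, 0), 0) ξ (p, u₀) + dd (0, 1) ξ (p, u₀) * (|p.2.1| ^ β * uxx)) * ux)
      + p.2.1 * (dd ((0, 0, 1), 0) η (p, u₀) - dd ((0, 0, 1), 0) τ (p, u₀) * (|p.2.1| ^ β * uxx)
        - dd ((0, 0, 1), 0) ξ (p, u₀) * ux)
      - |p.2.1| ^ β * ((dd ((0, 1, 0), 0) (dd ((0, 1, 0), 0) η) (p, u₀)
            + 2 * dd ((0, 1, 0), 0) (dd (0, 1) η) (p, u₀) * ux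
            + dd (0, 1) (dd (0, 1) η) (p, u₀) * ux ^ 2 + dd (0, 1) η (p, u₀) * uxx)
          - (dd ((0, 1, 0), 0) (dd ((0, 1, 0), 0) τ) (p, u₀)
            + 2 * dd ((0, 1, 0), 0) (dd (0, 1) τ) (p, u₀) * ux
            + dd (0, 1) (dd (0, 1) τ) (p, u₀) * ux ^ 2 + dd (0, 1) τ (p, u₀) * uxx)
            * (|p.2.1| ^ β * uxx)
          - (dd ((0, 1, 0), 0) (dd ((0, 1, 0), 0) ξ) (p, u₀)
            + 2 * dd ((0, 1, 0), 0) (dd (0, 1) ξ) (p, u₀) * ux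
            + dd (0, 1) (dd (0, 1) ξ) (p, u₀) * ux ^ 2 + dd (0, 1) ξ (p, u₀) * uxx) * ux
          - 2 * (dd ((0, 1, 0), 0) τ (p, u₀) + dd (0, 1) τ (p, u₀) * ux) * utx
          - 2 * (dd ((0, 1, 0), 0) ξ (p, u₀) + dd (0, 1) ξ (p, u₀) * ux) * uxx
          - 2 * (dd ((0, 1, 0), 0) ζ (p, u₀) + dd (0, 1) ζ (p, u₀) * ux) * uxy)
      - ξ (p, u₀) * deriv (fun s : ℝ => |s| ^ β) p.2.1 * uxx = 0 := by
    intro p hp u₀ ux uxx utx uxy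
    obtain ⟨u, hu, h0, h1, h2, h3, h4, h5, h6⟩ :=
      exists_jet p u₀ (|p.2.1| ^ β * uxx) ux 0 uxx utx uxy
    have := (prolongedAction_eq (β := β) ho' (V := V) hu
      (τ := fun q => τ (q, u q)) (ξ := fun q => ξ (q, u q)) (ζ := fun q => ζ (q, u q))
      (η := fun q => η (q, u q)) (fun q _ => rfl)
      (contDiffOn_comp_graph hτ hu) (contDiffOn_comp_graph hξ hu) (contDiffOn_comp_graph hζ hu)
      (contDiffOn_comp_graph hη hu) hp).symm.trans
        (hL.2 u hu p hp.1 (by unfold SatisfiesAt; rw [h1, h3, h4]; ring))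
    rw [h1, h2, h3, h4, h5, h6] at this
    rw [dT_eq_dd, dX_eq_dd, dY_eq_dd] at *
    simp only [dd_comp_graph ho' hτ hu _ hp, dd_comp_graph ho' hξ hu _ hp,
      dd_comp_graph ho' hζ hu _ hp, dd_comp_graph ho' hη hu _ hp, dd_dd_comp_graph ho' hτ hu _ hp,
      dd_dd_comp_graph ho' hξ hu _ hp, dd_dd_comp_graph ho' hζ hu _ hp,
      dd_dd_comp_graph ho' hη hu _ hp, h0, h1, h2, h3, h4] at this
    linear_combination this
  -- The coefficients of `u_tx` and `u_xy`.
  have fτ : ∀ z ∈ cyl Ω', dd (0, 1) τ z = 0 ∧ dd ((0, 1, 0), 0) τ z = 0 := by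
    rintro ⟨p, u₀⟩ hz
    have hp := mem_cyl.1 hz
    have a : |p.2.1| ^ β * dd ((0, 1, 0), 0) τ (p, u₀) = 0 := by
      linear_combination (jet p hp u₀ 0 0 1 0 - jet p hp u₀ 0 0 0 0) / 2
    have b : |p.2.1| ^ β * dd (0, 1) τ (p, u₀) = 0 := by
      linear_combination (jet p hp u₀ 1 0 1 0 - jet p hp u₀ 1 0 0 0) / 2 - a
    exact ⟨(mul_eq_zero.1 b).resolve_left (hpos p hp), (mul_eq_zero.1 a).resolve_left (hpos p hp)⟩
  have fζ : ∀ p ∈ Ω', ∀ u₀, dd (0, 1) ζ (p, u₀) = 0 := by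
    intro p hp u₀
    have b : |p.2.1| ^ β * dd (0, 1) ζ (p, u₀) = 0 := by
      linear_combination (jet p hp u₀ 1 0 0 1 - jet p hp u₀ 1 0 0 0
        - jet p hp u₀ 0 0 0 1 + jet p hp u₀ 0 0 0 0) / 2
    exact (mul_eq_zero.1 b).resolve_left (hpos p hp)
  have hc := isOpen_cyl ho'
  have τux : ∀ z ∈ cyl Ω', dd ((0, 1, 0), 0) (dd (0, 1) τ) z = 0 := fun z hz =>
    dd_eq_zero_of_eqOn hc (fun w hw => (fτ w hw).1) _ hz
  have τuu : ∀ z ∈ cyl Ω', dd (0, 1) (dd (0, 1) τ) z = 0 := fun z hz =>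
    dd_eq_zero_of_eqOn hc (fun w hw => (fτ w hw).1) _ hz
  -- The coefficient of `u_x u_xx`.
  have fξ : ∀ z ∈ cyl Ω', dd (0, 1) ξ z = 0 := by
    rintro ⟨p, u₀⟩ hz
    have hp := mem_cyl.1 hz
    have b : |p.2.1| ^ β * dd (0, 1) ξ (p, u₀) = 0 := by
      linear_combination (jet p hp u₀ 1 1 0 0 - jet p hp u₀ 1 0 0 0
        - jet p hp u₀ 0 1 0 0 + jet p hp u₀ 0 0 0 0) / 2
        - (|p.2.1| ^ β) ^ 2 * τux _ hz - (|p.2.1| ^ β) ^ 2 * τuu _ hz / 2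
    exact (mul_eq_zero.1 b).resolve_left (hpos p hp)
  have ξux : ∀ z ∈ cyl Ω', dd ((0, 1, 0), 0) (dd (0, 1) ξ) z = 0 := fun z hz =>
    dd_eq_zero_of_eqOn hc fξ _ hz
  refine ⟨(fτ _ (mem_cyl.2 hp)).1, fξ _ (mem_cyl.2 hp), fζ p hp u₀, ?_⟩
  -- The coefficient of `u_x²`.
  have b : |p.2.1| ^ β * dd (0, 1) (dd (0, 1) η) (p, u₀) = 0 := by
    linear_combination -(jet p hp u₀ 1 0 0 0 + jet p hp u₀ (-1) 0 0 0
        - 2 * jet p hp u₀ 0 0 0 0) / 2 + 2 * |p.2.1| ^ β * ξux (p, u₀) (mem_cyl.2 hp)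
  exact (mul_eq_zero.1 b).resolve_left (hpos p hp)

/-- Every Lie symmetry is an affine field. -/
lemma IsLieSymmetry.exists_affineField {β : ℝ} {Ω : Set BaseSpace} (ho : IsOpen Ω)
    {V : TotalSpace → TotalSpace} (hL : IsLieSymmetry β Ω V) :
    ∃ τ ξ ζ η₁ η₀ : BaseSpace → ℝ, SmoothCoeffs Ω τ ξ ζ η₁ η₀ ∧
      V = affineField Ω τ ξ ζ η₁ η₀ := by
  have ho' := isOpen_offPlane ho
  have hV := hL.1.2
  have hV' : ContDiffOn ℝ ∞ V (cyl (offPlane Ω)) :=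
    hV.mono fun z hz => mem_cyl.2 (mem_cyl.1 hz).1
  have sm : ∀ s : ℝ, ContDiffOn ℝ ∞ (fun q : BaseSpace => V (q, s)) Ω := fun s =>
    hV.comp (contDiff_id.prodMk contDiff_const).contDiffOn fun q hq => mem_cyl.2 hq
  have d := fun p hp u₀ => hL.dd_fiber_eq_zero ho (p := p) hp u₀
  refine ⟨fun q => (V (q, 0)).1.1, fun q => (V (q, 0)).1.2.1, fun q => (V (q, 0)).1.2.2,
    fun q => (V (q, 1)).2 - (V (q, 0)).2, fun q => (V (q, 0)).2,
    ⟨(sm 0).fst.fst, (sm 0).fst.snd.fst, (sm 0).fst.snd.snd, (sm 1).snd.sub (sm 0).snd,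
      (sm 0).snd⟩, ?_⟩
  funext ⟨q, s⟩
  by_cases hq : q ∈ Ω
  · rw [affineField_apply (z := (q, s)) hq]
    have h1 := eq_zero_of_eq_zero_offPlane ho
      (f := fun q => (V (q, s)).1.1 - (V (q, 0)).1.1)
      ((sm s).fst.fst.sub (sm 0).fst.fst).continuousOn
      (fun p hp => sub_eq_zero.2 (fiber_const ho' hV'.fst.fst hp (fun s => (d p hp s).1) s)) q hq
    have h2 := eq_zero_of_eq_zero_offPlane ho
      (f := fun q => (V (q, s)).1.2.1 - (V (q, 0)).1.2.1)
      ((sm s).fst.snd.fst.sub (sm 0).fst.snd.fst).continuousOn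
      (fun p hp => sub_eq_zero.2
        (fiber_const ho' hV'.fst.snd.fst hp (fun s => (d p hp s).2.1) s)) q hq
    have h3 := eq_zero_of_eq_zero_offPlane ho
      (f := fun q => (V (q, s)).1.2.2 - (V (q, 0)).1.2.2)
      ((sm s).fst.snd.snd.sub (sm 0).fst.snd.snd).continuousOn
      (fun p hp => sub_eq_zero.2
        (fiber_const ho' hV'.fst.snd.snd hp (fun s => (d p hp s).2.2.1) s)) q hq
    have h4 := eq_zero_of_eq_zero_offPlane ho
      (f := fun q => (V (q, s)).2 - (((V (q, 1)).2 - (V (q, 0)).2) * s + (V (q, 0)).2))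
      ((sm s).snd.sub ((((sm 1).snd.sub (sm 0).snd).mul contDiffOn_const).add
        (sm 0).snd)).continuousOn
      (fun p hp => sub_eq_zero.2
        (fiber_affine ho' hV'.snd hp (fun s => (d p hp s).2.2.2) s)) q hq
    ext
    exacts [sub_eq_zero.1 h1, sub_eq_zero.1 h2, sub_eq_zero.1 h3, sub_eq_zero.1 h4]
  · rw [hL.1.1 _ (fun h => hq (mem_cyl.1 h))]
    exact (indicator_of_notMem (fun h => hq (mem_cyl.1 h)) _).symm

/-! ### Integration of the determining equations -/

lemma mul_deriv_abs_rpow (β x : ℝ) : x * deriv (fun s : ℝ => |s| ^ β) x = β * |x| ^ β := by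
  rcases eq_or_ne x 0 with rfl | hx
  · rcases eq_or_ne β 0 with rfl | hβ
    · simp
    · simp [Real.zero_rpow hβ]
  · have h := (hasDerivAt_abs hx).rpow_const (p := β) (Or.inl (abs_pos.2 hx).ne')
    rw [h.deriv, Real.rpow_sub_one (abs_pos.2 hx).ne']
    have h1 : x * (SignType.sign x : ℝ) = |x| := by rw [mul_comm, sign_mul_self]
    have h2 := (abs_pos.2 hx).ne'
    field_simp
    linear_combination β * h1

/-- The consequences of the determining equations that hold for every `β`, on all of `Ω`. The
equation `ux` is the only one that is restricted to points with `x ≠ 0`. -/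
structure SymmetryCoeffs (β : ℝ) (Ω : Set BaseSpace) (τ ξ ζ η₁ η₀ : BaseSpace → ℝ) : Prop
    extends SmoothCoeffs Ω τ ξ ζ η₁ η₀ where
  τx : ∀ p ∈ Ω, dd (0, 1, 0) τ p = 0
  ζx : ∀ p ∈ Ω, dd (0, 1, 0) ζ p = 0
  ξ_eq : ∀ p ∈ Ω, ξ p = dd (1, 0, 0) ζ p + p.2.1 * dd (0, 0, 1) ζ p
    - p.2.1 * (dd (1, 0, 0) τ p + p.2.1 * dd (0, 0, 1) τ p)
  ζt : ∀ p ∈ Ω, β * dd (1, 0, 0) ζ p = 0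
  ζy : ∀ p ∈ Ω, (2 - β) * dd (0, 0, 1) ζ p = (3 - β) * dd (1, 0, 0) τ p
  τy : ∀ p ∈ Ω, (β - 5) * dd (0, 0, 1) τ p = 0
  ux : ∀ p ∈ offPlane Ω, dd (1, 0, 0) ξ p + p.2.1 * dd (0, 0, 1) ξ p
    + 2 * |p.2.1| ^ β * dd (0, 1, 0) η₁ p = |p.2.1| ^ β * dd (0, 1, 0) (dd (0, 1, 0) ξ) p
  eq₁ : ∀ p ∈ Ω, SatisfiesAt β η₁ p
  eq₀ : ∀ p ∈ Ω, SatisfiesAt β η₀ p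

lemma IsLieSymmetry.exists_symmetryCoeffs {β : ℝ} {Ω : Set BaseSpace} (ho : IsOpen Ω)
    {V : TotalSpace → TotalSpace} (hL : IsLieSymmetry β Ω V) :
    ∃ τ ξ ζ η₁ η₀ : BaseSpace → ℝ, SymmetryCoeffs β Ω τ ξ ζ η₁ η₀ ∧
      V = affineField Ω τ ξ ζ η₁ η₀ := by
  obtain ⟨τ, ξ, ζ, η₁, η₀, hs, rfl⟩ := hL.exists_affineField ho
  obtain ⟨hd, hE1, hE0⟩ := IsLieSymmetry.determiningEquations ho hs hL
  have cx : ContinuousOn (fun p : BaseSpace => p.2.1) Ω := by fun_prop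
  have cζt := ContDiffOn.dd hs.smooth_ζ ho (1, 0, 0)
  have cζy := ContDiffOn.dd hs.smooth_ζ ho (0, 0, 1)
  have cτt := ContDiffOn.dd hs.smooth_τ ho (1, 0, 0)
  have cτy := ContDiffOn.dd hs.smooth_τ ho (0, 0, 1)
  have hτx : ∀ p ∈ Ω, dd (0, 1, 0) τ p = 0 :=
    eq_zero_of_eq_zero_offPlane ho (ContDiffOn.dd hs.smooth_τ ho _).continuousOn hd.τx
  have hζx : ∀ p ∈ Ω, dd (0, 1, 0) ζ p = 0 :=
    eq_zero_of_eq_zero_offPlane ho (ContDiffOn.dd hs.smooth_ζ ho _).continuousOn hd.ζx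
  have hξ : ∀ p ∈ Ω, ξ p = dd (1, 0, 0) ζ p + p.2.1 * dd (0, 0, 1) ζ p
      - p.2.1 * (dd (1, 0, 0) τ p + p.2.1 * dd (0, 0, 1) τ p) := by
    have := eq_zero_of_eq_zero_offPlane ho (f := fun p => ξ p - (dd (1, 0, 0) ζ p
      + p.2.1 * dd (0, 0, 1) ζ p - p.2.1 * (dd (1, 0, 0) τ p + p.2.1 * dd (0, 0, 1) τ p)))
      (hs.smooth_ξ.continuousOn.sub ((cζt.continuousOn.add (cx.mul cζy.continuousOn)).sub
        (cx.mul (cτt.continuousOn.add (cx.mul cτy.continuousOn)))))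
      (fun p hp => sub_eq_zero.2 (hd.uy p hp))
    exact fun p hp => sub_eq_zero.1 (this p hp)
  have comm0 : ∀ {f : BaseSpace → ℝ}, ContDiffOn ℝ ∞ f Ω → (∀ p ∈ Ω, dd (0, 1, 0) f p = 0) →
      ∀ e, ∀ p ∈ Ω, dd (0, 1, 0) (dd e f) p = 0 := fun hf h e p hp => by
    rw [dd_comm ho hf _ _ hp]; exact dd_eq_zero_of_eqOn ho h _ hp
  have hξx : ∀ p ∈ Ω, dd (0, 1, 0) ξ p
      = dd (0, 0, 1) ζ p - dd (1, 0, 0) τ p - 2 * p.2.1 * dd (0, 0, 1) τ p := by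
    intro p hp
    rw [dd_of_eqOn ho hξ _ p hp]
    have e1 := ContDiffOn.differentiableAt' cζt ho hp
    have e2 := ContDiffOn.differentiableAt' cζy ho hp
    have e3 := ContDiffOn.differentiableAt' cτt ho hp
    have e4 := ContDiffOn.differentiableAt' cτy ho hp
    simp (disch := fun_prop) only [dd_add, dd_sub, dd_mul, dd_x, comm0 hs.smooth_τ hτx _ p hp,
      comm0 hs.smooth_ζ hζx _ p hp]
    ring
  have hpoly : ∀ p ∈ Ω, -β * dd (1, 0, 0) ζ p
      + p.2.1 * ((2 - β) * dd (0, 0, 1) ζ p - (3 - β) * dd (1, 0, 0) τ p)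
      + p.2.1 ^ 2 * ((β - 5) * dd (0, 0, 1) τ p) = 0 := by
    refine eq_zero_of_eq_zero_offPlane ho ?_ fun p hp => ?_
    · exact ((continuousOn_const.mul cζt.continuousOn).add (cx.mul
        ((continuousOn_const.mul cζy.continuousOn).sub
          (continuousOn_const.mul cτt.continuousOn)))).add
        ((cx.pow 2).mul (continuousOn_const.mul cτy.continuousOn))
    · have h1 := hd.uxx p hp
      have h2 := mul_deriv_abs_rpow β p.2.1
      have h3 : |p.2.1| ^ β ≠ 0 := (Real.rpow_pos_of_pos (abs_pos.2 hp.2) β).ne'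
      rw [dX_eq_dd, hξx p hp.1, hξ p hp.1] at h1
      rw [dT_eq_dd, dY_eq_dd] at h1
      refine (mul_eq_zero.1 (?_ : |p.2.1| ^ β * _ = 0)).resolve_left h3
      linear_combination p.2.1 * h1 + (dd (1, 0, 0) ζ p + p.2.1 * dd (0, 0, 1) ζ p
        - p.2.1 * (dd (1, 0, 0) τ p + p.2.1 * dd (0, 0, 1) τ p)) * h2
  have hco := coeffs_eq_zero ho (contDiffOn_const.mul cζt)
    ((contDiffOn_const.mul cζy).sub (contDiffOn_const.mul cτt)) (contDiffOn_const.mul cτy)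
    (fun p hp => by
      rw [dX_eq_dd, dd_const_mul _ _ (ContDiffOn.differentiableAt' cζt ho hp),
        comm0 hs.smooth_ζ hζx _ p hp, mul_zero])
    (fun p hp => by
      have e2 := ContDiffOn.differentiableAt' cζy ho hp
      have e3 := ContDiffOn.differentiableAt' cτt ho hp
      rw [dX_eq_dd, dd_sub _ (e2.const_mul _) (e3.const_mul _), dd_const_mul _ _ e2,
        dd_const_mul _ _ e3, comm0 hs.smooth_ζ hζx _ p hp, comm0 hs.smooth_τ hτx _ p hp]
      ring)
    (fun p hp => by
      rw [dX_eq_dd, dd_const_mul _ _ (ContDiffOn.differentiableAt' cτy ho hp),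
        comm0 hs.smooth_τ hτx _ p hp, mul_zero]) hpoly
  exact ⟨τ, ξ, ζ, η₁, η₀, { hs with
    τx := hτx
    ζx := hζx
    ξ_eq := hξ
    ζt := fun p hp => by linear_combination -(hco p hp).1
    ζy := fun p hp => by linear_combination (hco p hp).2.1
    τy := fun p hp => (hco p hp).2.2
    ux := hd.ux
    eq₁ := hE1
    eq₀ := hE0 }, rfl⟩

/-- Two smooth functions with the same gradient on a connected open set differ by a constant. -/
lemma exists_eq_add_const {Ω : Set BaseSpace} (ho : IsOpen Ω) (hc : IsConnected Ω)
    {f : BaseSpace → ℝ} (hf : ContDiffOn ℝ ∞ f Ω) (g : BaseSpace → ℝ) (hg : ContDiff ℝ ∞ g)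
    (hT : ∀ p ∈ Ω, dd (1, 0, 0) f p = dd (1, 0, 0) g p)
    (hX : ∀ p ∈ Ω, dd (0, 1, 0) f p = dd (0, 1, 0) g p)
    (hY : ∀ p ∈ Ω, dd (0, 0, 1) f p = dd (0, 0, 1) g p) : ∃ c, ∀ p ∈ Ω, f p = g p + c := by
  have d : ∀ e, ∀ p ∈ Ω, dd e (fun q => f q - g q) p = dd e f p - dd e g p := fun e p hp =>
    dd_sub e (ContDiffOn.differentiableAt' hf ho hp) (hg.differentiable (by simp) p)
  obtain ⟨c, hc⟩ := exists_const_of_partials_eq_zero ho hc (hf.sub hg.contDiffOn)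
    (fun p hp => (d _ p hp).trans (sub_eq_zero.2 (hT p hp)))
    (fun p hp => (d _ p hp).trans (sub_eq_zero.2 (hX p hp)))
    (fun p hp => (d _ p hp).trans (sub_eq_zero.2 (hY p hp)))
  exact ⟨c, fun p hp => by linear_combination hc p hp⟩

/-- The derivatives of a function without dependence on a coordinate do not depend on it. -/
lemma dd_dd_eq_zero {E : Type*} [NormedAddCommGroup E] [NormedSpace ℝ E] {Ω : Set E}
    (ho : IsOpen Ω) {f : E → ℝ} (hf : ContDiffOn ℝ ∞ f Ω) {e : E} (h : ∀ p ∈ Ω, dd e f p = 0)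
    (e' : E) :
    ∀ p ∈ Ω, dd e (dd e' f) p = 0 := fun p hp => by
  rw [dd_comm ho hf _ _ hp]; exact dd_eq_zero_of_eqOn ho h _ hp

/-- If `h` does not depend on `x` and `h_t + x h_y` vanishes, then `h` is constant. -/
lemma exists_const_of_transport {Ω : Set BaseSpace} (ho : IsOpen Ω) (hc : IsConnected Ω)
    {h : BaseSpace → ℝ} (hh : ContDiffOn ℝ ∞ h Ω) (hx : ∀ p ∈ Ω, dd (0, 1, 0) h p = 0)
    (htr : ∀ p ∈ Ω, dd (1, 0, 0) h p + p.2.1 * dd (0, 0, 1) h p = 0) :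
    ∃ c, ∀ p ∈ Ω, h p = c := by
  have hco := coeffs_eq_zero ho (ContDiffOn.dd hh ho (1, 0, 0)) (ContDiffOn.dd hh ho (0, 0, 1))
    (contDiffOn_const (c := 0)) (dd_dd_eq_zero ho hh hx _) (dd_dd_eq_zero ho hh hx _)
    (fun p _ => dd_const _ _ p) (fun p hp => by linear_combination htr p hp)
  exact exists_const_of_partials_eq_zero ho hc hh (fun p hp => (hco p hp).1) hx
    (fun p hp => (hco p hp).2.1)

lemma SymmetryCoeffs.generic {β : ℝ} (hβ : β ∉ ({0, 2, 3, 5} : Set ℝ)) {Ω : Set BaseSpace}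
    (ho : IsOpen Ω) (hc : IsConnected Ω) {τ ξ ζ η₁ η₀ : BaseSpace → ℝ}
    (h : SymmetryCoeffs β Ω τ ξ ζ η₁ η₀) : ∃ c₁ c₂ c₃ c₄ : ℝ, ∀ p ∈ Ω,
      τ p = c₁ + (2 - β) * c₄ * p.1 ∧ ξ p = c₄ * p.2.1 ∧ ζ p = c₂ + (3 - β) * c₄ * p.2.2 ∧
      η₁ p = c₃ := by
  simp only [mem_insert_iff, mem_singleton_iff, not_or] at hβ
  obtain ⟨b0, b2, b3, b5⟩ := hβ
  have hτy : ∀ p ∈ Ω, dd (0, 0, 1) τ p = 0 := fun p hp =>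
    (mul_eq_zero.1 (h.τy p hp)).resolve_left (sub_ne_zero.2 b5)
  have hζt : ∀ p ∈ Ω, dd (1, 0, 0) ζ p = 0 := fun p hp =>
    (mul_eq_zero.1 (h.ζt p hp)).resolve_left b0
  have sτt := ContDiffOn.dd h.smooth_τ ho (1, 0, 0)
  have sζy := ContDiffOn.dd h.smooth_ζ ho (0, 0, 1)
  have b2' : 2 - β ≠ 0 := sub_ne_zero.2 (Ne.symm b2)
  have b3' : 3 - β ≠ 0 := sub_ne_zero.2 (Ne.symm b3)
  have hτtt : ∀ p ∈ Ω, dd (1, 0, 0) (dd (1, 0, 0) τ) p = 0 := fun p hp => by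
    have a := dd_of_eqOn ho h.ζy (1, 0, 0) p hp
    rw [dd_const_mul _ _ (ContDiffOn.differentiableAt' sζy ho hp),
      dd_const_mul _ _ (ContDiffOn.differentiableAt' sτt ho hp),
      dd_dd_eq_zero ho h.smooth_ζ hζt _ p hp, mul_zero] at a
    exact (mul_eq_zero.1 a.symm).resolve_left b3'
  obtain ⟨c, hτt⟩ := exists_const_of_partials_eq_zero ho hc sτt hτtt
    (dd_dd_eq_zero ho h.smooth_τ h.τx _) (dd_dd_eq_zero ho h.smooth_τ hτy _)
  obtain ⟨c₁, h₁⟩ := exists_eq_add_const ho hc h.smooth_τ (fun q => c * q.1) (by fun_prop)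
    (fun p hp => by simp (disch := fun_prop) [dd_const_mul, hτt p hp])
    (fun p hp => by simp (disch := fun_prop) [dd_const_mul, h.τx p hp])
    (fun p hp => by simp (disch := fun_prop) [dd_const_mul, hτy p hp])
  have hζy : ∀ p ∈ Ω, dd (0, 0, 1) ζ p = (3 - β) * (c / (2 - β)) := fun p hp => by
    have := h.ζy p hp
    rw [hτt p hp] at this
    field_simp
    linear_combination this
  obtain ⟨c₂, h₂⟩ := exists_eq_add_const ho hc h.smooth_ζ (fun q => (3 - β) * (c / (2 - β)) * q.2.2)
    (by fun_prop)
    (fun p hp => by simp (disch := fun_prop) [dd_const_mul, hζt p hp])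
    (fun p hp => by simp (disch := fun_prop) [dd_const_mul, h.ζx p hp])
    (fun p hp => by simp (disch := fun_prop) [dd_const_mul, hζy p hp])
  have hξ : ∀ p ∈ Ω, ξ p = c / (2 - β) * p.2.1 := fun p hp => by
    rw [h.ξ_eq p hp, hζt p hp, hζy p hp, hτt p hp, hτy p hp]
    field_simp
    ring
  have hξd : ∀ e, ∀ p ∈ Ω, dd e ξ p = c / (2 - β) * e.2.1 := fun e p hp => by
    rw [dd_of_eqOn ho hξ e p hp, dd_const_mul _ _ (by fun_prop), dd_x]
  have hη₁x : ∀ p ∈ Ω, dd (0, 1, 0) η₁ p = 0 := by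
    refine eq_zero_of_eq_zero_offPlane ho (ContDiffOn.dd h.smooth_η₁ ho _).continuousOn fun p hp => ?_
    have a := h.ux p hp
    rw [hξd _ p hp.1, hξd _ p hp.1, dd_eq_zero_of_eqOn ho (hξd (0, 1, 0)) _ hp.1] at a
    have h3 : |p.2.1| ^ β ≠ 0 := (Real.rpow_pos_of_pos (abs_pos.2 hp.2) β).ne'
    refine (mul_eq_zero.1 (?_ : |p.2.1| ^ β * _ = 0)).resolve_left h3
    simp only [mul_zero, zero_add] at a
    linear_combination a / 2
  obtain ⟨c₃, h₃⟩ := exists_const_of_transport ho hc h.smooth_η₁ hη₁x fun p hp => by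
    have a := h.eq₁ p hp
    unfold SatisfiesAt at a
    rw [dX_eq_dd, dd_eq_zero_of_eqOn ho hη₁x _ hp, dT_eq_dd, dY_eq_dd] at a
    linear_combination a
  refine ⟨c₁, c₂, c₃, c / (2 - β), fun p hp => ⟨?_, hξ p hp, ?_, h₃ p hp⟩⟩
  · rw [h₁ p hp]; field_simp; ring
  · rw [h₂ p hp]; ring

lemma SymmetryCoeffs.two {Ω : Set BaseSpace}
    (ho : IsOpen Ω) (hc : IsConnected Ω) {τ ξ ζ η₁ η₀ : BaseSpace → ℝ}
    (h : SymmetryCoeffs 2 Ω τ ξ ζ η₁ η₀) : ∃ c₁ c₂ c₃ c₄ c₅ : ℝ, ∀ p ∈ Ω,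
      τ p = c₁ ∧ ξ p = c₄ * p.2.1 + c₅ * (2 * p.2.1 * p.2.2) ∧
      ζ p = c₂ + c₄ * p.2.2 + c₅ * p.2.2 ^ 2 ∧ η₁ p = c₃ - c₅ * p.2.1 := by
  have hτy : ∀ p ∈ Ω, dd (0, 0, 1) τ p = 0 := fun p hp => by
    linear_combination -(h.τy p hp) / 3
  have hζt : ∀ p ∈ Ω, dd (1, 0, 0) ζ p = 0 := fun p hp => by
    linear_combination (h.ζt p hp) / 2
  have hτt : ∀ p ∈ Ω, dd (1, 0, 0) τ p = 0 := fun p hp => by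
    linear_combination -(h.ζy p hp)
  obtain ⟨c₁, h₁⟩ := exists_const_of_partials_eq_zero ho hc h.smooth_τ hτt h.τx hτy
  have hξ : ∀ p ∈ Ω, ξ p = p.2.1 * dd (0, 0, 1) ζ p := fun p hp => by
    rw [h.ξ_eq p hp, hζt p hp, hτt p hp, hτy p hp]; ring
  have sζy := ContDiffOn.dd h.smooth_ζ ho (0, 0, 1)
  have sζyy := ContDiffOn.dd sζy ho (0, 0, 1)
  have sζyyy := ContDiffOn.dd sζyy ho (0, 0, 1)
  have ζyt := dd_dd_eq_zero ho h.smooth_ζ hζt (0, 0, 1)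
  have ζyx := dd_dd_eq_zero ho h.smooth_ζ h.ζx (0, 0, 1)
  have ζyyt := dd_dd_eq_zero ho sζy ζyt (0, 0, 1)
  have ζyyx := dd_dd_eq_zero ho sζy ζyx (0, 0, 1)
  have ζyyyx := dd_dd_eq_zero ho sζyy ζyyx (0, 0, 1)
  have hξd : ∀ e, ∀ p ∈ Ω, dd e ξ p
      = e.2.1 * dd (0, 0, 1) ζ p + p.2.1 * dd e (dd (0, 0, 1) ζ) p := fun e p hp => by
    rw [dd_of_eqOn ho hξ e p hp, dd_mul _ (by fun_prop)
      (ContDiffOn.differentiableAt' sζy ho hp), dd_x]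
  have hξxx : ∀ p ∈ Ω, dd (0, 1, 0) (dd (0, 1, 0) ξ) p = 0 := fun p hp => by
    have : ∀ q ∈ Ω, dd (0, 1, 0) ξ q = dd (0, 0, 1) ζ q := fun q hq => by
      rw [hξd _ q hq, ζyx q hq]; simp
    rw [dd_of_eqOn ho this _ p hp, ζyx p hp]
  have hη₁x : ∀ p ∈ Ω, 2 * dd (0, 1, 0) η₁ p + dd (0, 0, 1) (dd (0, 0, 1) ζ) p = 0 := by
    refine eq_zero_of_eq_zero_offPlane ho ((continuousOn_const.mul
      (ContDiffOn.dd h.smooth_η₁ ho _).continuousOn).add sζyy.continuousOn) fun p hp => ?_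
    have a := h.ux p hp
    rw [hξd _ p hp.1, hξd _ p hp.1, hξxx p hp.1, ζyt p hp.1, Real.rpow_two, sq_abs] at a
    refine (mul_eq_zero.1 (?_ : p.2.1 ^ 2 * _ = 0)).resolve_left (pow_ne_zero 2 hp.2)
    linear_combination a
  have hη₁xx : ∀ p ∈ Ω, dd (0, 1, 0) (dd (0, 1, 0) η₁) p = 0 := fun p hp => by
    have a := dd_eq_zero_of_eqOn ho hη₁x (0, 1, 0) hp
    have e1 := ContDiffOn.differentiableAt' (ContDiffOn.dd h.smooth_η₁ ho (0, 1, 0)) ho hp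
    have e2 := ContDiffOn.differentiableAt' sζyy ho hp
    rw [dd_add _ (e1.const_mul _) e2, dd_const_mul _ _ e1, ζyyx p hp] at a
    linear_combination a / 2
  -- The part of `η₁` that does not depend on `x`.
  let H : BaseSpace → ℝ := fun q => η₁ q + q.2.1 * (dd (0, 0, 1) (dd (0, 0, 1) ζ) q / 2)
  have sH : ContDiffOn ℝ ∞ H Ω :=
    h.smooth_η₁.add (contDiff_fst.comp contDiff_snd |>.contDiffOn.mul (sζyy.div_const 2))
  have Hd : ∀ e, ∀ p ∈ Ω, dd e H p = dd e η₁ p + e.2.1 * (dd (0, 0, 1) (dd (0, 0, 1) ζ) p / 2)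
      + p.2.1 * (dd e (dd (0, 0, 1) (dd (0, 0, 1) ζ)) p / 2) := fun e p hp => by
    have e1 := ContDiffOn.differentiableAt' h.smooth_η₁ ho hp
    have e2 := ContDiffOn.differentiableAt' sζyy ho hp
    simp (disch := fun_prop) only [H, div_eq_mul_inv, dd_add, dd_mul, dd_x, dd_const]
    ring
  have Hx : ∀ p ∈ Ω, dd (0, 1, 0) H p = 0 := fun p hp => by
    rw [Hd _ p hp, ζyyx p hp]; linear_combination (hη₁x p hp) / 2
  have hpoly : ∀ p ∈ Ω, dd (1, 0, 0) H p + p.2.1 * dd (0, 0, 1) H p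
      + p.2.1 ^ 2 * (-(1 / 2) * dd (0, 0, 1) (dd (0, 0, 1) (dd (0, 0, 1) ζ)) p) = 0 := by
    intro p hp
    have a := h.eq₁ p hp
    unfold SatisfiesAt at a
    rw [dX_eq_dd, hη₁xx p hp, dT_eq_dd, dY_eq_dd] at a
    rw [Hd _ p hp, Hd _ p hp, ζyyt p hp]
    linear_combination a
  have hco := coeffs_eq_zero ho (ContDiffOn.dd sH ho (1, 0, 0)) (ContDiffOn.dd sH ho (0, 0, 1))
    (contDiffOn_const.mul sζyyy) (dd_dd_eq_zero ho sH Hx _) (dd_dd_eq_zero ho sH Hx _)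
    (fun p hp => by
      rw [dX_eq_dd, dd_const_mul _ _ (ContDiffOn.differentiableAt' sζyyy ho hp), ζyyyx p hp,
        mul_zero]) hpoly
  obtain ⟨c₃, h₃⟩ := exists_const_of_partials_eq_zero ho hc sH (fun p hp => (hco p hp).1) Hx
    (fun p hp => (hco p hp).2.1)
  obtain ⟨c, hζyy⟩ := exists_const_of_partials_eq_zero ho hc sζyy ζyyt ζyyx
    (fun p hp => by rw [dY_eq_dd]; linear_combination -2 * (hco p hp).2.2)
  obtain ⟨c₄, hζy⟩ := exists_eq_add_const ho hc sζy (fun q => c * q.2.2) (by fun_prop)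
    (fun p hp => by simp (disch := fun_prop) [dd_const_mul, ζyt p hp])
    (fun p hp => by simp (disch := fun_prop) [dd_const_mul, ζyx p hp])
    (fun p hp => by simp (disch := fun_prop) [dd_const_mul, hζyy p hp])
  obtain ⟨c₂, hζ⟩ := exists_eq_add_const ho hc h.smooth_ζ (fun q => c₄ * q.2.2 + c / 2 * q.2.2 ^ 2)
    (by fun_prop)
    (fun p hp => by simp (disch := fun_prop) [dd_const_mul, dd_add, dd_pow, hζt p hp])
    (fun p hp => by simp (disch := fun_prop) [dd_const_mul, dd_add, dd_pow, h.ζx p hp])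
    (fun p hp => by
      simp (disch := fun_prop) [dd_const_mul, dd_add, dd_pow, hζy p hp]; ring)
  refine ⟨c₁, c₂, c₃, c₄, c / 2, fun p hp => ⟨h₁ p hp, ?_, ?_, ?_⟩⟩
  · rw [hξ p hp, hζy p hp]; ring
  · rw [hζ p hp]; ring
  · have := h₃ p hp
    simp only [H, hζyy p hp] at this
    linear_combination this

lemma SymmetryCoeffs.zero {Ω : Set BaseSpace}
    (ho : IsOpen Ω) (hc : IsConnected Ω) {τ ξ ζ η₁ η₀ : BaseSpace → ℝ}
    (h : SymmetryCoeffs 0 Ω τ ξ ζ η₁ η₀) : ∃ c₁ c₂ c₃ c₄ c₅ c₆ c₇ c₈ : ℝ, ∀ p ∈ Ω,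
      τ p = c₁ + 2 * c₄ * p.1 + c₅ * p.1 ^ 2 ∧
      ξ p = c₄ * p.2.1 + c₅ * (p.1 * p.2.1 + 3 * p.2.2) + 3 * c₆ * p.1 ^ 2 + 2 * c₇ * p.1 + c₈ ∧
      ζ p = c₂ + 3 * c₄ * p.2.2 + 3 * c₅ * (p.1 * p.2.2) + c₆ * p.1 ^ 3 + c₇ * p.1 ^ 2
        + c₈ * p.1 ∧
      η₁ p = c₃ - c₅ * (p.2.1 ^ 2 + 2 * p.1) + 3 * c₆ * (p.2.2 - p.1 * p.2.1)
        - c₇ * p.2.1 := by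
  have hτy : ∀ p ∈ Ω, dd (0, 0, 1) τ p = 0 := fun p hp => by
    linear_combination -(h.τy p hp) / 5
  have hζy : ∀ p ∈ Ω, dd (0, 0, 1) ζ p = 3 / 2 * dd (1, 0, 0) τ p := fun p hp => by
    linear_combination (h.ζy p hp) / 2
  have sτt := ContDiffOn.dd h.smooth_τ ho (1, 0, 0)
  have sτtt := ContDiffOn.dd sτt ho (1, 0, 0)
  have sτttt := ContDiffOn.dd sτtt ho (1, 0, 0)
  have sζt := ContDiffOn.dd h.smooth_ζ ho (1, 0, 0)
  have sζtt := ContDiffOn.dd sζt ho (1, 0, 0)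
  have sζttt := ContDiffOn.dd sζtt ho (1, 0, 0)
  have τtx := dd_dd_eq_zero ho h.smooth_τ h.τx (1, 0, 0)
  have τty := dd_dd_eq_zero ho h.smooth_τ hτy (1, 0, 0)
  have τttx := dd_dd_eq_zero ho sτt τtx (1, 0, 0)
  have τtty := dd_dd_eq_zero ho sτt τty (1, 0, 0)
  have τtttx := dd_dd_eq_zero ho sτtt τttx (1, 0, 0)
  have ζtx := dd_dd_eq_zero ho h.smooth_ζ h.ζx (1, 0, 0)
  have ζttx := dd_dd_eq_zero ho sζt ζtx (1, 0, 0)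
  have ζtttx := dd_dd_eq_zero ho sζtt ζttx (1, 0, 0)
  have ζty : ∀ p ∈ Ω, dd (0, 0, 1) (dd (1, 0, 0) ζ) p
      = 3 / 2 * dd (1, 0, 0) (dd (1, 0, 0) τ) p := fun p hp => by
    rw [dd_comm ho h.smooth_ζ _ _ hp, dd_of_eqOn ho hζy _ p hp,
      dd_const_mul _ _ (ContDiffOn.differentiableAt' sτt ho hp)]
  have ζtty : ∀ p ∈ Ω, dd (0, 0, 1) (dd (1, 0, 0) (dd (1, 0, 0) ζ)) p
      = 3 / 2 * dd (1, 0, 0) (dd (1, 0, 0) (dd (1, 0, 0) τ)) p := fun p hp => by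
    rw [dd_comm ho sζt _ _ hp, dd_of_eqOn ho ζty _ p hp,
      dd_const_mul _ _ (ContDiffOn.differentiableAt' sτtt ho hp)]
  have hξ : ∀ p ∈ Ω, ξ p = dd (1, 0, 0) ζ p + p.2.1 * (1 / 2 * dd (1, 0, 0) τ p) :=
    fun p hp => by rw [h.ξ_eq p hp, hτy p hp, hζy p hp]; ring
  have hξd : ∀ e, ∀ p ∈ Ω, dd e ξ p = dd e (dd (1, 0, 0) ζ) p
      + (e.2.1 * (1 / 2 * dd (1, 0, 0) τ p) + p.2.1 * (1 / 2 * dd e (dd (1, 0, 0) τ) p)) :=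
    fun e p hp => by
      have e1 := ContDiffOn.differentiableAt' sζt ho hp
      have e2 := ContDiffOn.differentiableAt' sτt ho hp
      rw [dd_of_eqOn ho hξ e p hp]
      simp (disch := fun_prop) only [dd_add, dd_mul, dd_x, dd_const]
      ring
  have hξxx : ∀ p ∈ Ω, dd (0, 1, 0) (dd (0, 1, 0) ξ) p = 0 := fun p hp => by
    have : ∀ q ∈ Ω, dd (0, 1, 0) ξ q = 1 / 2 * dd (1, 0, 0) τ q := fun q hq => by
      rw [hξd _ q hq, ζtx q hq, τtx q hq]; ring
    rw [dd_of_eqOn ho this _ p hp,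
      dd_const_mul _ _ (ContDiffOn.differentiableAt' sτt ho hp), τtx p hp, mul_zero]
  have hη₁x : ∀ p ∈ Ω, 2 * dd (0, 1, 0) η₁ p + dd (1, 0, 0) (dd (1, 0, 0) ζ) p
      + p.2.1 * (2 * dd (1, 0, 0) (dd (1, 0, 0) τ) p) = 0 := by
    have cx : ContinuousOn (fun p : BaseSpace => p.2.1) Ω := by fun_prop
    refine eq_zero_of_eq_zero_offPlane ho (((continuousOn_const.mul
      (ContDiffOn.dd h.smooth_η₁ ho _).continuousOn).add sζtt.continuousOn).add
      (cx.mul (continuousOn_const.mul sτtt.continuousOn))) fun p hp => ?_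
    have a := h.ux p hp
    rw [hξd _ p hp.1, hξd _ p hp.1, hξxx p hp.1, ζty p hp.1, τty p hp.1, Real.rpow_zero] at a
    linear_combination a
  have hη₁xx : ∀ p ∈ Ω, dd (0, 1, 0) (dd (0, 1, 0) η₁) p
      = - dd (1, 0, 0) (dd (1, 0, 0) τ) p := fun p hp => by
    have a := dd_eq_zero_of_eqOn ho hη₁x (0, 1, 0) hp
    have e1 := ContDiffOn.differentiableAt' (ContDiffOn.dd h.smooth_η₁ ho (0, 1, 0)) ho hp
    have e2 := ContDiffOn.differentiableAt' sζtt ho hp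
    have e3 := ContDiffOn.differentiableAt' sτtt ho hp
    simp (disch := fun_prop) only [dd_add, dd_mul, dd_x, dd_const, ζttx p hp, τttx p hp] at a
    linear_combination a / 2
  -- The part of `η₁` that does not depend on `x`.
  let H : BaseSpace → ℝ := fun q => η₁ q + q.2.1 * (1 / 2 * dd (1, 0, 0) (dd (1, 0, 0) ζ) q)
    + q.2.1 ^ 2 * (1 / 2 * dd (1, 0, 0) (dd (1, 0, 0) τ) q)
  have sx : ContDiffOn ℝ ∞ (fun q : BaseSpace => q.2.1) Ω := by fun_prop
  have sH : ContDiffOn ℝ ∞ H Ω :=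
    (h.smooth_η₁.add (sx.mul (contDiffOn_const.mul sζtt))).add
      ((sx.pow 2).mul (contDiffOn_const.mul sτtt))
  have Hd : ∀ e, ∀ p ∈ Ω, dd e H p = dd e η₁ p
      + e.2.1 * (1 / 2 * dd (1, 0, 0) (dd (1, 0, 0) ζ) p)
      + p.2.1 * (1 / 2 * dd e (dd (1, 0, 0) (dd (1, 0, 0) ζ)) p)
      + 2 * p.2.1 * e.2.1 * (1 / 2 * dd (1, 0, 0) (dd (1, 0, 0) τ) p)
      + p.2.1 ^ 2 * (1 / 2 * dd e (dd (1, 0, 0) (dd (1, 0, 0) τ)) p) := fun e p hp => by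
    have e1 := ContDiffOn.differentiableAt' h.smooth_η₁ ho hp
    have e2 := ContDiffOn.differentiableAt' sζtt ho hp
    have e3 := ContDiffOn.differentiableAt' sτtt ho hp
    simp (disch := fun_prop) only [H, dd_add, dd_mul, dd_x, dd_const, dd_pow]
    norm_num
    ring
  have Hx : ∀ p ∈ Ω, dd (0, 1, 0) H p = 0 := fun p hp => by
    rw [Hd _ p hp, ζttx p hp, τttx p hp]; linear_combination (hη₁x p hp) / 2
  have hpoly : ∀ p ∈ Ω, (dd (1, 0, 0) H p + dd (1, 0, 0) (dd (1, 0, 0) τ) p)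
      + p.2.1 * (dd (0, 0, 1) H p - 1 / 2 * dd (1, 0, 0) (dd (1, 0, 0) (dd (1, 0, 0) ζ)) p)
      + p.2.1 ^ 2 * (-(5 / 4) * dd (1, 0, 0) (dd (1, 0, 0) (dd (1, 0, 0) τ)) p) = 0 := by
    intro p hp
    have a := h.eq₁ p hp
    unfold SatisfiesAt at a
    rw [dX_eq_dd, hη₁xx p hp, dT_eq_dd, dY_eq_dd, Real.rpow_zero] at a
    rw [Hd _ p hp, Hd _ p hp, ζtty p hp, τtty p hp]
    linear_combination a
  have sHt := ContDiffOn.dd sH ho (1, 0, 0)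
  have sHy := ContDiffOn.dd sH ho (0, 0, 1)
  have hco := coeffs_eq_zero ho (sHt.add sτtt) (sHy.sub (contDiffOn_const.mul sζttt))
    (contDiffOn_const.mul sτttt)
    (fun p hp => by
      have e1 := ContDiffOn.differentiableAt' sHt ho hp
      have e2 := ContDiffOn.differentiableAt' sτtt ho hp
      rw [dX_eq_dd, dd_add _ e1 e2, dd_dd_eq_zero ho sH Hx _ p hp, τttx p hp, add_zero])
    (fun p hp => by
      have e1 := ContDiffOn.differentiableAt' sHy ho hp
      have e2 := ContDiffOn.differentiableAt' sζttt ho hp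
      rw [dX_eq_dd, dd_sub _ e1 (e2.const_mul _), dd_const_mul _ _ e2,
        dd_dd_eq_zero ho sH Hx _ p hp, ζtttx p hp]
      ring)
    (fun p hp => by
      rw [dX_eq_dd, dd_const_mul _ _ (ContDiffOn.differentiableAt' sτttt ho hp), τtttx p hp,
        mul_zero]) hpoly
  have τttt : ∀ p ∈ Ω, dd (1, 0, 0) (dd (1, 0, 0) (dd (1, 0, 0) τ)) p = 0 := fun p hp => by
    linear_combination -(4 / 5) * (hco p hp).2.2
  have Ht : ∀ p ∈ Ω, dd (1, 0, 0) H p = - dd (1, 0, 0) (dd (1, 0, 0) τ) p := fun p hp => by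
    linear_combination (hco p hp).1
  have hζttt : ∀ p ∈ Ω, dd (1, 0, 0) (dd (1, 0, 0) (dd (1, 0, 0) ζ)) p = 2 * dd (0, 0, 1) H p :=
    fun p hp => by linear_combination -2 * (hco p hp).2.1
  obtain ⟨a, hτtt⟩ := exists_const_of_partials_eq_zero ho hc sτtt τttt τttx τtty
  obtain ⟨b, hτt⟩ := exists_eq_add_const ho hc sτt (fun q => a * q.1) (by fun_prop)
    (fun p hp => by simp (disch := fun_prop) [dd_const_mul, hτtt p hp])
    (fun p hp => by simp (disch := fun_prop) [dd_const_mul, τtx p hp])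
    (fun p hp => by simp (disch := fun_prop) [dd_const_mul, τty p hp])
  obtain ⟨c₁, hτ⟩ := exists_eq_add_const ho hc h.smooth_τ (fun q => b * q.1 + a / 2 * q.1 ^ 2)
    (by fun_prop)
    (fun p hp => by simp (disch := fun_prop) [dd_const_mul, dd_add, dd_pow, hτt p hp]; ring)
    (fun p hp => by simp (disch := fun_prop) [dd_const_mul, dd_add, dd_pow, h.τx p hp])
    (fun p hp => by simp (disch := fun_prop) [dd_const_mul, dd_add, dd_pow, hτy p hp])
  obtain ⟨d, hζ3⟩ := exists_const_of_partials_eq_zero ho hc sζttt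
    (fun p hp => by
      rw [dT_eq_dd, dd_of_eqOn ho hζttt _ p hp,
        dd_const_mul _ _ (ContDiffOn.differentiableAt' sHy ho hp), dd_comm ho sH _ _ hp,
        dd_of_eqOn ho Ht _ p hp, dd_neg, τtty p hp, neg_zero, mul_zero])
    ζtttx
    (fun p hp => by
      rw [dY_eq_dd, dd_comm ho sζtt _ _ hp, dd_of_eqOn ho ζtty _ p hp,
        dd_const_mul _ _ (ContDiffOn.differentiableAt' sτttt ho hp),
        dd_eq_zero_of_eqOn ho τttt _ hp, mul_zero])
  obtain ⟨e, hζ2⟩ := exists_eq_add_const ho hc sζtt (fun q => d * q.1) (by fun_prop)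
    (fun p hp => by simp (disch := fun_prop) [dd_const_mul, hζ3 p hp])
    (fun p hp => by simp (disch := fun_prop) [dd_const_mul, ζttx p hp])
    (fun p hp => by simp (disch := fun_prop) [dd_const_mul, ζtty p hp, τttt p hp])
  obtain ⟨c₈, hζ1⟩ := exists_eq_add_const ho hc sζt
    (fun q => d / 2 * q.1 ^ 2 + e * q.1 + 3 / 2 * a * q.2.2) (by fun_prop)
    (fun p hp => by
      simp (disch := fun_prop) [dd_const_mul, dd_add, dd_pow, hζ2 p hp]; ring)
    (fun p hp => by simp (disch := fun_prop) [dd_const_mul, dd_add, dd_pow, ζtx p hp])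
    (fun p hp => by
      simp (disch := fun_prop) [dd_const_mul, dd_add, dd_pow, ζty p hp, hτtt p hp])
  obtain ⟨c₂, hζ⟩ := exists_eq_add_const ho hc h.smooth_ζ
    (fun q => d / 6 * q.1 ^ 3 + e / 2 * q.1 ^ 2 + c₈ * q.1 + 3 / 2 * a * (q.1 * q.2.2)
      + 3 / 2 * b * q.2.2) (by fun_prop)
    (fun p hp => by
      simp (disch := fun_prop) [dd_const_mul, dd_add, dd_pow, dd_mul, hζ1 p hp]; ring)
    (fun p hp => by
      simp (disch := fun_prop) [dd_const_mul, dd_add, dd_pow, dd_mul, h.ζx p hp])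
    (fun p hp => by
      simp (disch := fun_prop) [dd_const_mul, dd_add, dd_pow, dd_mul, hζy p hp, hτt p hp]; ring)
  obtain ⟨c₃, hH⟩ := exists_eq_add_const ho hc sH
    (fun q => d / 2 * q.2.2 + (-a) * q.1) (by fun_prop)
    (fun p hp => by
      simp (disch := fun_prop) [dd_const_mul, dd_add, dd_neg, Ht p hp, hτtt p hp])
    (fun p hp => by simp (disch := fun_prop) [dd_const_mul, dd_add, dd_neg, Hx p hp])
    (fun p hp => by
      have := hζttt p hp
      rw [hζ3 p hp] at this
      simp (disch := fun_prop) [dd_const_mul, dd_add, dd_neg]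
      linarith)
  refine ⟨c₁, c₂, c₃, b / 2, a / 2, d / 6, e / 2, c₈, fun p hp => ⟨?_, ?_, ?_, ?_⟩⟩
  · rw [hτ p hp]; ring
  · rw [hξ p hp, hζ1 p hp, hτt p hp]; ring
  · rw [hζ p hp]; ring
  · have := hH p hp
    simp only [H, hζ2 p hp, hτtt p hp] at this
    linear_combination this

/-! ### Solutions and the action of symmetries on them -/

/-- `f` is a smooth solution on `Ω`; its values outside of `Ω` are arbitrary. -/
structure IsSolutionOn (β : ℝ) (Ω : Set BaseSpace) (f : BaseSpace → ℝ) : Prop where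
  smooth : ContDiffOn ℝ ∞ f Ω
  eq : ∀ p ∈ Ω, SatisfiesAt β f p

section Solutions

variable {β : ℝ} {Ω : Set BaseSpace} {f g : BaseSpace → ℝ}

lemma satisfiesAt_congr (ho : IsOpen Ω) (h : EqOn f g Ω) {p : BaseSpace} (hp : p ∈ Ω) :
    SatisfiesAt β f p ↔ SatisfiesAt β g p := by
  unfold SatisfiesAt
  rw [dT_eq_dd, dX_eq_dd, dY_eq_dd, dd_congr ho h _ hp, dd_congr ho h _ hp,
    dd_congr ho (dd_congr ho h _) _ hp]

lemma IsSolutionOn.congr (ho : IsOpen Ω) (hf : IsSolutionOn β Ω f) (h : EqOn g f Ω) :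
    IsSolutionOn β Ω g :=
  ⟨hf.smooth.congr h, fun p hp => (satisfiesAt_congr ho h hp).2 (hf.eq p hp)⟩

lemma IsSolutionOn.comb (ho : IsOpen Ω) (hf : IsSolutionOn β Ω f) (hg : IsSolutionOn β Ω g)
    (a b : ℝ) : IsSolutionOn β Ω (fun p => a * f p + b * g p) := by
  have key : ∀ {f g : BaseSpace → ℝ}, ContDiffOn ℝ ∞ f Ω → ContDiffOn ℝ ∞ g Ω → ∀ e, ∀ p ∈ Ω,
      dd e (fun p => a * f p + b * g p) p = a * dd e f p + b * dd e g p := by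
    intro f g hf hg e p hp
    have e1 := ContDiffOn.differentiableAt' hf ho hp
    have e2 := ContDiffOn.differentiableAt' hg ho hp
    simp (disch := fun_prop) only [dd_add, dd_const_mul]
  refine ⟨(contDiffOn_const.mul hf.smooth).add (contDiffOn_const.mul hg.smooth),
    fun p hp => ?_⟩
  have h1 := hf.eq p hp
  have h2 := hg.eq p hp
  unfold SatisfiesAt at *
  rw [dT_eq_dd, dX_eq_dd, dY_eq_dd] at *
  rw [key hf.smooth hg.smooth _ p hp, key hf.smooth hg.smooth _ p hp,
    dd_of_eqOn ho (key hf.smooth hg.smooth _) _ p hp,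
    key (ContDiffOn.dd hf.smooth ho _) (ContDiffOn.dd hg.smooth ho _) _ p hp]
  linear_combination a * h1 + b * h2

lemma isSolutionOn_const (c : ℝ) : IsSolutionOn β Ω (fun _ => c) :=
  ⟨contDiffOn_const, fun p _ => by
    have : dd (0, 1, 0) (fun _ : BaseSpace => c) = fun _ => 0 := by funext q; simp
    simp [SatisfiesAt, dT_eq_dd, dX_eq_dd, dY_eq_dd, this]⟩

lemma IsSolutionOn.indicator_mem (ho : IsOpen Ω) (hf : IsSolutionOn β Ω f) :
    Ω.indicator f ∈ solutions β Ω := by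
  have h : EqOn (Ω.indicator f) f Ω := fun p hp => indicator_of_mem hp f
  have := hf.congr ho h
  exact ⟨fun p hp => indicator_of_notMem hp f, this.smooth, this.eq⟩

lemma isSolutionOn_of_mem (hf : f ∈ solutions β Ω) : IsSolutionOn β Ω f := ⟨hf.2.1, hf.2.2⟩

end Solutions

lemma continuousOn_abs_rpow {β : ℝ} {Ω : TopologicalSpace.Opens BaseSpace}
    (hΩ : IsDomainFor β Ω) : ContinuousOn (fun p : BaseSpace => |p.2.1| ^ β) Ω := by
  intro p hp
  refine ContinuousAt.continuousWithinAt ?_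
  refine ContinuousAt.rpow_const (by fun_prop) ?_
  by_cases hx : p.2.1 = 0
  · obtain ⟨n, rfl⟩ := hΩ.regular p hp hx
    exact Or.inr (by positivity)
  · exact Or.inl (abs_pos.2 hx).ne'

/-- A smooth function on an open set agrees near any point with a smooth function on the whole
space. -/
lemma exists_contDiff_eventuallyEq {Ω : Set BaseSpace} (ho : IsOpen Ω) {f : BaseSpace → ℝ}
    (hf : ContDiffOn ℝ ∞ f Ω) {p : BaseSpace} (hp : p ∈ Ω) :
    ∃ u : BaseSpace → ℝ, ContDiff ℝ ∞ u ∧ u =ᶠ[𝓝 p] f := by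
  obtain ⟨r, hr, hball⟩ := Metric.nhds_basis_closedBall.mem_iff.1 (ho.mem_nhds hp)
  let φ : ContDiffBump p := ⟨r / 2, r, by positivity, by linarith⟩
  refine ⟨fun q => φ q * f q, ?_, ?_⟩
  · refine contDiff_iff_contDiffAt.2 fun q => ?_
    by_cases hq : q ∈ tsupport φ
    · rw [φ.tsupport_eq] at hq
      exact φ.contDiffAt.mul (hf.contDiffAt (ho.mem_nhds (hball hq)))
    · refine (contDiffAt_const (c := (0 : ℝ))).congr_of_eventuallyEq ?_
      filter_upwards [notMem_tsupport_iff_eventuallyEq.1 hq] with z hz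
      simp [hz]
  · filter_upwards [φ.eventuallyEq_one] with q hq
    simp [hq]

/-- The action of a Lie symmetry on solutions: the characteristic of a symmetry, evaluated on a
solution, is a solution. Indeed, the prolonged action differs from the equation for the
characteristic by a derivative of the equation for `f`. -/
lemma isSolutionOn_characteristic {β : ℝ} {Ω : TopologicalSpace.Opens BaseSpace}
    (hΩ : IsDomainFor β Ω) {V : TotalSpace → TotalSpace} (hV : IsLieSymmetry β Ω V)
    {f : BaseSpace → ℝ} (hf : IsSolutionOn β Ω f) : IsSolutionOn β Ω (characteristic V f) := by
  have ho := Ω.isOpen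
  have ho' := isOpen_offPlane ho
  have sQ : ContDiffOn ℝ ∞ (characteristic V f) Ω := by
    have h : ContDiffOn ℝ ∞ (fun q : BaseSpace => V (q, f q)) Ω :=
      hV.1.2.comp (contDiffOn_id.prodMk hf.smooth) fun q hq => ⟨hq, mem_univ _⟩
    have h1 := h.fst
    exact ((h.snd.sub (h1.fst.mul (ContDiffOn.dd hf.smooth ho _))).sub
      (h1.snd.fst.mul (ContDiffOn.dd hf.smooth ho _))).sub
        (h1.snd.snd.mul (ContDiffOn.dd hf.smooth ho _))
  refine ⟨sQ, fun q hq => ?_⟩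
  have cx : ContinuousOn (fun p : BaseSpace => p.2.1) Ω := by fun_prop
  refine sub_eq_zero.1 (eq_zero_of_eq_zero_offPlane ho
    (f := fun p => dT (characteristic V f) p + p.2.1 * dY (characteristic V f) p
      - |p.2.1| ^ β * dX (dX (characteristic V f)) p)
    (((ContDiffOn.dd sQ ho _).continuousOn.add (cx.mul (ContDiffOn.dd sQ ho _).continuousOn)).sub
      ((continuousOn_abs_rpow hΩ).mul (ContDiffOn.dd (ContDiffOn.dd sQ ho _) ho _).continuousOn))
    (fun p hp => ?_) q hq)
  obtain ⟨u, hu, huf⟩ := exists_contDiff_eventuallyEq ho hf.smooth hp.1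
  obtain ⟨N, hNΩ, hN, hpN⟩ := eventually_nhds_iff.1 (huf.and (ho'.mem_nhds hp))
  have hEq : EqOn u f N := fun q hq => (hNΩ q hq).1
  have hd : ∀ e, EqOn (dd e u) (dd e f) N := fun e => dd_congr hN hEq e
  have hQ : EqOn (characteristic V u) (characteristic V f) N := fun q hq => by
    simp only [characteristic, dT_eq_dd, dX_eq_dd, dY_eq_dd, hd _ hq, hEq hq]
  have hsat : ∀ q ∈ N, SatisfiesAt β u q := fun q hq =>
    (satisfiesAt_congr hN hEq hq).2 (hf.eq q (hNΩ q hq).2.1)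
  have hact := hV.2 u hu p hp.1 (hsat p hpN)
  have hu' : ContDiffOn ℝ ∞ u Set.univ := hu.contDiffOn
  -- The derivatives of the equation for `u`.
  have hE : ∀ e, dd e (dT u) p + (e.2.1 * dY u p + p.2.1 * dd e (dY u) p)
      - (deriv (fun s : ℝ => |s| ^ β) p.2.1 * e.2.1 * dX (dX u) p
        + |p.2.1| ^ β * dd e (dX (dX u)) p) = 0 := by
    intro e
    have h0 : ∀ q ∈ N, dT u q + q.2.1 * dY u q - |q.2.1| ^ β * dX (dX u) q = 0 :=
      fun q hq => sub_eq_zero.2 (hsat q hq)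
    have h1 := dd_eq_zero_of_eqOn hN h0 e hpN
    have e1 : DifferentiableAt ℝ (dT u) p := (contDiff_dT hu).differentiable (by simp) p
    have e2 : DifferentiableAt ℝ (dY u) p := (contDiff_dY hu).differentiable (by simp) p
    have e3 : DifferentiableAt ℝ (dX (dX u)) p :=
      (contDiff_dX (contDiff_dX hu)).differentiable (by simp) p
    have e5 : DifferentiableAt ℝ (fun s : ℝ => |s| ^ β) p.2.1 :=
      ((hasDerivAt_abs hp.2).rpow_const (Or.inl (abs_pos.2 hp.2).ne')).differentiableAt
    have e6 : HasFDerivAt (fun q : BaseSpace => q.2.1)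
      ((ContinuousLinearMap.fst ℝ ℝ ℝ).comp (ContinuousLinearMap.snd ℝ ℝ (ℝ × ℝ))) p :=
      ((ContinuousLinearMap.fst ℝ ℝ ℝ).comp (ContinuousLinearMap.snd ℝ ℝ (ℝ × ℝ))).hasFDerivAt
    have e7 := HasDerivAt.comp_hasFDerivAt (h₂ := fun s : ℝ => |s| ^ β) p e5.hasDerivAt e6
    have e8 : dd e (fun q : BaseSpace => |q.2.1| ^ β) p
        = deriv (fun s : ℝ => |s| ^ β) p.2.1 * e.2.1 := by
      have := e7.fderiv
      simp only [Function.comp_def] at this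
      simp [dd, this]
    have e4 : DifferentiableAt ℝ (fun q : BaseSpace => |q.2.1| ^ β) p := e7.differentiableAt
    simp (disch := fun_prop) only [dd_sub, dd_add, dd_mul, dd_x, e8] at h1
    linear_combination h1
  have hT := hE (1, 0, 0)
  have hX := hE (0, 1, 0)
  have hY := hE (0, 0, 1)
  unfold prolongedAction etaT etaY etaXX at hact
  simp only [dT_eq_dd, dX_eq_dd, dY_eq_dd] at *
  rw [← dd_congr hN hQ _ hpN, ← dd_congr hN hQ _ hpN, ← dd_congr hN (dd_congr hN hQ _) _ hpN]
  linear_combination hact - (V (p, u p)).1.1 * hT - (V (p, u p)).1.2.1 * hX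
    - (V (p, u p)).1.2.2 * hY

/-! ### The Lie bracket of affine fields -/

/-- The directional derivative of `g` along the base part of an affine field. -/
noncomputable def along (τ ξ ζ g : BaseSpace → ℝ) (p : BaseSpace) : ℝ :=
  τ p * dd (1, 0, 0) g p + ξ p * dd (0, 1, 0) g p + ζ p * dd (0, 0, 1) g p

lemma fderiv_affineField {Ω : Set BaseSpace} (ho : IsOpen Ω) {τ ξ ζ η₁ η₀ : BaseSpace → ℝ}
    (h : SmoothCoeffs Ω τ ξ ζ η₁ η₀) {p : BaseSpace} (hp : p ∈ Ω) (u : ℝ) (w : TotalSpace) :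
    fderiv ℝ (affineField Ω τ ξ ζ η₁ η₀) (p, u) w =
      ((dd w.1 τ p, dd w.1 ξ p, dd w.1 ζ p), dd w.1 η₁ p * u + η₁ p * w.2 + dd w.1 η₀ p) := by
  have hd : ∀ {f : BaseSpace → ℝ}, ContDiffOn ℝ ∞ f Ω → HasFDerivAt (fun z : TotalSpace => f z.1)
      ((fderiv ℝ f p).comp (ContinuousLinearMap.fst ℝ BaseSpace ℝ)) (p, u) := fun hf => by
    have := (ContDiffOn.differentiableAt' hf ho hp).hasFDerivAt
    exact HasFDerivAt.comp (f := Prod.fst) (p, u) this hasFDerivAt_fst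
  have hA := ((hd h.smooth_τ).prodMk ((hd h.smooth_ξ).prodMk (hd h.smooth_ζ))).prodMk
    (((hd h.smooth_η₁).fun_mul (hasFDerivAt_snd (p := ((p, u) : TotalSpace)))).fun_add
      (hd h.smooth_η₀))
  have he : affineField Ω τ ξ ζ η₁ η₀ =ᶠ[𝓝 (p, u)]
      fun z => ((τ z.1, ξ z.1, ζ z.1), η₁ z.1 * z.2 + η₀ z.1) :=
    Filter.eventually_of_mem ((isOpen_cyl ho).mem_nhds (mem_cyl.2 hp))
      fun z hz => affineField_apply (mem_cyl.1 hz)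
  rw [he.fderiv_eq, hA.fderiv]
  simp [dd]
  ring

lemma dd_eq_along (τ ξ ζ g : BaseSpace → ℝ) (p : BaseSpace) :
    dd (τ p, ξ p, ζ p) g p = along τ ξ ζ g p := by
  exact fderiv_apply_eq g p _

lemma lieBracket_affineField {Ω : Set BaseSpace} (ho : IsOpen Ω)
    {τ ξ ζ η₁ η₀ τ' ξ' ζ' η₁' η₀' : BaseSpace → ℝ} (h : SmoothCoeffs Ω τ ξ ζ η₁ η₀)
    (h' : SmoothCoeffs Ω τ' ξ' ζ' η₁' η₀') :
    VectorField.lieBracket ℝ (affineField Ω τ ξ ζ η₁ η₀) (affineField Ω τ' ξ' ζ' η₁' η₀')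
      = affineField Ω (fun p => along τ ξ ζ τ' p - along τ' ξ' ζ' τ p)
          (fun p => along τ ξ ζ ξ' p - along τ' ξ' ζ' ξ p)
          (fun p => along τ ξ ζ ζ' p - along τ' ξ' ζ' ζ p)
          (fun p => along τ ξ ζ η₁' p - along τ' ξ' ζ' η₁ p)
          (fun p => along τ ξ ζ η₀' p - along τ' ξ' ζ' η₀ p + η₁' p * η₀ p - η₁ p * η₀' p) := by
  funext ⟨p, u⟩
  by_cases hp : p ∈ Ω
  · have a : ∀ {τ ξ ζ η₁ η₀ : BaseSpace → ℝ}, affineField Ω τ ξ ζ η₁ η₀ (p, u)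
        = ((τ p, ξ p, ζ p), η₁ p * u + η₀ p) := affineField_apply (z := (p, u)) hp
    simp only [VectorField.lieBracket, a, fderiv_affineField ho h hp, fderiv_affineField ho h' hp,
      dd_eq_along, Prod.mk_sub_mk]
    simp only [Prod.mk.injEq, true_and]
    ring
  · have a : ∀ {τ ξ ζ η₁ η₀ : BaseSpace → ℝ}, affineField Ω τ ξ ζ η₁ η₀ (p, u) = 0 :=
      indicator_of_notMem (fun hz => hp (mem_cyl.1 hz)) _
    simp [VectorField.lieBracket, a]

/-- The bracket of two symmetries contributes a solution to the term free of `u`. -/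
lemma isSolutionOn_bracket {β : ℝ} {Ω : TopologicalSpace.Opens BaseSpace} (hΩ : IsDomainFor β Ω)
    {τ ξ ζ η₁ η₀ τ' ξ' ζ' η₁' η₀' : BaseSpace → ℝ}
    (hV : IsLieSymmetry β Ω (affineField Ω τ ξ ζ η₁ η₀))
    (hV' : IsLieSymmetry β Ω (affineField Ω τ' ξ' ζ' η₁' η₀'))
    (h₀ : IsSolutionOn β Ω η₀) (h₀' : IsSolutionOn β Ω η₀') :
    IsSolutionOn β Ω
      (fun p => along τ ξ ζ η₀' p - along τ' ξ' ζ' η₀ p + η₁' p * η₀ p - η₁ p * η₀' p) := by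
  have ho := Ω.isOpen
  have s1 := isSolutionOn_characteristic hΩ hV h₀'
  have s2 := isSolutionOn_characteristic hΩ hV' h₀
  refine ((s2.comb ho s1 1 (-1)).comb ho (h₀.comb ho h₀' 1 (-1)) 1 1).congr ho fun p hp => ?_
  have a : ∀ {τ ξ ζ η₁ η₀ : BaseSpace → ℝ} (u : ℝ), affineField Ω τ ξ ζ η₁ η₀ (p, u)
      = ((τ p, ξ p, ζ p), η₁ p * u + η₀ p) := fun u => affineField_apply (z := (p, u)) hp
  simp only [characteristic, a, along, dT_eq_dd, dX_eq_dd, dY_eq_dd]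
  ring

/-! ### The algebra `𝔤^gen` -/

section Fields

variable (Ω : Set BaseSpace)

lemma field_eq (τ ξ ζ η₁ η₀ : ℝ → ℝ → ℝ → ℝ) :
    field Ω (fun t x y _ => τ t x y) (fun t x y _ => ξ t x y) (fun t x y _ => ζ t x y)
      (fun t x y u => η₁ t x y * u + η₀ t x y)
    = affineField Ω (fun p => τ p.1 p.2.1 p.2.2) (fun p => ξ p.1 p.2.1 p.2.2)
      (fun p => ζ p.1 p.2.1 p.2.2) (fun p => η₁ p.1 p.2.1 p.2.2)
      (fun p => η₀ p.1 p.2.1 p.2.2) := rfl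

lemma K2_eq : K2 Ω = affineField Ω (fun _ => 0) (fun p => 2 * p.2.1 * p.2.2)
    (fun p => p.2.2 ^ 2) (fun p => -p.2.1) (fun _ => 0) := by
  rw [← field_eq Ω (fun _ _ _ => 0) (fun _ x y => 2 * x * y) (fun _ _ y => y ^ 2)
    (fun _ x _ => -x) (fun _ _ _ => 0), K2]
  congr 1; funext t x y u; ring

lemma K0_eq : K0 Ω = affineField Ω (fun p => p.1 ^ 2) (fun p => p.1 * p.2.1 + 3 * p.2.2)
    (fun p => 3 * p.1 * p.2.2) (fun p => -(p.2.1 ^ 2 + 2 * p.1)) (fun _ => 0) := by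
  rw [← field_eq Ω (fun t _ _ => t ^ 2) (fun t x y => t * x + 3 * y) (fun t _ y => 3 * t * y)
    (fun t x _ => -(x ^ 2 + 2 * t)) (fun _ _ _ => 0), K0]
  congr 1; funext t x y u; ring

lemma P3_eq : P3 Ω = affineField Ω (fun _ => 0) (fun p => 3 * p.1 ^ 2)
    (fun p => p.1 ^ 3) (fun p => 3 * (p.2.2 - p.1 * p.2.1)) (fun _ => 0) := by
  rw [← field_eq Ω (fun _ _ _ => 0) (fun t _ _ => 3 * t ^ 2) (fun t _ _ => t ^ 3)
    (fun t x y => 3 * (y - t * x)) (fun _ _ _ => 0), P3]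
  congr 1; funext t x y u; ring

lemma P2_eq : P2 Ω = affineField Ω (fun _ => 0) (fun p => 2 * p.1)
    (fun p => p.1 ^ 2) (fun p => -p.2.1) (fun _ => 0) := by
  rw [← field_eq Ω (fun _ _ _ => 0) (fun t _ _ => 2 * t) (fun t _ _ => t ^ 2)
    (fun _ x _ => -x) (fun _ _ _ => 0), P2]
  congr 1; funext t x y u; ring

lemma P1_eq : P1 Ω = affineField Ω (fun _ => 0) (fun _ => 1)
    (fun p => p.1) (fun _ => 0) (fun _ => 0) := by
  rw [← field_eq Ω (fun _ _ _ => 0) (fun _ _ _ => 1) (fun t _ _ => t)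
    (fun _ _ _ => 0) (fun _ _ _ => 0), P1]
  congr 1; funext t x y u; ring

/-- The general element `c₁ 𝒫^t + c₂ 𝒫^y + c₃ ℐ + c₄ 𝒟^β + 𝒵(f)` of `𝔤^gen_β`. -/
noncomputable def genField (β : ℝ) (c₁ c₂ c₃ c₄ : ℝ) (f : BaseSpace → ℝ) :
    TotalSpace → TotalSpace :=
  affineField Ω (fun p => c₁ + (2 - β) * c₄ * p.1) (fun p => c₄ * p.2.1)
    (fun p => c₂ + (3 - β) * c₄ * p.2.2) (fun _ => c₃) f

lemma genField_eq (β c₁ c₂ c₃ c₄ : ℝ) (f : BaseSpace → ℝ) :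
    genField Ω β c₁ c₂ c₃ c₄ f
      = c₁ • Pt Ω + c₂ • Py Ω + c₃ • fieldI Ω + c₄ • fieldD β Ω + fieldZ Ω f := by
  funext z
  by_cases hz : z ∈ cyl Ω
  · simp only [genField, affineField, Pt, Py, fieldI, fieldD, fieldZ, field, Pi.add_apply,
      Pi.smul_apply, indicator_of_mem hz]
    ext <;> simp <;> ring
  · simp [genField, affineField, Pt, Py, fieldI, fieldD, fieldZ, field, indicator_of_notMem hz]

lemma fieldZ_congr {f g : BaseSpace → ℝ} (h : EqOn f g Ω) : fieldZ Ω f = fieldZ Ω g := by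
  refine indicator_congr fun z hz => ?_
  have := h (mem_cyl.1 hz)
  simp only [Prod.mk.eta, this]

end Fields

lemma smoothCoeffs_genField {β : ℝ} {Ω : Set BaseSpace} (c₁ c₂ c₃ c₄ : ℝ) {f : BaseSpace → ℝ}
    (hf : ContDiffOn ℝ ∞ f Ω) : SmoothCoeffs Ω (fun p => c₁ + (2 - β) * c₄ * p.1)
      (fun p => c₄ * p.2.1) (fun p => c₂ + (3 - β) * c₄ * p.2.2) (fun _ => c₃) f :=
  ⟨by fun_prop, by fun_prop, by fun_prop, by fun_prop, hf⟩

lemma isLieSymmetry_genField {β : ℝ} {Ω : Set BaseSpace} (ho : IsOpen Ω) (c₁ c₂ c₃ c₄ : ℝ)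
    {f : BaseSpace → ℝ} (hf : IsSolutionOn β Ω f) :
    IsLieSymmetry β Ω (genField Ω β c₁ c₂ c₃ c₄ f) := by
  have h1 : dd (0, 1, 0) (fun p : BaseSpace => c₄ * p.2.1) = fun _ => c₄ := by
    funext p; simp (disch := fun_prop) only [dd_const_mul, dd_x, mul_one]
  refine isLieSymmetry_affineField ho (smoothCoeffs_genField c₁ c₂ c₃ c₄ hf.smooth)
    ⟨fun p _ => ?_, fun p _ => ?_, fun p _ => ?_, fun p _ => ?_, fun p _ => ?_,
      (isSolutionOn_const c₃).eq, hf.eq⟩ <;>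
    simp (disch := fun_prop) only [dT_eq_dd, dX_eq_dd, dY_eq_dd, h1, dd_add, dd_const_mul,
      dd_const, dd_t, dd_x, dd_y]
  · ring
  · ring
  · linear_combination -c₄ * mul_deriv_abs_rpow β p.2.1
  · ring
  · ring

lemma mem_genAlgebra {β : ℝ} {Ω : Set BaseSpace} (ho : IsOpen Ω) {V : TotalSpace → TotalSpace} :
    V ∈ genAlgebra β Ω ↔
      ∃ c₁ c₂ c₃ c₄ f, IsSolutionOn β Ω f ∧ V = genField Ω β c₁ c₂ c₃ c₄ f := by
  constructor
  · intro hV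
    have h0 : IsSolutionOn β Ω (fun _ => (0 : ℝ)) := isSolutionOn_const 0
    have hZ0 : fieldZ Ω (fun _ => (0 : ℝ)) = 0 := by
      funext z; by_cases hz : z ∈ cyl Ω <;> simp [fieldZ, field, hz]
    have hZ : ∀ (a b : ℝ) (f g : BaseSpace → ℝ),
        fieldZ Ω (fun p => a * f p + b * g p) = a • fieldZ Ω f + b • fieldZ Ω g := fun a b f g => by
      funext z; by_cases hz : z ∈ cyl Ω <;> simp [fieldZ, field, hz]
    refine Submodule.span_induction (p := fun V _ => ∃ c₁ c₂ c₃ c₄ f, IsSolutionOn β Ω f ∧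
      V = genField Ω β c₁ c₂ c₃ c₄ f) ?_ ?_ ?_ ?_ hV
    · rintro V ((rfl | rfl | rfl | rfl) | ⟨f, hf, rfl⟩)
      · exact ⟨1, 0, 0, 0, _, h0, by simp [genField_eq, hZ0]⟩
      · exact ⟨0, 1, 0, 0, _, h0, by simp [genField_eq, hZ0]⟩
      · exact ⟨0, 0, 1, 0, _, h0, by simp [genField_eq, hZ0]⟩
      · exact ⟨0, 0, 0, 1, _, h0, by simp [genField_eq, hZ0]⟩
      · exact ⟨0, 0, 0, 0, f, isSolutionOn_of_mem hf, by simp [genField_eq]⟩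
    · exact ⟨0, 0, 0, 0, _, h0, by simp [genField_eq, hZ0]⟩
    · rintro _ _ _ _ ⟨a₁, a₂, a₃, a₄, f, hf, rfl⟩ ⟨b₁, b₂, b₃, b₄, g, hg, rfl⟩
      refine ⟨a₁ + b₁, a₂ + b₂, a₃ + b₃, a₄ + b₄, _, hf.comb ho hg 1 1, ?_⟩
      rw [genField_eq, genField_eq, genField_eq, hZ]
      module
    · rintro a _ _ ⟨a₁, a₂, a₃, a₄, f, hf, rfl⟩
      refine ⟨a * a₁, a * a₂, a * a₃, a * a₄, _, hf.comb ho h0 a 0, ?_⟩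
      rw [genField_eq, genField_eq, hZ]
      module
  · rintro ⟨c₁, c₂, c₃, c₄, f, hf, rfl⟩
    rw [genField_eq]
    have hs : ∀ V ∈ ({Pt Ω, Py Ω, fieldI Ω, fieldD β Ω} : Set (TotalSpace → TotalSpace)),
        V ∈ genAlgebra β Ω := fun V hV => Submodule.subset_span (Or.inl hV)
    refine add_mem (add_mem (add_mem (add_mem ?_ ?_) ?_) ?_) ?_
    · exact Submodule.smul_mem _ _ (hs _ (by simp))
    · exact Submodule.smul_mem _ _ (hs _ (by simp))
    · exact Submodule.smul_mem _ _ (hs _ (by simp))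
    · exact Submodule.smul_mem _ _ (hs _ (by simp))
    · refine Submodule.subset_span (Or.inr ⟨_, hf.indicator_mem ho, ?_⟩)
      exact fieldZ_congr Ω fun p hp => (indicator_of_mem hp f).symm

lemma genAlgebra_le {β : ℝ} (Ω : TopologicalSpace.Opens BaseSpace) :
    genAlgebra β Ω ≤ maxInvarianceAlgebra β Ω := fun V hV => by
  obtain ⟨c₁, c₂, c₃, c₄, f, hf, rfl⟩ := (mem_genAlgebra Ω.isOpen).1 hV
  exact isLieSymmetry_genField Ω.isOpen c₁ c₂ c₃ c₄ hf

lemma isLieClosed_genAlgebra {β : ℝ} {Ω : TopologicalSpace.Opens BaseSpace}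
    (hΩ : IsDomainFor β Ω) : IsLieClosed (genAlgebra β Ω) := by
  intro V hV W hW
  have ho := Ω.isOpen
  obtain ⟨c₁, c₂, c₃, c₄, f, hf, rfl⟩ := (mem_genAlgebra ho).1 hV
  obtain ⟨d₁, d₂, d₃, d₄, g, hg, rfl⟩ := (mem_genAlgebra ho).1 hW
  rw [mem_genAlgebra ho]
  refine ⟨(2 - β) * (c₁ * d₄ - d₁ * c₄), (3 - β) * (c₂ * d₄ - d₂ * c₄), 0, 0, _,
    isSolutionOn_bracket hΩ (isLieSymmetry_genField ho c₁ c₂ c₃ c₄ hf)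
      (isLieSymmetry_genField ho d₁ d₂ d₃ d₄ hg) hf hg, ?_⟩
  unfold genField
  rw [lieBracket_affineField ho (smoothCoeffs_genField c₁ c₂ c₃ c₄ hf.smooth)
    (smoothCoeffs_genField d₁ d₂ d₃ d₄ hg.smooth)]
  refine affineField_congr ?_ ?_ ?_ ?_ fun p _ => rfl
  all_goals
    intro p _
    simp (disch := fun_prop) only [along, dd_add, dd_const_mul, dd_const, dd_t, dd_x, dd_y]
    ring

lemma maxInvarianceAlgebra_eq_of_generic {β : ℝ} (hβ : β ∉ ({0, 2, 3, 5} : Set ℝ))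
    {Ω : TopologicalSpace.Opens BaseSpace} (hΩ : IsConnected (Ω : Set BaseSpace)) :
    maxInvarianceAlgebra β Ω = genAlgebra β Ω := by
  refine le_antisymm (fun V hV => ?_) (genAlgebra_le Ω)
  obtain ⟨τ, ξ, ζ, η₁, η₀, h, rfl⟩ := IsLieSymmetry.exists_symmetryCoeffs Ω.isOpen hV
  obtain ⟨c₁, c₂, c₃, c₄, hc⟩ := h.generic hβ Ω.isOpen hΩ
  exact (mem_genAlgebra Ω.isOpen).2 ⟨c₁, c₂, c₃, c₄, η₀, ⟨h.smooth_η₀, h.eq₀⟩,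
    affineField_congr (fun p hp => (hc p hp).1) (fun p hp => (hc p hp).2.1)
      (fun p hp => (hc p hp).2.2.1) (fun p hp => (hc p hp).2.2.2) fun p _ => rfl⟩

/-- A polynomial of degree two in a coordinate that vanishes on a nonempty open set has zero
coefficients. -/
lemma quadratic_coeffs {Ω : Set BaseSpace} (ho : IsOpen Ω) (hn : Ω.Nonempty) {φ : BaseSpace → ℝ}
    (hφ : Differentiable ℝ φ) {e : BaseSpace} (he : ∀ p, dd e φ p = 1) {a b c : ℝ}
    (h : ∀ p ∈ Ω, a + b * φ p + c * φ p ^ 2 = 0) : a = 0 ∧ b = 0 ∧ c = 0 := by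
  have h1 : ∀ p ∈ Ω, b + 2 * c * φ p = 0 := fun p hp => by
    have := dd_eq_zero_of_eqOn ho h e hp
    simp (disch := fun_prop) only [dd_add, dd_const_mul, dd_const, dd_pow, he] at this
    norm_num at this
    linarith
  have h2 : c = 0 := by
    obtain ⟨p, hp⟩ := hn
    have := dd_eq_zero_of_eqOn ho h1 e hp
    simp (disch := fun_prop) only [dd_add, dd_const_mul, dd_const, he] at this
    linarith
  obtain ⟨p, hp⟩ := hn
  have hb : b = 0 := by simpa [h2] using h1 p hp
  exact ⟨by simpa [h2, hb] using h p hp, hb, h2⟩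

/-! ### The algebra for `β = 2` -/

/-- The general element of `𝔤_2`. -/
noncomputable def twoField (Ω : Set BaseSpace) (c₁ c₂ c₃ c₄ c₅ : ℝ) (f : BaseSpace → ℝ) :
    TotalSpace → TotalSpace :=
  affineField Ω (fun _ => c₁) (fun p => c₄ * p.2.1 + c₅ * (2 * p.2.1 * p.2.2))
    (fun p => c₂ + c₄ * p.2.2 + c₅ * p.2.2 ^ 2) (fun p => c₃ - c₅ * p.2.1) f

lemma smoothCoeffs_twoField {Ω : Set BaseSpace} (c₁ c₂ c₃ c₄ c₅ : ℝ) {f : BaseSpace → ℝ}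
    (hf : ContDiffOn ℝ ∞ f Ω) : SmoothCoeffs Ω (fun _ => c₁)
      (fun p => c₄ * p.2.1 + c₅ * (2 * p.2.1 * p.2.2))
      (fun p => c₂ + c₄ * p.2.2 + c₅ * p.2.2 ^ 2) (fun p => c₃ - c₅ * p.2.1) f :=
  ⟨by fun_prop, by fun_prop, by fun_prop, by fun_prop, hf⟩

lemma twoField_eq (Ω : Set BaseSpace) (c₁ c₂ c₃ c₄ c₅ : ℝ) (f : BaseSpace → ℝ) :
    twoField Ω c₁ c₂ c₃ c₄ c₅ f = genField Ω 2 c₁ c₂ c₃ c₄ f + c₅ • K2 Ω := by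
  funext z
  rw [K2_eq]
  by_cases hz : z ∈ cyl Ω
  · simp only [twoField, genField, affineField, Pi.add_apply, Pi.smul_apply, indicator_of_mem hz]
    ext <;> simp only [Prod.fst_add, Prod.snd_add, Prod.smul_fst, Prod.smul_snd, smul_eq_mul] <;> ring
  · simp [twoField, genField, affineField, indicator_of_notMem hz]

lemma isLieSymmetry_twoField {Ω : Set BaseSpace} (ho : IsOpen Ω) (c₁ c₂ c₃ c₄ c₅ : ℝ)
    {f : BaseSpace → ℝ} (hf : IsSolutionOn 2 Ω f) :
    IsLieSymmetry 2 Ω (twoField Ω c₁ c₂ c₃ c₄ c₅ f) := by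
  have h1 : dd (0, 1, 0) (fun p : BaseSpace => c₄ * p.2.1 + c₅ * (2 * p.2.1 * p.2.2))
      = fun p => c₄ + c₅ * (2 * p.2.2) := by
    funext p
    simp (disch := fun_prop) only [dd_add, dd_const_mul, dd_mul, dd_x, dd_y]
    ring
  have h2 : dd (0, 1, 0) (fun p : BaseSpace => c₃ - c₅ * p.2.1) = fun p => -c₅ := by
    funext p
    simp (disch := fun_prop) only [dd_sub, dd_const_mul, dd_const, dd_x]
    ring
  refine isLieSymmetry_affineField ho (smoothCoeffs_twoField c₁ c₂ c₃ c₄ c₅ hf.smooth)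
    ⟨fun p _ => ?_, fun p _ => ?_, fun p _ => ?_, fun p _ => ?_, fun p _ => ?_,
      fun p _ => ?_, hf.eq⟩ <;>
    simp (disch := fun_prop) only [SatisfiesAt, dT_eq_dd, dX_eq_dd, dY_eq_dd, h1, h2, dd_add,
      dd_sub, dd_mul, dd_const, dd_pow, dd_x, dd_y, Real.rpow_two, sq_abs]
  · norm_num
  · have := mul_deriv_abs_rpow 2 p.2.1
    simp only [Real.rpow_two, sq_abs] at this ⊢
    linear_combination -(c₄ + 2 * c₅ * p.2.2) * this
  · norm_num; ring
  · norm_num; ring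
  · norm_num

lemma mem_maxInvarianceAlgebra_two {Ω : TopologicalSpace.Opens BaseSpace}
    (hΩ : IsConnected (Ω : Set BaseSpace)) {V : TotalSpace → TotalSpace} :
    V ∈ maxInvarianceAlgebra 2 Ω ↔
      ∃ c₁ c₂ c₃ c₄ c₅ f, IsSolutionOn 2 Ω f ∧ V = twoField Ω c₁ c₂ c₃ c₄ c₅ f := by
  constructor
  · intro hV
    obtain ⟨τ, ξ, ζ, η₁, η₀, h, rfl⟩ := IsLieSymmetry.exists_symmetryCoeffs Ω.isOpen hV
    obtain ⟨c₁, c₂, c₃, c₄, c₅, hc⟩ := h.two Ω.isOpen hΩ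
    exact ⟨c₁, c₂, c₃, c₄, c₅, η₀, ⟨h.smooth_η₀, h.eq₀⟩,
      affineField_congr (fun p hp => (hc p hp).1) (fun p hp => (hc p hp).2.1)
        (fun p hp => (hc p hp).2.2.1) (fun p hp => (hc p hp).2.2.2) fun p _ => rfl⟩
  · rintro ⟨c₁, c₂, c₃, c₄, c₅, f, hf, rfl⟩
    exact isLieSymmetry_twoField Ω.isOpen c₁ c₂ c₃ c₄ c₅ hf

lemma isLieClosed_two {Ω : TopologicalSpace.Opens BaseSpace}
    (hΩ : IsDomainFor 2 Ω) : IsLieClosed (maxInvarianceAlgebra 2 Ω) := by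
  intro V hV W hW
  have ho := Ω.isOpen
  obtain ⟨c₁, c₂, c₃, c₄, c₅, f, hf, rfl⟩ := (mem_maxInvarianceAlgebra_two hΩ.isConnected).1 hV
  obtain ⟨d₁, d₂, d₃, d₄, d₅, g, hg, rfl⟩ := (mem_maxInvarianceAlgebra_two hΩ.isConnected).1 hW
  rw [mem_maxInvarianceAlgebra_two hΩ.isConnected]
  refine ⟨0, c₂ * d₄ - c₄ * d₂, 0, 2 * (c₂ * d₅ - c₅ * d₂), c₄ * d₅ - c₅ * d₄, _,
    isSolutionOn_bracket hΩ (isLieSymmetry_twoField ho c₁ c₂ c₃ c₄ c₅ hf)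
      (isLieSymmetry_twoField ho d₁ d₂ d₃ d₄ d₅ hg) hf hg, ?_⟩
  unfold twoField
  rw [lieBracket_affineField ho (smoothCoeffs_twoField c₁ c₂ c₃ c₄ c₅ hf.smooth)
    (smoothCoeffs_twoField d₁ d₂ d₃ d₄ d₅ hg.smooth)]
  refine affineField_congr ?_ ?_ ?_ ?_ fun p _ => rfl
  all_goals
    intro p _
    simp (disch := fun_prop) only [along, dd_add, dd_sub, dd_mul, dd_const, dd_pow,
      dd_x, dd_y]
    norm_num <;> ring

lemma maxInvarianceAlgebra_two {Ω : TopologicalSpace.Opens BaseSpace}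
    (hΩ : IsConnected (Ω : Set BaseSpace)) : maxInvarianceAlgebra 2 Ω =
      genAlgebra 2 Ω ⊔ Submodule.span ℝ {K2 Ω} := by
  ext V
  simp only [mem_maxInvarianceAlgebra_two hΩ, Submodule.mem_sup, Submodule.mem_span_singleton,
    mem_genAlgebra Ω.isOpen]
  constructor
  · rintro ⟨c₁, c₂, c₃, c₄, c₅, f, hf, rfl⟩
    exact ⟨_, ⟨c₁, c₂, c₃, c₄, f, hf, rfl⟩, _, ⟨c₅, rfl⟩, (twoField_eq _ _ _ _ _ _ _).symm⟩
  · rintro ⟨_, ⟨c₁, c₂, c₃, c₄, f, hf, rfl⟩, _, ⟨c₅, rfl⟩, rfl⟩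
    exact ⟨c₁, c₂, c₃, c₄, c₅, f, hf, (twoField_eq _ _ _ _ _ _ _).symm⟩

lemma smul_K2_mem_genAlgebra {Ω : TopologicalSpace.Opens BaseSpace}
    (hΩ : IsConnected (Ω : Set BaseSpace)) {c : ℝ}
    (h : c • K2 Ω ∈ genAlgebra 2 Ω) : c = 0 := by
  obtain ⟨c₁, c₂, c₃, c₄, f, hf, he⟩ := (mem_genAlgebra Ω.isOpen).1 h
  have h1 : twoField Ω 0 0 0 0 c (fun _ => 0) = twoField Ω c₁ c₂ c₃ c₄ 0 f := by
    rw [twoField_eq, twoField_eq, he, zero_smul, add_zero]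
    have : genField Ω 2 0 0 0 0 (fun _ => 0) = 0 := by
      funext z; by_cases hz : z ∈ cyl Ω <;> simp [genField, affineField, hz]
    rw [this, zero_add]
  have h2 := fun p hp => (eqOn_of_affineField_eq h1 (p := p) hp).2.2.1
  exact (quadratic_coeffs Ω.isOpen hΩ.nonempty (φ := fun p => p.2.2) (e := (0, 0, 1))
    (a := -c₂) (b := -c₄) (c := c) (by fun_prop) (by simp)
    (fun p hp => by linear_combination h2 p hp)).2.2

/-! ### The algebra for `β = 0` -/

/-- The general element of `𝔤_0`. -/
noncomputable def zeroField (Ω : Set BaseSpace) (c₁ c₂ c₃ c₄ c₅ c₆ c₇ c₈ : ℝ)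
    (f : BaseSpace → ℝ) : TotalSpace → TotalSpace :=
  affineField Ω (fun p => c₁ + 2 * c₄ * p.1 + c₅ * p.1 ^ 2)
    (fun p => c₄ * p.2.1 + c₅ * (p.1 * p.2.1 + 3 * p.2.2) + 3 * c₆ * p.1 ^ 2 + 2 * c₇ * p.1 + c₈)
    (fun p => c₂ + 3 * c₄ * p.2.2 + 3 * c₅ * (p.1 * p.2.2) + c₆ * p.1 ^ 3 + c₇ * p.1 ^ 2
      + c₈ * p.1)
    (fun p => c₃ - c₅ * (p.2.1 ^ 2 + 2 * p.1) + 3 * c₆ * (p.2.2 - p.1 * p.2.1) - c₇ * p.2.1) f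

lemma smoothCoeffs_zeroField {Ω : Set BaseSpace} (c₁ c₂ c₃ c₄ c₅ c₆ c₇ c₈ : ℝ)
    {f : BaseSpace → ℝ} (hf : ContDiffOn ℝ ∞ f Ω) :
    SmoothCoeffs Ω (fun p => c₁ + 2 * c₄ * p.1 + c₅ * p.1 ^ 2)
    (fun p => c₄ * p.2.1 + c₅ * (p.1 * p.2.1 + 3 * p.2.2) + 3 * c₆ * p.1 ^ 2 + 2 * c₇ * p.1 + c₈)
    (fun p => c₂ + 3 * c₄ * p.2.2 + 3 * c₅ * (p.1 * p.2.2) + c₆ * p.1 ^ 3 + c₇ * p.1 ^ 2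
      + c₈ * p.1)
    (fun p => c₃ - c₅ * (p.2.1 ^ 2 + 2 * p.1) + 3 * c₆ * (p.2.2 - p.1 * p.2.1) - c₇ * p.2.1) f :=
  ⟨by fun_prop, by fun_prop, by fun_prop, by fun_prop, hf⟩

lemma zeroField_eq (Ω : Set BaseSpace) (c₁ c₂ c₃ c₄ c₅ c₆ c₇ c₈ : ℝ) (f : BaseSpace → ℝ) :
    zeroField Ω c₁ c₂ c₃ c₄ c₅ c₆ c₇ c₈ f = genField Ω 0 c₁ c₂ c₃ c₄ f
      + (c₅ • K0 Ω + (c₆ • P3 Ω + (c₇ • P2 Ω + c₈ • P1 Ω))) := by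
  funext z
  rw [K0_eq, P3_eq, P2_eq, P1_eq]
  by_cases hz : z ∈ cyl Ω
  · simp only [zeroField, genField, affineField, Pi.add_apply, Pi.smul_apply, indicator_of_mem hz]
    ext <;> simp <;> ring
  · simp [zeroField, genField, affineField, indicator_of_notMem hz]

lemma isLieSymmetry_zeroField {Ω : Set BaseSpace} (ho : IsOpen Ω) (c₁ c₂ c₃ c₄ c₅ c₆ c₇ c₈ : ℝ)
    {f : BaseSpace → ℝ} (hf : IsSolutionOn 0 Ω f) :
    IsLieSymmetry 0 Ω (zeroField Ω c₁ c₂ c₃ c₄ c₅ c₆ c₇ c₈ f) := by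
  have h1 : dd (0, 1, 0) (fun p : BaseSpace => c₄ * p.2.1 + c₅ * (p.1 * p.2.1 + 3 * p.2.2)
      + 3 * c₆ * p.1 ^ 2 + 2 * c₇ * p.1 + c₈) = fun p => c₄ + c₅ * p.1 := by
    funext p
    simp (disch := fun_prop) only [dd_add, dd_const_mul, dd_mul, dd_const, dd_pow, dd_t, dd_x,
      dd_y]
    ring
  have h2 : dd (0, 1, 0) (fun p : BaseSpace => c₃ - c₅ * (p.2.1 ^ 2 + 2 * p.1)
      + 3 * c₆ * (p.2.2 - p.1 * p.2.1) - c₇ * p.2.1)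
      = fun p => -(2 * c₅) * p.2.1 - 3 * c₆ * p.1 - c₇ := by
    funext p
    simp (disch := fun_prop) only [dd_add, dd_sub, dd_const_mul, dd_mul, dd_const, dd_pow, dd_t,
      dd_x, dd_y]
    norm_num
    ring
  refine isLieSymmetry_affineField ho (smoothCoeffs_zeroField c₁ c₂ c₃ c₄ c₅ c₆ c₇ c₈ hf.smooth)
    ⟨fun p _ => ?_, fun p _ => ?_, fun p _ => ?_, fun p _ => ?_, fun p _ => ?_,
      fun p _ => ?_, hf.eq⟩ <;>
    simp (disch := fun_prop) only [SatisfiesAt, dT_eq_dd, dX_eq_dd, dY_eq_dd, h1, h2, dd_add,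
      dd_sub, dd_mul, dd_const, dd_pow, dd_t, dd_x, dd_y, Real.rpow_zero,
      deriv_const]
  all_goals norm_num
  all_goals ring

lemma mem_maxInvarianceAlgebra_zero {Ω : TopologicalSpace.Opens BaseSpace}
    (hΩ : IsConnected (Ω : Set BaseSpace)) {V : TotalSpace → TotalSpace} :
    V ∈ maxInvarianceAlgebra 0 Ω ↔ ∃ c₁ c₂ c₃ c₄ c₅ c₆ c₇ c₈ f, IsSolutionOn 0 Ω f ∧
      V = zeroField Ω c₁ c₂ c₃ c₄ c₅ c₆ c₇ c₈ f := by
  constructor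
  · intro hV
    obtain ⟨τ, ξ, ζ, η₁, η₀, h, rfl⟩ := IsLieSymmetry.exists_symmetryCoeffs Ω.isOpen hV
    obtain ⟨c₁, c₂, c₃, c₄, c₅, c₆, c₇, c₈, hc⟩ := h.zero Ω.isOpen hΩ
    exact ⟨c₁, c₂, c₃, c₄, c₅, c₆, c₇, c₈, η₀, ⟨h.smooth_η₀, h.eq₀⟩,
      affineField_congr (fun p hp => (hc p hp).1) (fun p hp => (hc p hp).2.1)
        (fun p hp => (hc p hp).2.2.1) (fun p hp => (hc p hp).2.2.2) fun p _ => rfl⟩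
  · rintro ⟨c₁, c₂, c₃, c₄, c₅, c₆, c₇, c₈, f, hf, rfl⟩
    exact isLieSymmetry_zeroField Ω.isOpen c₁ c₂ c₃ c₄ c₅ c₆ c₇ c₈ hf

lemma isLieClosed_zero {Ω : TopologicalSpace.Opens BaseSpace}
    (hΩ : IsDomainFor 0 Ω) : IsLieClosed (maxInvarianceAlgebra 0 Ω) := by
  intro V hV W hW
  have ho := Ω.isOpen
  obtain ⟨c₁, c₂, c₃, c₄, c₅, c₆, c₇, c₈, f, hf, rfl⟩ :=
    (mem_maxInvarianceAlgebra_zero hΩ.isConnected).1 hV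
  obtain ⟨d₁, d₂, d₃, d₄, d₅, d₆, d₇, d₈, g, hg, rfl⟩ :=
    (mem_maxInvarianceAlgebra_zero hΩ.isConnected).1 hW
  rw [mem_maxInvarianceAlgebra_zero hΩ.isConnected]
  refine ⟨2 * (c₁ * d₄ - c₄ * d₁), (c₁ * d₈ - c₈ * d₁) + 3 * (c₂ * d₄ - c₄ * d₂),
    -2 * (c₁ * d₅ - c₅ * d₁) - (c₈ * d₇ - c₇ * d₈) + 3 * (c₂ * d₆ - c₆ * d₂),
    c₁ * d₅ - c₅ * d₁, 2 * (c₄ * d₅ - c₅ * d₄), 3 * (c₄ * d₆ - c₆ * d₄) - (c₅ * d₇ - c₇ * d₅),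
    3 * (c₁ * d₆ - c₆ * d₁) + (c₄ * d₇ - c₇ * d₄) + 2 * (c₈ * d₅ - c₅ * d₈),
    2 * (c₁ * d₇ - c₇ * d₁) + (c₈ * d₄ - c₄ * d₈) + 3 * (c₂ * d₅ - c₅ * d₂), _,
    isSolutionOn_bracket hΩ (isLieSymmetry_zeroField ho c₁ c₂ c₃ c₄ c₅ c₆ c₇ c₈ hf)
      (isLieSymmetry_zeroField ho d₁ d₂ d₃ d₄ d₅ d₆ d₇ d₈ hg) hf hg, ?_⟩
  unfold zeroField
  rw [lieBracket_affineField ho (smoothCoeffs_zeroField c₁ c₂ c₃ c₄ c₅ c₆ c₇ c₈ hf.smooth)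
    (smoothCoeffs_zeroField d₁ d₂ d₃ d₄ d₅ d₆ d₇ d₈ hg.smooth)]
  refine affineField_congr ?_ ?_ ?_ ?_ fun p _ => rfl
  all_goals
    intro p _
    simp (disch := fun_prop) only [along, dd_add, dd_sub, dd_mul, dd_const, dd_pow,
      dd_t, dd_x, dd_y]
    norm_num
    ring

lemma mem_span_zero {Ω : Set BaseSpace} {V : TotalSpace → TotalSpace} :
    V ∈ Submodule.span ℝ {K0 Ω, P3 Ω, P2 Ω, P1 Ω} ↔
      ∃ c₅ c₆ c₇ c₈ : ℝ, V = c₅ • K0 Ω + (c₆ • P3 Ω + (c₇ • P2 Ω + c₈ • P1 Ω)) := by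
  simp only [Submodule.mem_span_insert, Submodule.mem_span_singleton]
  constructor
  · rintro ⟨c₅, _, ⟨c₆, _, ⟨c₇, _, ⟨c₈, rfl⟩, rfl⟩, rfl⟩, rfl⟩
    exact ⟨c₅, c₆, c₇, c₈, rfl⟩
  · rintro ⟨c₅, c₆, c₇, c₈, rfl⟩
    exact ⟨c₅, _, ⟨c₆, _, ⟨c₇, _, ⟨c₈, rfl⟩, rfl⟩, rfl⟩, rfl⟩

lemma maxInvarianceAlgebra_zero {Ω : TopologicalSpace.Opens BaseSpace}
    (hΩ : IsConnected (Ω : Set BaseSpace)) : maxInvarianceAlgebra 0 Ω =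
      genAlgebra 0 Ω ⊔ Submodule.span ℝ {K0 Ω, P3 Ω, P2 Ω, P1 Ω} := by
  ext V
  simp only [mem_maxInvarianceAlgebra_zero hΩ, Submodule.mem_sup, mem_span_zero,
    mem_genAlgebra Ω.isOpen]
  constructor
  · rintro ⟨c₁, c₂, c₃, c₄, c₅, c₆, c₇, c₈, f, hf, rfl⟩
    exact ⟨_, ⟨c₁, c₂, c₃, c₄, f, hf, rfl⟩, _, ⟨c₅, c₆, c₇, c₈, rfl⟩,
      (zeroField_eq _ _ _ _ _ _ _ _ _ _).symm⟩
  · rintro ⟨_, ⟨c₁, c₂, c₃, c₄, f, hf, rfl⟩, _, ⟨c₅, c₆, c₇, c₈, rfl⟩, rfl⟩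
    exact ⟨c₁, c₂, c₃, c₄, c₅, c₆, c₇, c₈, f, hf, (zeroField_eq _ _ _ _ _ _ _ _ _ _).symm⟩

/-- A combination of the additional fields for `β = 0` lies in `𝔤^gen_0` only if it is trivial. -/
lemma coeffs_eq_zero_of_mem_genAlgebra_zero {Ω : TopologicalSpace.Opens BaseSpace}
    (hΩ : IsConnected (Ω : Set BaseSpace)) {d₅ d₆ d₇ d₈ : ℝ}
    (h : d₅ • K0 Ω + (d₆ • P3 Ω + (d₇ • P2 Ω + d₈ • P1 Ω)) ∈ genAlgebra 0 Ω) :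
    d₅ = 0 ∧ d₆ = 0 ∧ d₇ = 0 ∧ d₈ = 0 := by
  obtain ⟨c₁, c₂, c₃, c₄, f, hf, he⟩ := (mem_genAlgebra Ω.isOpen).1 h
  have h1 : zeroField Ω 0 0 0 0 d₅ d₆ d₇ d₈ (fun _ => 0) = zeroField Ω c₁ c₂ c₃ c₄ 0 0 0 0 f := by
    rw [zeroField_eq, zeroField_eq, he]
    have : genField Ω 0 0 0 0 0 (fun _ => 0) = 0 := by
      funext z; by_cases hz : z ∈ cyl Ω <;> simp [genField, affineField, hz]
    rw [this]
    module
  have h2 := fun p hp => eqOn_of_affineField_eq h1 (p := p) hp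
  obtain ⟨-, h4, h5⟩ := quadratic_coeffs Ω.isOpen hΩ.nonempty (φ := fun p => p.1) (e := (1, 0, 0))
    (a := -c₁) (b := -(2 * c₄)) (c := d₅) (by fun_prop) (by simp)
    (fun p hp => by linear_combination (h2 p hp).1)
  have h4' : c₄ = 0 := by linarith
  subst h4' h5
  obtain ⟨h8, h7, h6⟩ := quadratic_coeffs Ω.isOpen hΩ.nonempty (φ := fun p => p.1)
    (e := (1, 0, 0)) (a := d₈) (b := 2 * d₇) (c := 3 * d₆) (by fun_prop) (by simp)
    (fun p hp => by linear_combination (h2 p hp).2.1)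
  exact ⟨rfl, by linarith, by linarith, h8⟩

/-! ### The exceptional values of `β` -/

/-- The symmetry `t² ∂_t - 2tx ∂_x - (1/|x| + 2t) u ∂_u` for `β = 3`, the counterpart of `𝒦_2`. -/
noncomputable def extraThree (Ω : Set BaseSpace) : TotalSpace → TotalSpace :=
  affineField Ω (fun p => p.1 ^ 2) (fun p => -(2 * p.1 * p.2.1)) (fun _ => 0)
    (fun p => -(|p.2.1| ^ (-1 : ℝ) + 2 * p.1)) (fun _ => 0)

lemma isLieSymmetry_extraThree {Ω : Set BaseSpace} (ho : IsOpen Ω)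
    (hx : ∀ p ∈ Ω, p.2.1 ≠ 0) : IsLieSymmetry 3 Ω (extraThree Ω) := by
  have sg : ContDiffOn ℝ ∞ (fun p : BaseSpace => |p.2.1| ^ (-1 : ℝ)) Ω := by
    intro p hp
    refine ContDiffAt.contDiffWithinAt ?_
    have h1 : ContDiffAt ℝ ∞ (fun q : BaseSpace => |q.2.1|) p :=
      ContDiffAt.comp (g := fun s : ℝ => |s|) (f := fun q : BaseSpace => q.2.1) p
        (contDiffAt_abs (hx p hp)) (by fun_prop)
    exact h1.rpow_const_of_ne (abs_pos.2 (hx p hp)).ne'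
  have dg : ∀ e : BaseSpace, ∀ p ∈ Ω, dd e (fun q : BaseSpace => |q.2.1| ^ (-1 : ℝ)) p
      = deriv (fun s : ℝ => |s| ^ (-1 : ℝ)) p.2.1 * e.2.1 := by
    intro e p hp
    have e5 : DifferentiableAt ℝ (fun s : ℝ => |s| ^ (-1 : ℝ)) p.2.1 :=
      ((hasDerivAt_abs (hx p hp)).rpow_const (Or.inl (abs_pos.2 (hx p hp)).ne')).differentiableAt
    have e6 : HasFDerivAt (fun q : BaseSpace => q.2.1)
      ((ContinuousLinearMap.fst ℝ ℝ ℝ).comp (ContinuousLinearMap.snd ℝ ℝ (ℝ × ℝ))) p :=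
      ((ContinuousLinearMap.fst ℝ ℝ ℝ).comp (ContinuousLinearMap.snd ℝ ℝ (ℝ × ℝ))).hasFDerivAt
    have := (HasDerivAt.comp_hasFDerivAt (h₂ := fun s : ℝ => |s| ^ (-1 : ℝ)) p
      e5.hasDerivAt e6).fderiv
    simp only [Function.comp_def] at this
    simp [dd, this]
  set g : BaseSpace → ℝ := fun p => |p.2.1| ^ (-1 : ℝ) with hg
  have sgx := ContDiffOn.dd sg ho (0, 1, 0)
  -- `x g_x = -g`, and hence `x² g_xx = 2 g`.
  have g1 : ∀ p ∈ Ω, p.2.1 * dd (0, 1, 0) g p + g p = 0 := fun p hp => by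
    have := mul_deriv_abs_rpow (-1) p.2.1
    rw [dg _ p hp]
    simp only [hg]
    linear_combination this
  have g2 : ∀ p ∈ Ω, p.2.1 * dd (0, 1, 0) (dd (0, 1, 0) g) p + 2 * dd (0, 1, 0) g p = 0 := by
    intro p hp
    have e1 := ContDiffOn.differentiableAt' sg ho hp
    have e2 := ContDiffOn.differentiableAt' sgx ho hp
    have := dd_eq_zero_of_eqOn ho g1 (0, 1, 0) hp
    simp (disch := fun_prop) only [dd_add, dd_mul, dd_x] at this
    linear_combination this
  have hs : SmoothCoeffs Ω (fun p => p.1 ^ 2) (fun p => -(2 * p.1 * p.2.1)) (fun _ => 0)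
      (fun p => -(g p + 2 * p.1)) (fun _ => 0) :=
    ⟨by fun_prop, by fun_prop, by fun_prop, (sg.add (by fun_prop)).neg, by fun_prop⟩
  have h1 : ∀ e : BaseSpace, dd e (fun p : BaseSpace => -(2 * p.1 * p.2.1))
      = fun p => -(2 * (e.1 * p.2.1 + p.1 * e.2.1)) := fun e => by
    funext p
    rw [dd_neg]
    simp (disch := fun_prop) only [dd_mul, dd_const, dd_t, dd_x]
    ring
  have h2 : ∀ e : BaseSpace, ∀ p ∈ Ω, dd e (fun p : BaseSpace => -(g p + 2 * p.1)) p
      = -(dd e g p + 2 * e.1) := fun e p hp => by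
    have e1 := ContDiffOn.differentiableAt' sg ho hp
    rw [dd_neg]
    simp (disch := fun_prop) only [dd_add, dd_const_mul, dd_t]
  have h3 : ∀ p ∈ Ω, dd (0, 1, 0) (dd (0, 1, 0) (fun p : BaseSpace => -(g p + 2 * p.1))) p
      = -dd (0, 1, 0) (dd (0, 1, 0) g) p := fun p hp => by
    have e2 := ContDiffOn.differentiableAt' sgx ho hp
    rw [dd_of_eqOn ho (h2 (0, 1, 0)) _ p hp, dd_neg]
    simp (disch := fun_prop) only [dd_add, dd_const, add_zero]
  -- `|x|³ g = x²`.
  have hgx : ∀ p ∈ Ω, |p.2.1| ^ (3 : ℝ) * g p = p.2.1 ^ 2 := fun p hp => by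
    simp only [hg]
    rw [← Real.rpow_add (abs_pos.2 (hx p hp)), ← sq_abs, ← Real.rpow_natCast]
    norm_num
  have key : ∀ p ∈ Ω, |p.2.1| ^ (3 : ℝ) * dd (0, 1, 0) g p = -p.2.1 := fun p hp => by
    apply mul_left_cancel₀ (hx p hp)
    linear_combination |p.2.1| ^ (3 : ℝ) * g1 p hp - hgx p hp
  have key2 : ∀ p ∈ Ω, |p.2.1| ^ (3 : ℝ) * dd (0, 1, 0) (dd (0, 1, 0) g) p = 2 := fun p hp => by
    apply mul_left_cancel₀ (hx p hp)
    linear_combination |p.2.1| ^ (3 : ℝ) * g2 p hp - 2 * key p hp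
  have h0 : ∀ e : BaseSpace, dd e (fun p : BaseSpace => p.1 ^ 2) = fun p => 2 * p.1 * e.1 :=
    fun e => by
      funext p
      simp (disch := fun_prop) only [dd_pow, dd_t]
      norm_num
  refine isLieSymmetry_affineField (η₁ := fun p => -(g p + 2 * p.1)) ho hs
    ⟨fun p _ => ?_, fun p _ => ?_, fun p _ => ?_, fun p _ => ?_, fun p hp => ?_,
      fun p hp => ?_, (isSolutionOn_const 0).eq⟩
  · simp [dX_eq_dd, h0]
  · simp [dX_eq_dd]
  · simp only [dT_eq_dd, dX_eq_dd, dY_eq_dd, h1, h0]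
    linear_combination 2 * p.1 * mul_deriv_abs_rpow 3 p.2.1
  · simp only [dT_eq_dd, dY_eq_dd, h0, dd_const]
    ring
  · have h4 : dd (0, 1, 0) (fun p : BaseSpace => -(2 * (0 * p.2.1 + p.1 * 1)))
        = fun _ => 0 := by
      funext p
      rw [dd_neg]
      simp (disch := fun_prop) only [dd_add, dd_mul, dd_const, dd_t, dd_x]
      ring
    simp only [dT_eq_dd, dX_eq_dd, dY_eq_dd, h1, h2 _ p hp, h4]
    linear_combination -2 * key p hp
  · unfold SatisfiesAt
    simp only [dT_eq_dd, dX_eq_dd, dY_eq_dd, h2 _ p hp, h3 p hp, dg _ p hp]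
    linear_combination key2 p hp

/-- The symmetry `y ∂_t - x² ∂_x - xu ∂_u` for `β = 5`, the counterpart of `𝒫^1`. -/
noncomputable def extraFive (Ω : Set BaseSpace) : TotalSpace → TotalSpace :=
  affineField Ω (fun p => p.2.2) (fun p => -p.2.1 ^ 2) (fun _ => 0) (fun p => -p.2.1) (fun _ => 0)

lemma isLieSymmetry_extraFive {Ω : Set BaseSpace} (ho : IsOpen Ω) :
    IsLieSymmetry 5 Ω (extraFive Ω) := by
  have h1 : ∀ e : BaseSpace, dd e (fun p : BaseSpace => -p.2.1 ^ 2)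
      = fun p => -(2 * p.2.1 * e.2.1) := fun e => by
    funext p
    rw [dd_neg]
    simp (disch := fun_prop) only [dd_pow, dd_x]
    norm_num
  have h2 : ∀ e : BaseSpace, dd e (fun p : BaseSpace => -p.2.1) = fun _ => -e.2.1 := fun e => by
    funext p
    rw [dd_neg, dd_x]
  have h3 : ∀ p, dd (0, 1, 0) (fun p : BaseSpace => -(2 * p.2.1 * 1)) p = -2 := fun p => by
    rw [dd_neg]
    simp (disch := fun_prop) only [dd_mul, dd_const, dd_x]
    ring
  refine isLieSymmetry_affineField ho
    ⟨by fun_prop, by fun_prop, by fun_prop, by fun_prop, by fun_prop⟩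
    ⟨fun p _ => ?_, fun p _ => ?_, fun p _ => ?_, fun p _ => ?_, fun p _ => ?_,
      fun p _ => ?_, (isSolutionOn_const 0).eq⟩ <;>
    simp only [SatisfiesAt, dT_eq_dd, dX_eq_dd, dY_eq_dd, h1, h2, h3, dd_const, dd_y]
  · linear_combination p.2.1 * mul_deriv_abs_rpow 5 p.2.1
  · ring
  · ring
  · ring

lemma genAlgebra_ne_of_mem {β : ℝ} (hβ : β ∈ ({0, 2, 3, 5} : Set ℝ))
    {Ω : TopologicalSpace.Opens BaseSpace} (hΩ : IsDomainFor β Ω) :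
    maxInvarianceAlgebra β Ω ≠ genAlgebra β Ω := by
  intro he
  have ho := Ω.isOpen
  have hn := hΩ.isConnected.nonempty
  simp only [mem_insert_iff, mem_singleton_iff] at hβ
  have h0 : ∀ β : ℝ, IsSolutionOn β (Ω : Set BaseSpace) (fun _ => (0 : ℝ)) :=
    fun β => isSolutionOn_const 0
  rcases hβ with rfl | rfl | rfl | rfl
  · have h1 : zeroField Ω 0 0 0 0 0 0 0 1 (fun _ => 0) ∈ maxInvarianceAlgebra 0 Ω :=
      isLieSymmetry_zeroField ho 0 0 0 0 0 0 0 1 (h0 0)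
    have h2 : genField Ω 0 0 0 0 0 (fun _ => 0) ∈ genAlgebra 0 Ω :=
      (mem_genAlgebra ho).2 ⟨0, 0, 0, 0, _, h0 0, rfl⟩
    rw [he, zeroField_eq] at h1
    have h3 := (Submodule.add_mem_iff_right _ h2).1 h1
    exact one_ne_zero (coeffs_eq_zero_of_mem_genAlgebra_zero hΩ.isConnected h3).2.2.2
  · have h1 : twoField Ω 0 0 0 0 1 (fun _ => 0) ∈ maxInvarianceAlgebra 2 Ω :=
      isLieSymmetry_twoField ho 0 0 0 0 1 (h0 2)
    have h2 : genField Ω 2 0 0 0 0 (fun _ => 0) ∈ genAlgebra 2 Ω :=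
      (mem_genAlgebra ho).2 ⟨0, 0, 0, 0, _, h0 2, rfl⟩
    rw [he, twoField_eq] at h1
    have h3 := (Submodule.add_mem_iff_right _ h2).1 h1
    exact one_ne_zero (smul_K2_mem_genAlgebra hΩ.isConnected h3)
  · have hx : ∀ p ∈ Ω, p.2.1 ≠ 0 := fun p hp h => by
      obtain ⟨n, hn⟩ := hΩ.regular p hp h
      have : (3 : ℕ) = 2 * n := by exact_mod_cast hn
      omega
    have h1 : extraThree Ω ∈ maxInvarianceAlgebra 3 Ω := isLieSymmetry_extraThree ho hx
    rw [he, mem_genAlgebra ho] at h1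
    obtain ⟨c₁, c₂, c₃, c₄, f, -, hf⟩ := h1
    have h2 := fun p hp => (eqOn_of_affineField_eq hf (p := p) hp).1
    exact one_ne_zero (quadratic_coeffs ho hn (φ := fun p => p.1) (e := (1, 0, 0))
      (a := -c₁) (b := -((2 - 3) * c₄)) (c := 1) (by fun_prop) (by simp)
      (fun p hp => by linear_combination h2 p hp)).2.2
  · have h1 : extraFive Ω ∈ maxInvarianceAlgebra 5 Ω := isLieSymmetry_extraFive ho
    rw [he, mem_genAlgebra ho] at h1
    obtain ⟨c₁, c₂, c₃, c₄, f, -, hf⟩ := h1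
    have h2 : ∀ p ∈ (Ω : Set BaseSpace), p.2.2 = c₁ + (2 - 5) * c₄ * p.1 :=
      fun p hp => (eqOn_of_affineField_eq hf (p := p) hp).1
    obtain ⟨p, hp⟩ := hn
    have h3 := dd_of_eqOn ho h2 (0, 0, 1) p hp
    simp (disch := fun_prop) [dd_add, dd_const_mul] at h3

/-! ### The kernel algebra -/

/-- The general element of the kernel algebra. -/
noncomputable def kernelField (Ω : Set BaseSpace) (c₁ c₂ c₃ c₄ c₅ c₆ : ℝ) :
    TotalSpace → TotalSpace :=
  affineField Ω (fun _ => c₁) (fun _ => 0) (fun _ => c₂) (fun _ => c₃)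
    (fun p => c₄ * (p.1 * p.2.1 - p.2.2) + c₅ * p.2.1 + c₆)

lemma mem_kernelSpan {Ω : Set BaseSpace} {V : TotalSpace → TotalSpace} :
    V ∈ kernelSpan Ω ↔ ∃ c₁ c₂ c₃ c₄ c₅ c₆, V = kernelField Ω c₁ c₂ c₃ c₄ c₅ c₆ := by
  have he : ∀ c₁ c₂ c₃ c₄ c₅ c₆ : ℝ, kernelField Ω c₁ c₂ c₃ c₄ c₅ c₆ = c₁ • Pt Ω + (c₂ • Py Ω
      + (c₃ • fieldI Ω + (c₄ • fieldZ Ω (fun p => p.1 * p.2.1 - p.2.2)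
      + (c₅ • fieldZ Ω (fun p => p.2.1) + c₆ • fieldZ Ω (fun _ => 1))))) := by
    intro c₁ c₂ c₃ c₄ c₅ c₆
    funext z
    by_cases hz : z ∈ cyl Ω
    · simp only [kernelField, affineField, Pt, Py, fieldI, fieldZ, field, Pi.add_apply,
        Pi.smul_apply, indicator_of_mem hz]
      ext <;> simp
      ring
    · simp [kernelField, affineField, Pt, Py, fieldI, fieldZ, field, indicator_of_notMem hz]
  simp only [kernelSpan, Submodule.mem_span_insert, Submodule.mem_span_singleton, he]
  constructor
  · rintro ⟨c₁, _, ⟨c₂, _, ⟨c₃, _, ⟨c₄, _, ⟨c₅, _, ⟨c₆, rfl⟩, rfl⟩, rfl⟩, rfl⟩, rfl⟩, rfl⟩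
    exact ⟨c₁, c₂, c₃, c₄, c₅, c₆, rfl⟩
  · rintro ⟨c₁, c₂, c₃, c₄, c₅, c₆, rfl⟩
    exact ⟨c₁, _, ⟨c₂, _, ⟨c₃, _, ⟨c₄, _, ⟨c₅, _, ⟨c₆, rfl⟩, rfl⟩, rfl⟩, rfl⟩, rfl⟩, rfl⟩

lemma isLieClosed_kernelSpan {Ω : Set BaseSpace} (ho : IsOpen Ω) :
    IsLieClosed (kernelSpan Ω) := by
  intro V hV W hW
  obtain ⟨c₁, c₂, c₃, c₄, c₅, c₆, rfl⟩ := mem_kernelSpan.1 hV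
  obtain ⟨d₁, d₂, d₃, d₄, d₅, d₆, rfl⟩ := mem_kernelSpan.1 hW
  rw [mem_kernelSpan]
  refine ⟨0, 0, 0, d₃ * c₄ - c₃ * d₄, c₁ * d₄ - d₁ * c₄ + d₃ * c₅ - c₃ * d₅,
    d₂ * c₄ - c₂ * d₄ + d₃ * c₆ - c₃ * d₆, ?_⟩
  unfold kernelField
  rw [lieBracket_affineField ho
    ⟨by fun_prop, by fun_prop, by fun_prop, by fun_prop, by fun_prop⟩
    ⟨by fun_prop, by fun_prop, by fun_prop, by fun_prop, by fun_prop⟩]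
  refine affineField_congr ?_ ?_ ?_ ?_ ?_
  all_goals
    intro p _
    simp (disch := fun_prop) only [along, dd_add, dd_sub, dd_mul, dd_const,
      dd_t, dd_x, dd_y]
    ring

/-- The solutions of `f_xx = 0`, `f_t + x f_y = 0`, i.e. the common solutions of all equations. -/
lemma exists_coeffs_of_common_solution {Ω : Set BaseSpace} (ho : IsOpen Ω) (hc : IsConnected Ω)
    {f : BaseSpace → ℝ} (hf : ContDiffOn ℝ ∞ f Ω)
    (hxx : ∀ p ∈ Ω, dd (0, 1, 0) (dd (0, 1, 0) f) p = 0)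
    (htr : ∀ p ∈ Ω, dd (1, 0, 0) f p + p.2.1 * dd (0, 0, 1) f p = 0) :
    ∃ a b c, ∀ p ∈ Ω, f p = a * (p.1 * p.2.1 - p.2.2) + b * p.2.1 + c := by
  have sx := ContDiffOn.dd hf ho (0, 1, 0)
  have sy := ContDiffOn.dd hf ho (0, 0, 1)
  have st := ContDiffOn.dd hf ho (1, 0, 0)
  have sxt := ContDiffOn.dd sx ho (1, 0, 0)
  have sxy := ContDiffOn.dd sx ho (0, 0, 1)
  have xtx := dd_dd_eq_zero ho sx hxx (1, 0, 0)
  have xyx := dd_dd_eq_zero ho sx hxx (0, 0, 1)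
  have h1 : ∀ p ∈ Ω, dd (1, 0, 0) (dd (0, 1, 0) f) p + dd (0, 0, 1) f p
      + p.2.1 * dd (0, 0, 1) (dd (0, 1, 0) f) p = 0 := fun p hp => by
    have e1 := ContDiffOn.differentiableAt' sy ho hp
    have e2 := ContDiffOn.differentiableAt' st ho hp
    have := dd_eq_zero_of_eqOn ho htr (0, 1, 0) hp
    simp (disch := fun_prop) only [dd_add, dd_mul, dd_x] at this
    rw [dd_comm ho hf (0, 1, 0) (1, 0, 0) hp, dd_comm ho hf (0, 1, 0) (0, 0, 1) hp] at this
    linear_combination this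
  have hxy : ∀ p ∈ Ω, dd (0, 0, 1) (dd (0, 1, 0) f) p = 0 := fun p hp => by
    have e1 := ContDiffOn.differentiableAt' sy ho hp
    have e2 := ContDiffOn.differentiableAt' sxt ho hp
    have e3 := ContDiffOn.differentiableAt' sxy ho hp
    have := dd_eq_zero_of_eqOn ho h1 (0, 1, 0) hp
    simp (disch := fun_prop) only [dd_add, dd_mul, dd_x, xtx p hp, xyx p hp] at this
    rw [dd_comm ho hf (0, 1, 0) (0, 0, 1) hp] at this
    linear_combination this / 2
  have hy : ∀ p ∈ Ω, dd (0, 0, 1) f p = - dd (1, 0, 0) (dd (0, 1, 0) f) p := fun p hp => by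
    linear_combination h1 p hp - p.2.1 * hxy p hp
  have ht : ∀ p ∈ Ω, dd (1, 0, 0) f p = p.2.1 * dd (1, 0, 0) (dd (0, 1, 0) f) p :=
    fun p hp => by linear_combination htr p hp - p.2.1 * hy p hp
  have xty := dd_dd_eq_zero ho sx hxy (1, 0, 0)
  have xtt : ∀ p ∈ Ω, dd (1, 0, 0) (dd (1, 0, 0) (dd (0, 1, 0) f)) p = 0 := fun p hp => by
    have a := dd_of_eqOn ho hy (1, 0, 0) p hp
    have b := dd_of_eqOn ho ht (0, 0, 1) p hp
    rw [dd_mul _ (by fun_prop) (ContDiffOn.differentiableAt' sxt ho hp), dd_x, xty p hp,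
      dd_comm ho hf _ _ hp] at b
    rw [dd_neg] at a
    linear_combination a - b
  obtain ⟨a, ha⟩ := exists_const_of_partials_eq_zero ho hc sxt xtt xtx xty
  obtain ⟨b, hb⟩ := exists_eq_add_const ho hc sx (fun q => a * q.1) (by fun_prop)
    (fun p hp => by simp (disch := fun_prop) [dd_const_mul, ha p hp])
    (fun p hp => by simp (disch := fun_prop) [dd_const_mul, hxx p hp])
    (fun p hp => by simp (disch := fun_prop) [dd_const_mul, hxy p hp])
  obtain ⟨c, hc⟩ := exists_eq_add_const ho hc hf
    (fun q => a * (q.1 * q.2.1 - q.2.2) + b * q.2.1) (by fun_prop)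
    (fun p hp => by
      simp (disch := fun_prop) [dd_const_mul, dd_add, dd_sub, dd_mul, ht p hp, ha p hp]; ring)
    (fun p hp => by
      simp (disch := fun_prop) [dd_const_mul, dd_add, dd_sub, dd_mul, hb p hp])
    (fun p hp => by
      simp (disch := fun_prop) [dd_const_mul, dd_add, dd_sub, dd_mul, hy p hp, ha p hp])
  exact ⟨a, b, c, hc⟩

lemma isSolutionOn_common (β : ℝ) (Ω : Set BaseSpace) (a b c : ℝ) :
    IsSolutionOn β Ω (fun p => a * (p.1 * p.2.1 - p.2.2) + b * p.2.1 + c) := by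
  refine ⟨by fun_prop, fun p _ => ?_⟩
  have h1 : dd (0, 1, 0) (fun p : BaseSpace => a * (p.1 * p.2.1 - p.2.2) + b * p.2.1 + c)
      = fun p => a * p.1 + b := by
    funext p
    simp (disch := fun_prop) only [dd_const_mul, dd_add, dd_sub, dd_mul, dd_const, dd_t, dd_x,
      dd_y]
    ring
  unfold SatisfiesAt
  simp (disch := fun_prop) only [dT_eq_dd, dX_eq_dd, dY_eq_dd, h1, dd_const_mul, dd_add, dd_sub,
    dd_mul, dd_const, dd_t, dd_x, dd_y]
  ring

lemma iInf_maxInvarianceAlgebra {Ω : TopologicalSpace.Opens BaseSpace}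
    (hΩ : IsConnected (Ω : Set BaseSpace)) :
    (⨅ β : ℝ, maxInvarianceAlgebra β Ω) = kernelSpan Ω := by
  have ho := Ω.isOpen
  refine le_antisymm (fun V hV => ?_) (le_iInf fun β V hV => ?_)
  · rw [Submodule.mem_iInf] at hV
    -- Two generic values of the parameter suffice.
    have h1 := hV 1
    have h4 := hV 4
    rw [maxInvarianceAlgebra_eq_of_generic (by norm_num) hΩ, mem_genAlgebra ho] at h1 h4
    obtain ⟨c₁, c₂, c₃, c₄, f, hf, rfl⟩ := h1
    obtain ⟨d₁, d₂, d₃, d₄, g, hg, he⟩ := h4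
    have hE := fun p hp => eqOn_of_affineField_eq he (p := p) hp
    have hfg : EqOn f g Ω := fun p hp => (hE p hp).2.2.2.2
    obtain ⟨-, hτ, -⟩ := quadratic_coeffs ho hΩ.nonempty (φ := fun p => p.1) (e := (1, 0, 0))
      (a := c₁ - d₁) (b := (2 - 1) * c₄ - (2 - 4) * d₄) (c := 0) (by fun_prop) (by simp)
      (fun p hp => by linear_combination (hE p hp).1)
    obtain ⟨-, hξ, -⟩ := quadratic_coeffs ho hΩ.nonempty (φ := fun p => p.2.1) (e := (0, 1, 0))
      (a := 0) (b := c₄ - d₄) (c := 0) (by fun_prop) (by simp)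
      (fun p hp => by linear_combination (hE p hp).2.1)
    have hc4 : c₄ = 0 := by linarith
    subst hc4
    have e1 : ∀ p ∈ (Ω : Set BaseSpace), dd (1, 0, 0) f p + p.2.1 * dd (0, 0, 1) f p
        = |p.2.1| * dd (0, 1, 0) (dd (0, 1, 0) f) p := fun p hp => by
      have := hf.eq p hp
      unfold SatisfiesAt at this
      rwa [Real.rpow_one] at this
    have e4 : ∀ p ∈ (Ω : Set BaseSpace), dd (1, 0, 0) f p + p.2.1 * dd (0, 0, 1) f p
        = |p.2.1| ^ (4 : ℝ) * dd (0, 1, 0) (dd (0, 1, 0) f) p :=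
      fun p hp => (hg.congr ho hfg).eq p hp
    have hxx : ∀ p ∈ (Ω : Set BaseSpace), dd (0, 1, 0) (dd (0, 1, 0) f) p = 0 := by
      refine eq_zero_of_eq_zero_off ho (F := {0, 1, -1}) (by simp)
        (ContDiffOn.dd (ContDiffOn.dd hf.smooth ho _) ho _).continuousOn fun p hp hx => ?_
      simp only [mem_insert_iff, mem_singleton_iff, not_or] at hx
      have h : (|p.2.1| ^ (4 : ℝ) - |p.2.1|) * dd (0, 1, 0) (dd (0, 1, 0) f) p = 0 := by
        linear_combination e1 p hp - e4 p hp
      refine (mul_eq_zero.1 h).resolve_left fun h0 => ?_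
      have hpos := abs_pos.2 hx.1
      have h4 : |p.2.1| ^ (4 : ℝ) = |p.2.1| ^ 4 := by exact_mod_cast Real.rpow_natCast |p.2.1| 4
      rw [h4] at h0
      have h5 : |p.2.1| * (|p.2.1| ^ 2 + |p.2.1| + 1) * (|p.2.1| - 1) = 0 := by
        linear_combination h0
      have h6 : |p.2.1| = 1 := sub_eq_zero.1 ((mul_eq_zero.1 h5).resolve_left (by positivity))
      rcases eq_or_eq_neg_of_abs_eq h6 with h | h
      exacts [hx.2.1 h, hx.2.2 h]
    obtain ⟨a, b, c, habc⟩ := exists_coeffs_of_common_solution ho hΩ hf.smooth hxx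
      (fun p hp => by rw [e1 p hp, hxx p hp, mul_zero])
    exact mem_kernelSpan.2 ⟨c₁, c₂, c₃, a, b, c, affineField_congr (fun p _ => by simp)
      (fun p _ => by simp) (fun p _ => by simp) (fun p _ => rfl) habc⟩
  · obtain ⟨c₁, c₂, c₃, a, b, c, rfl⟩ := mem_kernelSpan.1 hV
    refine genAlgebra_le Ω ((mem_genAlgebra ho).2 ⟨c₁, c₂, c₃, 0, _,
      isSolutionOn_common β Ω a b c, affineField_congr (fun p _ => by simp)
      (fun p _ => by simp) (fun p _ => by simp) (fun p _ => rfl) (fun p _ => rfl)⟩)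

/-! ### The global equivalence of `β` and `5 - β` -/

lemma isOpen_regularRegion : IsOpen regularRegion :=
  isOpen_ne.preimage (by fun_prop)

lemma satisfiesAt_congr_nhds {β : ℝ} {v w : BaseSpace → ℝ} {p : BaseSpace} (h : v =ᶠ[𝓝 p] w) :
    SatisfiesAt β v p ↔ SatisfiesAt β w p := by
  obtain ⟨N, hN, hNo, hp⟩ := eventually_nhds_iff.1 h
  exact satisfiesAt_congr hNo hN hp

lemma globallyEquivalent_refl (β : ℝ) : GloballyEquivalent β β := by
  refine ⟨OpenPartialHomeomorph.ofSet regularRegion isOpen_regularRegion, Equiv.refl ℝ,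
    ⟨⟨((0, 1, 0), 0), by simp [regularRegion]⟩, by simp, by simp, contDiffOn_id, contDiffOn_id,
      contDiff_id, contDiff_id, fun β v v' p p' _ _ _ h he => ?_⟩, rfl, rfl, rfl⟩
  simp only [OpenPartialHomeomorph.ofSet_apply, id_eq, Prod.mk.injEq, Equiv.refl_apply] at h he ⊢
  obtain ⟨rfl, -⟩ := h
  exact satisfiesAt_congr_nhds he

/-- The point transformation `(t, x, y, u) ↦ (σ y, 1 / x, σ t, u / x)`, where `σ` is the sign
of `x`. -/
noncomputable def reflection (z : TotalSpace) : TotalSpace :=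
  ((z.1.2.1 / |z.1.2.1| * z.1.2.2, z.1.2.1⁻¹, z.1.2.1 / |z.1.2.1| * z.1.1), z.2 / z.1.2.1)

lemma reflection_mem {z : TotalSpace} (hz : z ∈ regularRegion) : reflection z ∈ regularRegion :=
  inv_ne_zero hz

lemma reflection_reflection {z : TotalSpace} (hz : z ∈ regularRegion) :
    reflection (reflection z) = z := by
  have hx : z.1.2.1 ≠ 0 := hz
  have ha : |z.1.2.1| ≠ 0 := (abs_pos.2 hx).ne'
  ext
  · simp only [reflection, abs_inv]
    field_simp
  · simp [reflection]
  · simp only [reflection, abs_inv]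
    field_simp
  · simp only [reflection]
    field_simp

lemma contDiffOn_reflection : ContDiffOn ℝ ∞ reflection regularRegion := by
  intro z hz
  have hx : z.1.2.1 ≠ 0 := hz
  refine ContDiffAt.contDiffWithinAt ?_
  have h0 : ContDiffAt ℝ ∞ (fun z : TotalSpace => z.1.2.1) z := by fun_prop
  have h1 : ContDiffAt ℝ ∞ (fun z : TotalSpace => |z.1.2.1|) z :=
    ContDiffAt.comp (g := fun s : ℝ => |s|) (f := fun z : TotalSpace => z.1.2.1) z
      (contDiffAt_abs hx) h0
  have h2 := h0.div h1 (abs_pos.2 hx).ne'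
  exact ((h2.mul (by fun_prop)).prodMk ((h0.inv hx).prodMk (h2.mul (by fun_prop)))).prodMk
    (contDiffAt_snd.div h0 hx)

/-- `reflection` as a transformation of the region `x ≠ 0`. -/
noncomputable def reflectionHomeomorph : OpenPartialHomeomorph TotalSpace TotalSpace where
  toFun := reflection
  invFun := reflection
  source := regularRegion
  target := regularRegion
  map_source' _ := reflection_mem
  map_target' _ := reflection_mem
  left_inv' _ := reflection_reflection
  right_inv' _ := reflection_reflection
  open_source := isOpen_regularRegion
  open_target := isOpen_regularRegion
  continuousOn_toFun := contDiffOn_reflection.continuousOn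
  continuousOn_invFun := contDiffOn_reflection.continuousOn

/-- If `v(t, x, y) = x w(σ y, 1 / x, σ t)` with `σ = ± 1` the sign of `x`, then `v` satisfies the
equation with parameter `β` if and only if `w` satisfies the one with parameter `5 - β`. -/
lemma satisfiesAt_reflection {β σ : ℝ} {v w : BaseSpace → ℝ} {p : BaseSpace} (hx : p.2.1 ≠ 0)
    (hσ : p.2.1 = σ * |p.2.1|) (hσ2 : σ ^ 2 = 1)
    (hw : ContDiffAt ℝ ∞ w (σ * p.2.2, p.2.1⁻¹, σ * p.1))
    (h : ∀ᶠ q in 𝓝 p, v q = q.2.1 * w (σ * q.2.2, q.2.1⁻¹, σ * q.1)) :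
    SatisfiesAt β v p ↔ SatisfiesAt (5 - β) w (σ * p.2.2, p.2.1⁻¹, σ * p.1) := by
  let A : BaseSpace → BaseSpace := fun q => (σ * q.2.2, q.2.1⁻¹, σ * q.1)
  have hA : ∀ q : BaseSpace, q.2.1 ≠ 0 → ∃ A' : BaseSpace →L[ℝ] BaseSpace, HasFDerivAt A A' q ∧
      ∀ e, A' e = (σ * e.2.2, -(q.2.1 ^ 2)⁻¹ * e.2.1, σ * e.1) := by
    intro q hq
    have ht : HasFDerivAt (fun q : BaseSpace => q.1) (ContinuousLinearMap.fst ℝ ℝ (ℝ × ℝ)) q :=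
      hasFDerivAt_fst
    have hx : HasFDerivAt (fun q : BaseSpace => q.2.1)
      ((ContinuousLinearMap.fst ℝ ℝ ℝ).comp (ContinuousLinearMap.snd ℝ ℝ (ℝ × ℝ))) q :=
      ((ContinuousLinearMap.fst ℝ ℝ ℝ).comp (ContinuousLinearMap.snd ℝ ℝ (ℝ × ℝ))).hasFDerivAt
    have hy : HasFDerivAt (fun q : BaseSpace => q.2.2)
      ((ContinuousLinearMap.snd ℝ ℝ ℝ).comp (ContinuousLinearMap.snd ℝ ℝ (ℝ × ℝ))) q :=
      ((ContinuousLinearMap.snd ℝ ℝ ℝ).comp (ContinuousLinearMap.snd ℝ ℝ (ℝ × ℝ))).hasFDerivAt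
    have hx' := (hasDerivAt_inv hq).comp_hasFDerivAt q hx
    refine ⟨_, (hy.const_mul σ).prodMk (hx'.prodMk (ht.const_mul σ)), fun e => ?_⟩
    simp
  have hAc : ContinuousAt A p := (hA p hx).choose_spec.1.continuousAt
  -- `w` is twice differentiable near the image point.
  have hw2 : ∀ᶠ q in 𝓝 p, ContDiffAt ℝ 2 w (A q) :=
    hAc.eventually ((hw.of_le (WithTop.coe_le_coe.2 le_top)).eventually (by simp))
  have chain : ∀ (g : BaseSpace → ℝ) (q e : BaseSpace), q.2.1 ≠ 0 → DifferentiableAt ℝ g (A q) →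
      DifferentiableAt ℝ (fun q => g (A q)) q ∧
      dd e (fun q => g (A q)) q = σ * e.2.2 * dT g (A q)
        - (q.2.1 ^ 2)⁻¹ * e.2.1 * dX g (A q) + σ * e.1 * dY g (A q) := by
    intro g q e hq hg
    obtain ⟨A', hA', hA'e⟩ := hA q hq
    have h1 : HasFDerivAt (fun q => g (A q)) _ q := hg.hasFDerivAt.comp q hA'
    refine ⟨h1.differentiableAt, ?_⟩
    simp only [dd, h1.fderiv, ContinuousLinearMap.comp_apply, hA'e, fderiv_apply_eq]
    ring
  obtain ⟨N, hN, hNo, hp⟩ := eventually_nhds_iff.1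
    (h.and (hw2.and
      (ContinuousAt.eventually_ne (g := fun q : BaseSpace => q.2.1) (by fun_prop) hx)))
  have hv : ∀ q ∈ N, v q = q.2.1 * w (A q) := fun q hq => (hN q hq).1
  have dw : ∀ q ∈ N, DifferentiableAt ℝ w (A q) := fun q hq =>
    (hN q hq).2.1.differentiableAt (by simp)
  have dwx : ∀ q ∈ N, DifferentiableAt ℝ (dX w) (A q) := fun q hq => by
    have := ((hN q hq).2.1.fderiv_right (m := 1) (by norm_num)).differentiableAt (by simp)
    exact this.clm_apply (by fun_prop)
  have d1 : ∀ e, ∀ q ∈ N, dd e v q = e.2.1 * w (A q) + q.2.1 * (σ * e.2.2 * dT w (A q)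
      - (q.2.1 ^ 2)⁻¹ * e.2.1 * dX w (A q) + σ * e.1 * dY w (A q)) := by
    intro e q hq
    obtain ⟨c1, c2⟩ := chain w q e (hN q hq).2.2 (dw q hq)
    rw [dd_of_eqOn hNo hv e q hq, dd_mul _ (by fun_prop) c1, c2, dd_x]
  have d2 : dd (0, 1, 0) (dd (0, 1, 0) v) p = (p.2.1 ^ 3)⁻¹ * dX (dX w) (A p) := by
    have e1 : ∀ q ∈ N, dd (0, 1, 0) v q = w (A q) - q.2.1⁻¹ * dX w (A q) := fun q hq => by
      have := (hN q hq).2.2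
      rw [d1 _ q hq]
      field_simp
      ring
    obtain ⟨c1, c2⟩ := chain w p (0, 1, 0) hx (dw p hp)
    obtain ⟨c3, c4⟩ := chain (dX w) p (0, 1, 0) hx (dwx p hp)
    have c5 : DifferentiableAt ℝ (fun q : BaseSpace => q.2.1⁻¹) p :=
      DifferentiableAt.inv (h := fun q : BaseSpace => q.2.1) (by fun_prop) hx
    have c6 : dd (0, 1, 0) (fun q : BaseSpace => q.2.1⁻¹) p = -(p.2.1 ^ 2)⁻¹ := by
      obtain ⟨A', hA', hA'e⟩ := hA p hx
      have := hA'.snd.fst.fderiv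
      simp only [A] at this
      simp [dd, this, hA'e]
    rw [dd_of_eqOn hNo e1 _ p hp, dd_sub _ c1 (c5.fun_mul c3), dd_mul _ c5 c3, c2, c4, c6]
    field_simp
    ring
  have hpow : |p.2.1⁻¹| ^ (5 - β) * |p.2.1| ^ 5 = |p.2.1| ^ β := by
    have h5 : |p.2.1| ^ 5 = |p.2.1| ^ (5 : ℝ) := by exact_mod_cast (Real.rpow_natCast _ 5).symm
    rw [abs_inv, Real.inv_rpow (abs_nonneg _), ← Real.rpow_neg (abs_nonneg _), h5,
      ← Real.rpow_add (abs_pos.2 hx)]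
    congr 1; ring
  change _ ↔ SatisfiesAt (5 - β) w (A p)
  unfold SatisfiesAt
  rw [dX_eq_dd, d2, dT_eq_dd, dY_eq_dd, d1 _ p hp, d1 _ p hp, ← hpow]
  have hσ0 : σ ≠ 0 := fun h => by simp [h] at hσ2
  have hx5 : |p.2.1| ^ 5 = σ * p.2.1 ^ 5 := by
    have : p.2.1 ^ 5 = σ ^ 5 * |p.2.1| ^ 5 := by rw [← mul_pow, ← hσ]
    rw [this]
    linear_combination -(σ ^ 4 + σ ^ 2 + 1) * |p.2.1| ^ 5 * hσ2
  rw [hx5, dT_eq_dd, dY_eq_dd, dX_eq_dd]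
  have hfac : ∀ T X Y r : ℝ, p.2.1 * (σ * Y) + p.2.1 * (p.2.1 * (σ * T))
      - r * (σ * p.2.1 ^ 5) * ((p.2.1 ^ 3)⁻¹ * X)
      = σ * p.2.1 ^ 2 * (T + p.2.1⁻¹ * Y - r * X) := by
    intro T X Y r
    field_simp
    ring
  have h3 : σ * p.2.1 ^ 2 ≠ 0 := mul_ne_zero hσ0 (pow_ne_zero 2 hx)
  have hiff : ∀ a b : ℝ, a = σ * p.2.1 ^ 2 * b → (a = 0 ↔ b = 0) := fun a b hab => by
    rw [hab, mul_eq_zero, or_iff_right h3]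
  rw [← sub_eq_zero, ← sub_eq_zero (a := _ + _ * dd (0, 0, 1) w (A p))]
  refine hiff _ _ ?_
  rw [show (A p).2.1 = p.2.1⁻¹ from rfl, ← hfac]
  simp

lemma globallyEquivalent_five_sub (β : ℝ) : GloballyEquivalent β (5 - β) := by
  refine ⟨reflectionHomeomorph, Equiv.subLeft 5,
    ⟨⟨((0, 1, 0), 0), by simp [reflectionHomeomorph, regularRegion]⟩, subset_rfl, subset_rfl,
      contDiffOn_reflection, contDiffOn_reflection, ?_, ?_,
      fun β v v' p p' _ hv' hs h he => ?_⟩, rfl, rfl, rfl⟩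
  · exact contDiff_const.sub contDiff_id
  · have : ⇑(Equiv.subLeft (5 : ℝ)).symm = fun x => -x + 5 := by
      funext x; simp [Equiv.subLeft]
    rw [this]
    fun_prop
  · have hx : p.2.1 ≠ 0 := hs
    have ha : |p.2.1| ≠ 0 := (abs_pos.2 hx).ne'
    have h' : reflection (p, v p) = (p', v' p') := h
    have he' : ∀ᶠ q in 𝓝 p, (reflection (q, v q)).2 = v' (reflection (q, v q)).1 := he
    set σ : ℝ := p.2.1 / |p.2.1| with hσ
    have hp' : p' = (σ * p.2.2, p.2.1⁻¹, σ * p.1) := (congrArg Prod.fst h').symm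
    have hσ2 : σ ^ 2 = 1 := by rw [hσ, div_pow, sq_abs, div_self (pow_ne_zero 2 hx)]
    have hsign : ∀ᶠ q : BaseSpace in 𝓝 p, q.2.1 / |q.2.1| = σ := by
      have hc : ContinuousAt (fun q : BaseSpace => q.2.1) p := by fun_prop
      rcases lt_or_gt_of_ne hx with hlt | hgt
      · filter_upwards [hc.eventually_lt continuousAt_const hlt] with q hq
        rw [hσ, abs_of_neg hq, abs_of_neg hlt, div_neg, div_neg, div_self hq.ne, div_self hx]
      · filter_upwards [continuousAt_const.eventually_lt hc hgt] with q hq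
        rw [hσ, abs_of_pos hq, abs_of_pos hgt, div_self hq.ne', div_self hx]
    rw [hp'] at hv' ⊢
    refine satisfiesAt_reflection hx (by rw [hσ]; field_simp) hσ2 hv' ?_
    have hne : ∀ᶠ q : BaseSpace in 𝓝 p, q.2.1 ≠ 0 :=
      ContinuousAt.eventually_ne (g := fun q : BaseSpace => q.2.1) (by fun_prop) hx
    filter_upwards [he', hsign, hne] with q h1 h2 h3
    simp only [reflection, h2] at h1
    rw [← h1]
    field_simp

/-! ### Second-order jets of curves -/

section TwoJet

variable {E F : Type*} [NormedAddCommGroup E] [NormedSpace ℝ E] [NormedAddCommGroup F]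
  [NormedSpace ℝ F]

/-- The curve `c` is differentiable near `0` and has the velocity `a` and the acceleration `b`
at `0`. -/
def TwoJet (c : ℝ → E) (a b : E) : Prop :=
  ∃ c' : ℝ → E, (∀ᶠ s in 𝓝 0, HasDerivAt c (c' s) s) ∧ c' 0 = a ∧ HasDerivAt c' b 0

lemma TwoJet.acceleration_eq {c d : ℝ → E} {a b a' b' : E} (hc : TwoJet c a b)
    (hd : TwoJet d a' b') (h : c =ᶠ[𝓝 0] d) : b = b' := by
  obtain ⟨c', hc1, -, hc2⟩ := hc
  obtain ⟨d', hd1, -, hd2⟩ := hd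
  have he : c' =ᶠ[𝓝 0] d' := by
    filter_upwards [hc1, hd1, h.eventuallyEq_nhds] with s h1 h2 h3
    exact h1.unique (h2.congr_of_eventuallyEq h3)
  exact hc2.unique (hd2.congr_of_eventuallyEq he)

/-- The second-order chain rule along a curve. -/
lemma TwoJet.comp {c : ℝ → E} {a b : E} {z : E} (hc : TwoJet c a b) (hz : c 0 = z) {f : E → F}
    (hf : ContDiffAt ℝ ∞ f z) :
    TwoJet (fun s => f (c s)) (fderiv ℝ f z a)
      (fderiv ℝ (fderiv ℝ f) z a a + fderiv ℝ f z b) := by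
  subst hz
  obtain ⟨c', hc1, rfl, hc2⟩ := hc
  have hf2 : ContDiffAt ℝ 2 f (c 0) := hf.of_le (WithTop.coe_le_coe.2 le_top)
  have hcont : ContinuousAt c 0 := (hc1.self_of_nhds).continuousAt
  have hd : ∀ᶠ s in 𝓝 (0 : ℝ), ContDiffAt ℝ 2 f (c s) :=
    hcont.eventually (hf2.eventually (by simp))
  refine ⟨fun s => fderiv ℝ f (c s) (c' s), ?_, rfl, ?_⟩
  · filter_upwards [hc1, hd] with s h1 h2
    exact (h2.differentiableAt (by simp)).hasFDerivAt.comp_hasDerivAt s h1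
  · have h1 : DifferentiableAt ℝ (fderiv ℝ f) (c 0) :=
      (hf2.fderiv_right (m := 1) (by norm_num)).differentiableAt (by simp)
    exact (h1.hasFDerivAt.comp_hasDerivAt (0 : ℝ) hc1.self_of_nhds).clm_apply hc2

lemma TwoJet.fst {c : ℝ → E × F} {a b : E × F} (hc : TwoJet c a b) :
    TwoJet (fun s => (c s).1) a.1 b.1 := by
  obtain ⟨c', hc1, rfl, hc2⟩ := hc
  exact ⟨fun s => (c' s).1, hc1.mono fun s h => h.fst, rfl, hc2.fst⟩

lemma TwoJet.snd {c : ℝ → E × F} {a b : E × F} (hc : TwoJet c a b) :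
    TwoJet (fun s => (c s).2) a.2 b.2 := by
  obtain ⟨c', hc1, rfl, hc2⟩ := hc
  exact ⟨fun s => (c' s).2, hc1.mono fun s h => h.snd, rfl, hc2.snd⟩

end TwoJet

/-- The second derivative of the quadratic form `(s x² + c t² + d y²) / 2` along `w`. -/
def diagForm (s c d : ℝ) (w : BaseSpace) : ℝ := s * w.2.1 ^ 2 + c * w.1 ^ 2 + d * w.2.2 ^ 2

/-- The quadratic polynomial with the value `z.2` and the differential `ℓ` at `z.1`. -/
noncomputable def quadJet (z : TotalSpace) (ℓ : BaseSpace →L[ℝ] ℝ) (s c d : ℝ)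
    (q : BaseSpace) : ℝ :=
  z.2 + ℓ (q - z.1) + diagForm s c d (q - z.1) / 2

lemma quadJet_self (z : TotalSpace) (ℓ : BaseSpace →L[ℝ] ℝ) (s c d : ℝ) :
    quadJet z ℓ s c d z.1 = z.2 := by simp [quadJet, diagForm]

lemma contDiff_quadJet (z : TotalSpace) (ℓ : BaseSpace →L[ℝ] ℝ) (s c d : ℝ) :
    ContDiff ℝ ∞ (quadJet z ℓ s c d) := by
  unfold quadJet diagForm
  fun_prop

lemma dd_quadJet (z : TotalSpace) (ℓ : BaseSpace →L[ℝ] ℝ) (s c d : ℝ) (e q : BaseSpace) :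
    dd e (quadJet z ℓ s c d) q = ℓ e + (s * (q.2.1 - z.1.2.1) * e.2.1
      + c * (q.1 - z.1.1) * e.1 + d * (q.2.2 - z.1.2.2) * e.2.2) := by
  have hq : Differentiable ℝ (fun q : BaseSpace => diagForm s c d (q - z.1) / 2) := by
    unfold diagForm; fun_prop
  have hl : ∀ q, HasFDerivAt (fun q : BaseSpace => z.2 + ℓ (q - z.1)) ℓ q := fun q =>
    (ℓ.hasFDerivAt.comp q ((hasFDerivAt_id q).sub_const z.1)).const_add _
  have h1 : quadJet z ℓ s c d = fun q => (z.2 + ℓ (q - z.1)) + diagForm s c d (q - z.1) / 2 := rfl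
  rw [h1, dd_add e (hl q).differentiableAt (hq q)]
  congr 1
  · rw [dd, (hl q).fderiv]
  · have h2 : (fun q : BaseSpace => diagForm s c d (q - z.1) / 2) = fun q =>
        (s / 2) * (q.2.1 - z.1.2.1) ^ 2 + ((c / 2) * (q.1 - z.1.1) ^ 2
          + (d / 2) * (q.2.2 - z.1.2.2) ^ 2) := by
      funext q; simp [diagForm]; ring
    have hx : dd e (fun q : BaseSpace => q.2.1 - z.1.2.1) q = e.2.1 := by
      rw [dd_sub e (by fun_prop) (by fun_prop)]; simp
    have ht : dd e (fun q : BaseSpace => q.1 - z.1.1) q = e.1 := by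
      rw [dd_sub e (by fun_prop) (by fun_prop)]; simp
    have hy : dd e (fun q : BaseSpace => q.2.2 - z.1.2.2) q = e.2.2 := by
      rw [dd_sub e (by fun_prop) (by fun_prop)]; simp
    rw [h2, dd_add e (by fun_prop) (by fun_prop), dd_add e (by fun_prop) (by fun_prop),
      dd_const_mul e _ (by fun_prop), dd_const_mul e _ (by fun_prop),
      dd_const_mul e _ (by fun_prop), dd_pow e 2 (by fun_prop), dd_pow e 2 (by fun_prop),
      dd_pow e 2 (by fun_prop), hx, ht, hy]
    push_cast
    ring

lemma satisfiesAt_quadJet {β : ℝ} {z : TotalSpace} {ℓ : BaseSpace →L[ℝ] ℝ} {s c d : ℝ} :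
    SatisfiesAt β (quadJet z ℓ s c d) z.1 ↔ ℓ (1, 0, z.1.2.1) = |z.1.2.1| ^ β * s := by
  have h1 : ∀ e, dd e (quadJet z ℓ s c d) z.1 = ℓ e := fun e => by simp [dd_quadJet]
  have h2 : dd (0, 1, 0) (dd (0, 1, 0) (quadJet z ℓ s c d)) z.1 = s := by
    have : dd (0, 1, 0) (quadJet z ℓ s c d)
        = fun q => ℓ (0, 1, 0) + s * (q.2.1 - z.1.2.1) := by
      funext q; simp [dd_quadJet]
    rw [this, dd_add _ (by fun_prop) (by fun_prop), dd_const_mul _ _ (by fun_prop),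
      dd_sub _ (by fun_prop) (by fun_prop)]
    simp
  have h3 : ((1, 0, z.1.2.1) : BaseSpace) = (1, 0, 0) + z.1.2.1 • (0, 0, 1) := by simp
  rw [SatisfiesAt, dX_eq_dd, dT_eq_dd, dY_eq_dd, h2, h1, h1, h3, map_add, map_smul, smul_eq_mul]

/-- The lift of the straight line in the direction `w` to the graph of the quadratic polynomial. -/
lemma twoJet_quadJet (z : TotalSpace) (ℓ : BaseSpace →L[ℝ] ℝ) (s c d : ℝ) (w : BaseSpace) :
    TwoJet (fun r : ℝ => ((z.1 + r • w, quadJet z ℓ s c d (z.1 + r • w)) : TotalSpace))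
      (w, ℓ w) (0, diagForm s c d w) := by
  have h1 : ∀ r : ℝ, HasDerivAt (fun r : ℝ => z.1 + r • w) w r := fun r => by
    simpa using ((hasDerivAt_id r).smul_const w).const_add z.1
  have h2 : (fun r : ℝ => quadJet z ℓ s c d (z.1 + r • w))
      = fun r => z.2 + (r * ℓ w + r ^ 2 * (diagForm s c d w / 2)) := by
    funext r; simp [quadJet, diagForm]; ring
  have h3 : ∀ r : ℝ, HasDerivAt (fun r : ℝ => quadJet z ℓ s c d (z.1 + r • w))
      (ℓ w + r * diagForm s c d w) r := fun r => by
    rw [h2]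
    have := (((hasDerivAt_id' r).mul_const (ℓ w)).fun_add
      ((hasDerivAt_pow 2 r).mul_const (diagForm s c d w / 2))).const_add z.2
    exact this.congr_deriv (by simp; ring)
  refine ⟨fun r => (w, ℓ w + r * diagForm s c d w),
    .of_forall fun r => (h1 r).prodMk (h3 r), ?_, ?_⟩
  · simp
  · have := ((hasDerivAt_id (0 : ℝ)).mul_const (diagForm s c d w)).const_add (ℓ w)
    simpa using (hasDerivAt_const (0 : ℝ) w).prodMk this

/-! ### The action of equivalence transformations on jets -/

lemma IsEquivTransformation.exists_hasFDerivAt {Φ : OpenPartialHomeomorph TotalSpace TotalSpace}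
    {b : Equiv.Perm ℝ} (h : IsEquivTransformation Φ b) {z : TotalSpace} (hz : z ∈ Φ.source) :
    ∃ A : TotalSpace ≃L[ℝ] TotalSpace, HasFDerivAt Φ (A : TotalSpace →L[ℝ] TotalSpace) z := by
  have h1 : HasFDerivAt Φ (fderiv ℝ Φ z) z :=
    ((h.smooth.contDiffAt (Φ.open_source.mem_nhds hz)).differentiableAt (by simp)).hasFDerivAt
  have h2 : HasFDerivAt Φ.symm (fderiv ℝ Φ.symm (Φ z)) (Φ z) :=
    ((h.smooth_symm.contDiffAt (Φ.open_target.mem_nhds (Φ.map_source hz))).differentiableAt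
      (by simp)).hasFDerivAt
  have h3 := h2.comp z h1
  have h1' : HasFDerivAt Φ (fderiv ℝ Φ z) (Φ.symm (Φ z)) := by rwa [Φ.left_inv hz]
  have h4 := h1'.comp (Φ z) h2
  have e3 := h3.unique ((hasFDerivAt_id z).congr_of_eventuallyEq
    (eventually_of_mem (Φ.open_source.mem_nhds hz) fun q hq => Φ.left_inv hq))
  have e4 := h4.unique ((hasFDerivAt_id (Φ z)).congr_of_eventuallyEq
    (eventually_of_mem (Φ.open_target.mem_nhds (Φ.map_source hz)) fun q hq => Φ.right_inv hq))
  exact ⟨ContinuousLinearEquiv.equivOfInverse _ _ (fun v => DFunLike.congr_fun e3 v)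
    fun v => DFunLike.congr_fun e4 v, h1⟩

/-- How a transformation with the linear part `A`, taking the `x`-coordinate `x` to `x'`, acts on
the equations at jets with the first-order part `ℓ`: the equation with parameter `β` at a jet with
the diagonal second-order part `(s, c, d)` is equivalent to the equation with parameter `b β` at
the transformed jet. The equivalence `e` is the map of the base space induced by `A` on the graph
of `ℓ`; the first-order part of the transformed jet is the covector `q ↦ (A (e⁻¹ q, ℓ (e⁻¹ q))).2`,
whose graph is the image of the graph of `ℓ`, and its second derivative along `x'` is an affine
function of `(s, c, d)`, through the second derivative along the preimage under `e` of the
`x'`-direction. -/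
def JetRule (A : TotalSpace ≃L[ℝ] TotalSpace) (b : Equiv.Perm ℝ) (x x' : ℝ)
    (ℓ : BaseSpace →L[ℝ] ℝ) (e : BaseSpace ≃L[ℝ] BaseSpace) : Prop :=
  ∃ K : ℝ, ∀ β s c d : ℝ, ℓ (1, 0, x) = |x| ^ β * s ↔
    (A (e.symm (1, 0, x'), ℓ (e.symm (1, 0, x')))).2 = |x'| ^ b β * (K
      + ((A (0, 1)).2 - (A (e.symm (A (0, 1)).1, ℓ (e.symm (A (0, 1)).1))).2)
        * diagForm s c d (e.symm (0, 1, 0)))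

/-- The constant `K` in the rule comes from the second derivative of `Φ` along the lift of the
preimage of the `x'`-direction to the graph of `ℓ`. -/
lemma IsEquivTransformation.jetRule {Φ : OpenPartialHomeomorph TotalSpace TotalSpace}
    {b : Equiv.Perm ℝ} (h : IsEquivTransformation Φ b) {z : TotalSpace} (hz : z ∈ Φ.source)
    {A : TotalSpace ≃L[ℝ] TotalSpace} (hA : HasFDerivAt Φ (A : TotalSpace →L[ℝ] TotalSpace) z)
    {ℓ : BaseSpace →L[ℝ] ℝ} {e : BaseSpace ≃L[ℝ] BaseSpace}
    (he : ∀ w, e w = (A (w, ℓ w)).1) : JetRule A b z.1.2.1 (Φ z).1.2.1 ℓ e := by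
  set w := e.symm (0, 1, 0) with hw
  have hew : (A (w, ℓ w)).1 = (0, 1, 0) := by rw [← he, hw, e.apply_symm_apply]
  set B := fderiv ℝ (fderiv ℝ Φ) z (w, ℓ w) (w, ℓ w)
  refine ⟨B.2 - (A (e.symm B.1, ℓ (e.symm B.1))).2, fun β s c d => ?_⟩
  have hΦ : ContDiffAt ℝ ∞ Φ z := h.smooth.contDiffAt (Φ.open_source.mem_nhds hz)
  set v := quadJet z ℓ s c d with hv
  have hvz : v z.1 = z.2 := quadJet_self z ℓ s c d
  have hvs : ContDiff ℝ ∞ v := contDiff_quadJet z ℓ s c d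
  have hz' : ((z.1, v z.1) : TotalSpace) = z := by rw [hvz]
  -- The image of the graph of `v` consists of the points `Φ (q, v q)`, and `q` is mapped to the
  -- base point of `Φ (q, v q)` with the invertible derivative `e`.
  have hG : ContDiffAt ℝ ∞ (fun q => Φ (q, v q)) z.1 :=
    ContDiffAt.comp (g := Φ) z.1 (by rwa [hz']) (contDiffAt_id.prodMk hvs.contDiffAt)
  have hf : ContDiffAt ℝ ∞ (fun q => (Φ (q, v q)).1) z.1 := hG.fst
  have hk : ContDiffAt ℝ ∞ (fun q => (Φ (q, v q)).2) z.1 := hG.snd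
  have hvd : HasFDerivAt v ℓ z.1 := by
    have h1 : fderiv ℝ v z.1 = ℓ := ContinuousLinearMap.ext fun w => by
      simpa [dd] using dd_quadJet z ℓ s c d w z.1
    exact h1 ▸ (hvs.differentiable (by simp) z.1).hasFDerivAt
  have hGd : HasFDerivAt (fun q => Φ (q, v q)) _ z.1 :=
    HasFDerivAt.comp (g := Φ) z.1 (by rwa [hz']) ((hasFDerivAt_id z.1).prodMk hvd)
  have hfd : HasFDerivAt (fun q => (Φ (q, v q)).1) (e : BaseSpace →L[ℝ] BaseSpace) z.1 :=
    hGd.fst.congr_fderiv (ContinuousLinearMap.ext fun w => (he w).symm)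
  have hkd : ∀ q, fderiv ℝ (fun q => (Φ (q, v q)).2) z.1 q = (A (q, ℓ q)).2 := fun q => by
    rw [hGd.snd.fderiv]; rfl
  -- Hence it is locally the graph of a function.
  have hfz : (Φ (z.1, v z.1)).1 = (Φ z).1 := by rw [hz']
  set g := hf.localInverse hfd (by simp) with hg
  have hgs : ContDiffAt ℝ ∞ g (Φ z).1 := by
    have := hf.to_localInverse hfd (by simp)
    rwa [hfz] at this
  have hgl : ∀ᶠ q in 𝓝 z.1, g (Φ (q, v q)).1 = q :=
    (hf.hasStrictFDerivAt' hfd (by simp)).eventually_left_inverse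
  have hgz : g (Φ z).1 = z.1 := by rw [← hfz]; exact hgl.self_of_nhds
  set v' : BaseSpace → ℝ := fun q => (Φ (g q, v (g q))).2 with hv'
  have hv's : ContDiffAt ℝ ∞ v' (Φ z).1 :=
    ContDiffAt.comp (g := fun q => (Φ (q, v q)).2) (f := g) _ (by rwa [hgz]) hgs
  have hgraph : ∀ᶠ q in 𝓝 z.1, (Φ (q, v q)).2 = v' (Φ (q, v q)).1 := by
    filter_upwards [hgl] with q hq
    simp only [hv', hq]
  have hΦz : Φ (z.1, v z.1) = ((Φ z).1, v' (Φ z).1) := by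
    have := hgraph.self_of_nhds
    rw [hz'] at this ⊢
    exact Prod.ext rfl this
  have hmap := h.maps β v v' z.1 (Φ z).1 hvs.contDiffAt hv's (by rwa [hz']) hΦz hgraph
  rw [hv, satisfiesAt_quadJet] at hmap
  rw [hmap]
  -- The first derivative of that function.
  have hd1 : ∀ q, fderiv ℝ v' (Φ z).1 q = (A (e.symm q, ℓ (e.symm q))).2 := by
    intro q
    have h1 : HasFDerivAt (fun q => (Φ (q, v q)).2)
        ((fderiv ℝ v' (Φ z).1).comp (e : BaseSpace →L[ℝ] BaseSpace)) z.1 := by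
      refine HasFDerivAt.congr_of_eventuallyEq ?_ hgraph
      refine HasFDerivAt.comp (g := v') (f := fun q => (Φ (q, v q)).1) z.1 ?_ hfd
      rw [hfz]
      exact (hv's.differentiableAt (by simp)).hasFDerivAt
    have h2 := DFunLike.congr_fun h1.fderiv (e.symm q)
    rw [hkd] at h2
    simpa using h2.symm
  -- The second derivative along `x`, computed from the curve `r ↦ z.1 + r • w`.
  have hd2 : dX (dX v') (Φ z).1 + (A (e.symm (B + diagForm s c d w • A (0, 1)).1,
      ℓ (e.symm (B + diagForm s c d w • A (0, 1)).1))).2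
      = (B + diagForm s c d w • A (0, 1)).2 := by
    have hA' : fderiv ℝ Φ z = A := hA.fderiv
    have hc0 : ((z.1 + (0 : ℝ) • w, v (z.1 + (0 : ℝ) • w)) : TotalSpace) = z := by
      rw [zero_smul, add_zero, hz']
    have j1 := (twoJet_quadJet z ℓ s c d w).comp hc0 hΦ
    rw [hA'] at j1
    have e1 : A (0, diagForm s c d w) = diagForm s c d w • A (0, 1) := by
      rw [← map_smul]; simp
    simp only [ContinuousLinearEquiv.coe_coe, e1] at j1
    have j2 := j1.fst
    rw [hew] at j2
    have j3 := j2.comp (f := v') (z := (Φ z).1)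
      (congrArg (fun z => (Φ z).1) hc0) hv's
    have hline : Tendsto (fun r : ℝ => z.1 + r • w) (𝓝 0) (𝓝 z.1) := by
      have : Continuous (fun r : ℝ => z.1 + r • w) := by fun_prop
      simpa using this.tendsto 0
    have j4 := j3.acceleration_eq j1.snd ((hline.eventually hgraph).mono fun r hr => hr.symm)
    rw [hd1] at j4
    have h2 : DifferentiableAt ℝ (fderiv ℝ v') (Φ z).1 :=
      (((hv's.of_le (WithTop.coe_le_coe.2 le_top) : ContDiffAt ℝ 2 v' _)).fderiv_right (m := 1)
        (by norm_num)).differentiableAt (by simp)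
    have h3 : dX (dX v') (Φ z).1 = fderiv ℝ (fderiv ℝ v') (Φ z).1 (0, 1, 0) (0, 1, 0) := by
      have : HasFDerivAt (dX v') _ (Φ z).1 :=
        h2.hasFDerivAt.clm_apply (hasFDerivAt_const ((0, 1, 0) : BaseSpace) _)
      simp [dX, this.fderiv]
    rw [h3]
    exact j4
  have hlin : ∀ q₁ q₂ : BaseSpace, ∀ r : ℝ, (A (e.symm (q₁ + r • q₂), ℓ (e.symm (q₁ + r • q₂)))).2
      = (A (e.symm q₁, ℓ (e.symm q₁))).2 + r * (A (e.symm q₂, ℓ (e.symm q₂))).2 := by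
    intro q₁ q₂ r
    rw [← hd1, ← hd1, ← hd1, map_add, map_smul, smul_eq_mul]
  simp only [Prod.fst_add, Prod.snd_add, Prod.smul_fst, Prod.smul_snd, smul_eq_mul, hlin] at hd2
  have h3 : ((1, 0, (Φ z).1.2.1) : BaseSpace) = (1, 0, 0) + (Φ z).1.2.1 • (0, 0, 1) := by simp
  rw [SatisfiesAt, dT, dY, hd1, hd1, h3, hlin]
  have h4 : dX (dX v') (Φ z).1 = B.2 - (A (e.symm B.1, ℓ (e.symm B.1))).2
      + ((A (0, 1)).2 - (A (e.symm (A (0, 1)).1, ℓ (e.symm (A (0, 1)).1))).2)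
        * diagForm s c d w := by
    linear_combination hd2
  rw [h4]

/-! ### The linear part of an equivalence transformation -/

/-- If `a ≠ 0 ≠ a'`, then elimination of `s` shows that `y ↦ (G + H a y) / a'` maps the positive
numbers `y = X ^ (-β)` onto the positive numbers `X' ^ (-b β)`, and such an affine function has no
constant term. -/
lemma const_eq_zero_of_forall_iff {b : Equiv.Perm ℝ} {X X' a a' G H : ℝ} (hX : 0 < X)
    (hX1 : X ≠ 1) (hX' : 0 < X') (hX'1 : X' ≠ 1)
    (h : ∀ β s, a = X ^ β * s ↔ a' = X' ^ b β * (G + H * s)) : G = 0 := by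
  have h1 : ∀ β, a' = X' ^ b β * (G + H * (a * X ^ (-β))) := fun β => by
    refine (h β _).1 ?_
    rw [mul_left_comm, ← Real.rpow_add hX, add_neg_cancel, Real.rpow_zero, mul_one]
  by_cases ha' : a' = 0
  · have h2 : ∀ β : ℝ, G + H * (a * X ^ (-β)) = 0 := fun β =>
      (mul_eq_zero.1 ((h1 β).symm.trans ha')).resolve_left (Real.rpow_pos_of_pos hX' _).ne'
    have h3 := h2 0
    have h4 := h2 (-1)
    rw [neg_zero, Real.rpow_zero] at h3
    rw [neg_neg, Real.rpow_one] at h4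
    have h5 : G * (X - 1) = 0 := by linear_combination X * h3 - h4
    exact (mul_eq_zero.1 h5).resolve_right (sub_ne_zero.2 hX1)
  · set g := G / a' with hg
    set k := H * a / a' with hk
    have h2 : ∀ β, X' ^ b β * (g + k * X ^ (-β)) = 1 := fun β => by
      have := h1 β
      rw [hg, hk]
      field_simp
      linear_combination -this
    have pos : ∀ y, 0 < y → 0 < g + k * y := fun y hy => by
      have h3 := h2 (-Real.logb X y)
      rw [neg_neg, Real.rpow_logb hX hX1 hy] at h3
      exact pos_of_mul_pos_right (h3 ▸ one_pos) (Real.rpow_pos_of_pos hX' _).le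
    have surj : ∀ r, 0 < r → ∃ y, 0 < y ∧ g + k * y = r := fun r hr => by
      refine ⟨X ^ (-(b.symm (Real.logb X' r⁻¹))), Real.rpow_pos_of_pos hX _, ?_⟩
      have h3 := h2 (b.symm (Real.logb X' r⁻¹))
      rw [b.apply_symm_apply, Real.rpow_logb hX' hX'1 (inv_pos.2 hr)] at h3
      rwa [inv_mul_eq_div, div_eq_one_iff_eq hr.ne'] at h3
    have hk0 : 0 ≤ k := by
      by_contra! hlt
      have h3 := pos ((|g| + 1) / -k) (by have := abs_nonneg g; have : 0 < -k := by linarith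
                                          positivity)
      rw [show k * ((|g| + 1) / -k) = -(|g| + 1) by field_simp [hlt.ne]] at h3
      linarith [le_abs_self g]
    have hg0 : g ≤ 0 := by
      by_contra! hlt
      obtain ⟨y, hy, he⟩ := surj (g / 2) (by linarith)
      nlinarith [mul_nonneg hk0 hy.le]
    have hg1 : 0 ≤ g := by
      by_contra! hlt
      rcases hk0.eq_or_lt with h0 | hpos
      · have := pos 1 one_pos
        rw [← h0] at this
        linarith
      · have h3 := pos (-g / k) (by apply div_pos <;> linarith)
        rw [mul_div_cancel₀ _ hpos.ne', add_neg_cancel] at h3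
        exact h3.false
    exact (div_eq_zero_iff.1 (le_antisymm hg0 hg1)).resolve_right ha'

section Linear

variable {A : TotalSpace ≃L[ℝ] TotalSpace}

/-- If the graph of `ℓ` does not contain the preimage under `A` of the vertical direction, its
image projects isomorphically to the base space. -/
lemma exists_equiv_of_transversal {ℓ : BaseSpace →L[ℝ] ℝ}
    (h : ℓ (A.symm (0, 1)).1 ≠ (A.symm (0, 1)).2) :
    ∃ e : BaseSpace ≃L[ℝ] BaseSpace, ∀ w, e w = (A (w, ℓ w)).1 := by
  let M : BaseSpace →L[ℝ] BaseSpace := (ContinuousLinearMap.fst ℝ BaseSpace ℝ).comp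
    ((A : TotalSpace →L[ℝ] TotalSpace).comp ((ContinuousLinearMap.id ℝ BaseSpace).prod ℓ))
  have hM : ∀ w, M w = (A (w, ℓ w)).1 := fun w => rfl
  have hinj : Function.Injective (M : BaseSpace →ₗ[ℝ] BaseSpace) := by
    rw [← LinearMap.ker_eq_bot, LinearMap.ker_eq_bot']
    intro w hw
    have h1 : A (w, ℓ w) = (A (w, ℓ w)).2 • ((0, 1) : TotalSpace) := by
      ext1
      · rw [← hM]; simpa using hw
      · simp
    set r := (A (w, ℓ w)).2
    have h2 : (w, ℓ w) = r • A.symm (0, 1) := by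
      rw [← map_smul, ← h1, A.symm_apply_apply]
    have h3 : w = r • (A.symm (0, 1)).1 := congrArg Prod.fst h2
    have h4 : ℓ w = r * (A.symm (0, 1)).2 := congrArg Prod.snd h2
    rw [h3, map_smul, smul_eq_mul] at h4
    have h5 : r = 0 := by
      by_contra hr
      exact h (mul_left_cancel₀ hr h4)
    rw [h3, h5, zero_smul]
  refine ⟨(LinearEquiv.ofInjectiveEndo _ hinj).toContinuousLinearEquiv, fun w => ?_⟩
  rw [← hM]
  rfl

/-- The coefficient by which second derivatives are transformed does not vanish: the vertical
direction is not mapped into the image of the graph of `ℓ`. -/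
lemma fiber_ne_zero {ℓ : BaseSpace →L[ℝ] ℝ} {e : BaseSpace ≃L[ℝ] BaseSpace}
    (he : ∀ w, e w = (A (w, ℓ w)).1) :
    (A (0, 1)).2 - (A (e.symm (A (0, 1)).1, ℓ (e.symm (A (0, 1)).1))).2 ≠ 0 := by
  intro h
  have h1 : A (0, 1) = A (e.symm (A (0, 1)).1, ℓ (e.symm (A (0, 1)).1)) := by
    ext1
    · rw [← he, e.apply_symm_apply]
    · linarith
  have h2 := A.injective h1
  have h3 : e.symm (A (0, 1)).1 = 0 := (congrArg Prod.fst h2).symm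
  have h4 := congrArg Prod.snd h2
  rw [h3] at h4
  simp at h4

lemma map_fiber_add (w : BaseSpace) (r : ℝ) : A (w, r) = A (w, 0) + r • A (0, 1) := by
  rw [← map_smul, ← map_add]; simp

/-- Since the equations for all `β` are preserved at once, the transformed second derivative is a
multiple of `s` alone. So the `x`-direction, lifted to the graph of `ℓ`, is mapped to the
`x'`-direction, and both sides of the equation are transformed by the same factor. -/
lemma JetRule.apply {b : Equiv.Perm ℝ} {x x' : ℝ} {ℓ : BaseSpace →L[ℝ] ℝ}
    {e : BaseSpace ≃L[ℝ] BaseSpace} (hr : JetRule A b x x' ℓ e)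
    (he : ∀ w, e w = (A (w, ℓ w)).1) (hx : x ≠ 0) (hx1 : |x| ≠ 1) (hx' : x' ≠ 0)
    (hx'1 : |x'| ≠ 1) :
    ∃ ρ : ℝ, ρ ≠ 0 ∧ (A ((0, 1, 0), ℓ (0, 1, 0))).1 = (0, ρ, 0) ∧
      ∀ β, (A (e.symm (1, 0, x'), ℓ (e.symm (1, 0, x')))).2 * |x| ^ β * ρ ^ 2
        = |x'| ^ b β * ((A (0, 1)).2 - (A (e.symm (A (0, 1)).1, ℓ (e.symm (A (0, 1)).1))).2)
          * ℓ (1, 0, x) := by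
  have hX := abs_pos.2 hx
  have hX' := abs_pos.2 hx'
  have hμ := fiber_ne_zero he
  obtain ⟨K, hK⟩ := hr
  set μ := (A (0, 1)).2 - (A (e.symm (A (0, 1)).1, ℓ (e.symm (A (0, 1)).1))).2
  set a' := (A (e.symm (1, 0, x'), ℓ (e.symm (1, 0, x')))).2
  set w := e.symm (0, 1, 0) with hw
  have hpow : ∀ β : ℝ, |x| ^ β * (ℓ (1, 0, x) * |x| ^ (-β)) = ℓ (1, 0, x) := fun β => by
    rw [mul_left_comm, ← Real.rpow_add hX, add_neg_cancel, Real.rpow_zero, mul_one]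
  -- The second-order jet coordinates other than `s` must not enter the transformed equation.
  have hfree : ∀ c d, μ * diagForm (ℓ (1, 0, x)) c d w = μ * diagForm (ℓ (1, 0, x)) 0 0 w := by
    intro c d
    have h1 := fun c d => (hK 0 (ℓ (1, 0, x)) c d).1 (by rw [Real.rpow_zero, one_mul])
    have h2 := mul_left_cancel₀ (Real.rpow_pos_of_pos hX' _).ne' ((h1 c d).symm.trans (h1 0 0))
    exact add_left_cancel h2
  have ht : w.1 = 0 := by
    have := mul_left_cancel₀ hμ (hfree 1 0)
    simpa [diagForm] using this
  have hy : w.2.2 = 0 := by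
    have := mul_left_cancel₀ hμ (hfree 0 1)
    simpa [diagForm] using this
  have hwx : w = w.2.1 • (0, 1, 0) := by ext <;> simp [ht, hy]
  have hx0 : w.2.1 ≠ 0 := by
    intro h0
    rw [h0, zero_smul] at hwx
    have := congrArg e hwx
    rw [hw, e.apply_symm_apply, map_zero] at this
    simp at this
  have hQ : ∀ s, diagForm s 0 0 w = w.2.1 ^ 2 * s := fun s => by simp [diagForm, mul_comm]
  have hK0 : K = 0 := by
    refine const_eq_zero_of_forall_iff (b := b) (a := ℓ (1, 0, x)) (a' := a')
      (H := μ * w.2.1 ^ 2) hX hx1 hX' hx'1 fun β s => ?_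
    rw [hK β s 0 0, hQ, mul_assoc]
  refine ⟨w.2.1⁻¹, inv_ne_zero hx0, ?_, fun β => ?_⟩
  · rw [← he]
    have h1 : e w = (0, 1, 0) := by rw [hw, e.apply_symm_apply]
    rw [hwx, map_smul] at h1
    rw [← inv_smul_smul₀ hx0 (e (0, 1, 0)), h1]
    simp
  · have h1 := (hK β (ℓ (1, 0, x) * |x| ^ (-β)) 0 0).1 (hpow β).symm
    rw [hK0, hQ, zero_add] at h1
    rw [h1]
    field_simp
    linear_combination hpow β

lemma exists_ne_zero_avoiding (a b c : ℝ) (ha : a ≠ 0) :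
    ∃ δ : ℝ, δ ≠ 0 ∧ a + δ * b ≠ 0 ∧ c + δ ≠ 0 := by
  obtain ⟨δ, hδ⟩ := (Set.toFinite ({0, -a / b, -c} : Set ℝ)).infinite_compl.nonempty
  simp only [mem_compl_iff, mem_insert_iff, mem_singleton_iff, not_or] at hδ
  refine ⟨δ, hδ.1, fun h => ?_, fun h => hδ.2.2 (by linarith)⟩
  by_cases hb : b = 0
  · exact ha (by simpa [hb] using h)
  · exact hδ.2.1 (by rw [eq_div_iff hb]; linarith)

lemma exists_transversal {ν : TotalSpace} (hν : ν ≠ 0) :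
    ∃ ℓ : BaseSpace →L[ℝ] ℝ, ℓ ν.1 ≠ ν.2 := by
  by_cases h1 : ν.1 = 0
  · refine ⟨0, fun h => hν (Prod.ext h1 ?_)⟩
    simpa using h.symm
  · obtain ⟨f, hf⟩ := SeparatingDual.exists_eq_one (R := ℝ) h1
    exact ⟨(ν.2 + 1) • f, by simp [hf]⟩

lemma exists_regular_covector {ν : TotalSpace} (hν : ν ≠ 0) (x : ℝ) :
    ∃ ℓ : BaseSpace →L[ℝ] ℝ, ℓ ν.1 ≠ ν.2 ∧ ℓ (1, 0, x) ≠ 0 := by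
  obtain ⟨ℓ, hℓ⟩ := exists_transversal hν
  obtain ⟨δ, -, h1, h2⟩ := exists_ne_zero_avoiding (ℓ ν.1 - ν.2) ν.1.1 (ℓ (1, 0, x))
    (sub_ne_zero.2 hℓ)
  refine ⟨ℓ + δ • ContinuousLinearMap.fst ℝ ℝ (ℝ × ℝ), fun h => h1 ?_, ?_⟩
  · simp only [add_apply, smul_apply, ContinuousLinearMap.coe_fst', smul_eq_mul] at h
    linarith
  · simpa using h2

/-- At a generic point, the images of the `x`-direction and of the `u`-direction under `A` have
no components along `t` and `y`. -/
lemma linear_part_of_jetRule {b : Equiv.Perm ℝ} {x x' : ℝ}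
    (hr : ∀ ℓ e, (∀ w, e w = (A (w, ℓ w)).1) → JetRule A b x x' ℓ e)
    (hx : x ≠ 0) (hx1 : |x| ≠ 1) (hx' : x' ≠ 0) (hx'1 : |x'| ≠ 1) :
    (∀ v : TotalSpace, v = ((0, 1, 0), 0) ∨ v = (0, 1) → (A v).1.1 = 0 ∧ (A v).1.2.2 = 0) ∧
      ∀ β, |x'| ^ b β = |x'| ^ b 0 * |x| ^ β := by
  have hν : A.symm (0, 1) ≠ 0 := by simp
  obtain ⟨ℓ, hℓ, ha⟩ := exists_regular_covector hν x
  obtain ⟨e, he⟩ := exists_equiv_of_transversal hℓ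
  obtain ⟨ρ, hρ, hX, hβ⟩ := (hr ℓ e he).apply he hx hx1 hx' hx'1
  constructor
  · -- Two covectors with different `x`-components.
    obtain ⟨δ, hδ, hδ1, -⟩ := exists_ne_zero_avoiding (ℓ (A.symm (0, 1)).1 - (A.symm (0, 1)).2)
      (A.symm (0, 1)).1.2.1 0 (sub_ne_zero.2 hℓ)
    set ℓ' : BaseSpace →L[ℝ] ℝ := ℓ + δ • (ContinuousLinearMap.fst ℝ ℝ ℝ).comp
      (ContinuousLinearMap.snd ℝ ℝ (ℝ × ℝ)) with hℓ'
    have happ : ∀ w, ℓ' w = ℓ w + δ * w.2.1 := fun w => by simp [hℓ']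
    obtain ⟨e', he'⟩ := exists_equiv_of_transversal (A := A) (ℓ := ℓ') fun h => hδ1 (by
      rw [happ] at h; linarith)
    obtain ⟨ρ', -, hX', -⟩ := (hr ℓ' e' he').apply he' hx hx1 hx' hx'1
    rw [happ, map_fiber_add] at hX'
    rw [map_fiber_add] at hX
    simp only [Prod.ext_iff, Prod.fst_add, Prod.snd_add, Prod.smul_fst, Prod.smul_snd,
      smul_eq_mul] at hX hX'
    obtain ⟨h1, -, h2⟩ := hX
    obtain ⟨h3, -, h4⟩ := hX'
    have h5 : (A (0, 1)).1.1 = 0 := (mul_eq_zero.1 (by linear_combination h3 - h1 :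
      δ * (A (0, 1)).1.1 = 0)).resolve_left hδ
    have h6 : (A (0, 1)).1.2.2 = 0 := (mul_eq_zero.1 (by linear_combination h4 - h2 :
      δ * (A (0, 1)).1.2.2 = 0)).resolve_left hδ
    rintro v (rfl | rfl)
    · rw [h5, mul_zero, add_zero] at h1
      rw [h6, mul_zero, add_zero] at h2
      exact ⟨h1, h2⟩
    · exact ⟨h5, h6⟩
  · intro β
    have h1 := hβ β
    have h0 := hβ 0
    rw [Real.rpow_zero, mul_one] at h0
    have h2 := mul_ne_zero (fiber_ne_zero he) ha
    refine mul_right_cancel₀ h2 ?_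
    linear_combination -h1 + |x| ^ β * h0

/-- If `A` preserves the vertical direction, it maps the direction of the transport term
`∂_t + x ∂_y` to a multiple of `∂_t + x' ∂_y`. -/
lemma transport_of_jetRule {b : Equiv.Perm ℝ} {x x' : ℝ}
    (hr : ∀ ℓ e, (∀ w, e w = (A (w, ℓ w)).1) → JetRule A b x x' ℓ e)
    (hx : x ≠ 0) (hx1 : |x| ≠ 1) (hx' : x' ≠ 0) (hx'1 : |x'| ≠ 1) (hv : (A (0, 1)).1 = 0) :
    (A ((1, 0, x), 0)).1.1 * |x'| ^ b 0 = (A ((0, 1, 0), 0)).1.2.1 ^ 2 ∧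
      (A ((1, 0, x), 0)).1.2.2 = x' * (A ((1, 0, x), 0)).1.1 := by
  have hX' := Real.rpow_pos_of_pos (abs_pos.2 hx') (b 0)
  set m := (A (0, 1)).2 with hm
  have hA1 : A (0, 1) = m • ((0, 1) : TotalSpace) := by
    ext1
    · simpa using hv
    · simp [hm]
  have hm0 : m ≠ 0 := fun h => by
    rw [h, zero_smul] at hA1
    simp at hA1
  have hs : A.symm (0, 1) = m⁻¹ • ((0, 1) : TotalSpace) := by
    rw [A.symm_apply_eq, map_smul, hA1, inv_smul_smul₀ hm0]
  obtain ⟨e, he⟩ := exists_equiv_of_transversal (A := A) (ℓ := 0) (by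
    rw [hs]; simpa using hm0.symm)
  simp only [zero_apply] at he
  have hfib : ∀ w r, (A (w, r)).1 = (A (w, 0)).1 := fun w r => by
    rw [map_fiber_add, Prod.fst_add, Prod.smul_fst, hv, smul_zero, add_zero]
  have he' : ∀ (ℓ : BaseSpace →L[ℝ] ℝ) w, e w = (A (w, ℓ w)).1 := fun ℓ w => by
    rw [he]; exact (hfib w (ℓ w)).symm
  set r := e.symm (1, 0, x') with hrdef
  have her : e r = (1, 0, x') := by rw [hrdef, e.apply_symm_apply]
  set ρ := (A ((0, 1, 0), 0)).1.2.1 with hρdef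
  have key : ∀ ℓ : BaseSpace →L[ℝ] ℝ, ((A (r, 0)).2 + ℓ r * m) * ρ ^ 2
      = |x'| ^ b 0 * m * ℓ (1, 0, x) := by
    intro ℓ
    obtain ⟨ρ', -, h1, h2⟩ := (hr ℓ e (he' ℓ)).apply (he' ℓ) hx hx1 hx' hx'1
    have h3 : ρ' = ρ := by rw [hρdef, ← hfib _ (ℓ (0, 1, 0)), h1]
    have h4 := h2 0
    rw [Real.rpow_zero, mul_one, h3, map_fiber_add, hv, map_zero e.symm, map_zero ℓ] at h4
    have h5 : A ((0 : BaseSpace), (0 : ℝ)) = 0 := map_zero A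
    rw [h5, Prod.snd_add, Prod.smul_snd, smul_eq_mul, Prod.snd_zero, sub_zero] at h4
    exact h4
  have key0 := key 0
  simp only [zero_apply, zero_mul, add_zero, mul_zero] at key0
  have key1 : ∀ ℓ : BaseSpace →L[ℝ] ℝ, ℓ r * ρ ^ 2 = |x'| ^ b 0 * ℓ (1, 0, x) := fun ℓ => by
    refine mul_right_cancel₀ hm0 ?_
    linear_combination key ℓ - key0
  have hrL : ρ ^ 2 • r = |x'| ^ b 0 • ((1, 0, x) : BaseSpace) := by
    refine SeparatingDual.eq_iff_forall_dual_eq (R := ℝ) |>.2 fun ℓ => ?_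
    rw [map_smul, map_smul, smul_eq_mul, smul_eq_mul, mul_comm, key1]
  have hfin := congrArg e hrL
  rw [map_smul, map_smul, her, he] at hfin
  simp only [Prod.ext_iff, Prod.smul_fst, Prod.smul_snd, smul_eq_mul] at hfin
  obtain ⟨h1, -, h2⟩ := hfin
  refine ⟨by linarith, mul_left_cancel₀ hX'.ne' ?_⟩
  linear_combination x' * h1 - h2

end Linear

/-! ### Rigidity of the equivalence pseudogroup -/

lemma dd_total_x (e z : TotalSpace) : dd e (fun z : TotalSpace => z.1.2.1) z = e.1.2.1 := by
  have h : HasFDerivAt (fun z : TotalSpace => z.1.2.1) ((ContinuousLinearMap.fst ℝ ℝ ℝ).comp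
    ((ContinuousLinearMap.snd ℝ ℝ (ℝ × ℝ)).comp (ContinuousLinearMap.fst ℝ BaseSpace ℝ))) z :=
    hasFDerivAt_fst.snd.fst
  simp [dd, h.fderiv]

lemma differentiableAt_abs_rpow {z : TotalSpace} (hz : z.1.2.1 ≠ 0) (r : ℝ) :
    DifferentiableAt ℝ (fun z : TotalSpace => |z.1.2.1| ^ r) z :=
  DifferentiableAt.comp (g := fun s : ℝ => |s| ^ r) (f := fun z : TotalSpace => z.1.2.1) z
    ((hasDerivAt_abs hz).rpow_const (Or.inl (abs_pos.2 hz).ne')).differentiableAt (by fun_prop)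

lemma mul_dd_abs_rpow {z : TotalSpace} (hz : z.1.2.1 ≠ 0) (r : ℝ) (e : TotalSpace) :
    z.1.2.1 * dd e (fun z : TotalSpace => |z.1.2.1| ^ r) z = r * |z.1.2.1| ^ r * e.1.2.1 := by
  have h1 : HasFDerivAt (fun z : TotalSpace => z.1.2.1)
      (fderiv ℝ (fun z : TotalSpace => z.1.2.1) z) z :=
    DifferentiableAt.hasFDerivAt (by fun_prop)
  have h2 := ((hasDerivAt_abs hz).rpow_const (p := r)
    (Or.inl (abs_pos.2 hz).ne')).differentiableAt.hasDerivAt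
  have h3 : HasFDerivAt (fun z : TotalSpace => |z.1.2.1| ^ r) _ z :=
    h2.comp_hasFDerivAt (f := fun z : TotalSpace => z.1.2.1) z h1
  rw [dd, h3.fderiv, smul_apply, smul_eq_mul, ← mul_assoc, mul_deriv_abs_rpow,
    ← dd_total_x e z, dd]

/-- If `P` and `Q` do not depend on `x`, then `P + x Q` is a nonzero multiple of a power of
`|x|` only for the exponents `0` and `1`. -/
lemma exponent_eq_zero_or_one {N : Set TotalSpace} (ho : IsOpen N) (hn : N.Nonempty)
    (hN : ∀ z ∈ N, z.1.2.1 ≠ 0) {P Q : TotalSpace → ℝ} (sP : ContDiffOn ℝ ∞ P N)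
    (sQ : ContDiffOn ℝ ∞ Q N) (hP : ∀ z ∈ N, dd ((0, 1, 0), 0) P z = 0)
    (hQ : ∀ z ∈ N, dd ((0, 1, 0), 0) Q z = 0) {c n : ℝ} (hc : c ≠ 0)
    (h : ∀ z ∈ N, P z + z.1.2.1 * Q z = c * |z.1.2.1| ^ n) : n = 0 ∨ n = 1 := by
  have hx : ∀ z : TotalSpace, DifferentiableAt ℝ (fun z : TotalSpace => z.1.2.1) z := by
    intro z; fun_prop
  have h1 : ∀ z ∈ N, z.1.2.1 * Q z = c * n * |z.1.2.1| ^ n := fun z hz => by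
    have hPz := ContDiffOn.differentiableAt' sP ho hz
    have hQz := ContDiffOn.differentiableAt' sQ ho hz
    have h2 := dd_congr ho h ((0, 1, 0), 0) hz
    rw [dd_add _ hPz ((hx z).fun_mul hQz), dd_mul _ (hx z) hQz, hP z hz, hQ z hz, dd_total_x,
      dd_const_mul _ _ (differentiableAt_abs_rpow (hN z hz) n)] at h2
    have h3 := mul_dd_abs_rpow (hN z hz) n ((0, 1, 0), 0)
    linear_combination z.1.2.1 * h2 + c * h3
  obtain ⟨z, hz⟩ := hn
  have hQz := ContDiffOn.differentiableAt' sQ ho hz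
  have h2 := dd_congr ho h1 ((0, 1, 0), 0) hz
  rw [dd_mul _ (hx z) hQz, hQ z hz, dd_total_x,
    dd_const_mul _ _ (differentiableAt_abs_rpow (hN z hz) n)] at h2
  have h3 := mul_dd_abs_rpow (hN z hz) n ((0, 1, 0), 0)
  have h4 : n * (n - 1) = 0 := by
    have h5 : c * |z.1.2.1| ^ n ≠ 0 :=
      mul_ne_zero hc (Real.rpow_pos_of_pos (abs_pos.2 (hN z hz)) n).ne'
    refine (mul_eq_zero.1 (?_ : c * |z.1.2.1| ^ n * (n * (n - 1)) = 0)).resolve_left h5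
    linear_combination -(c * n) * h3 - z.1.2.1 * h2 + h1 z hz
  exact (mul_eq_zero.1 h4).imp id sub_eq_zero.1

lemma exists_abs_x_ne_one {U : Set TotalSpace} (ho : IsOpen U) (hn : U.Nonempty) :
    ∃ z ∈ U, |z.1.2.1| ≠ 1 := by
  obtain ⟨z, hz⟩ := hn
  have hc : Continuous (fun s : ℝ => (((z.1.1, s, z.1.2.2), z.2) : TotalSpace)) := by fun_prop
  have hV : (fun s : ℝ => (((z.1.1, s, z.1.2.2), z.2) : TotalSpace)) ⁻¹' U ∈ 𝓝 z.1.2.1 :=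
    (ho.preimage hc).mem_nhds hz
  obtain ⟨s, hs, hs'⟩ := ((infinite_of_mem_nhds _ hV).sdiff (Set.toFinite {1, -1})).nonempty
  refine ⟨_, hs, fun h => hs' ?_⟩
  simpa using eq_or_eq_neg_of_abs_eq h

/-- The equivalence transformations induce only the identity and the reflection at `5 / 2` on the
line of parameters. -/
lemma IsEquivTransformation.eq_or_eq_five_sub {Φ : OpenPartialHomeomorph TotalSpace TotalSpace}
    {b : Equiv.Perm ℝ} (h : IsEquivTransformation Φ b) :
    (∀ β, b β = β) ∨ ∀ β, b β = 5 - β := by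
  have hso := Φ.open_source
  have hcont : ∀ z ∈ Φ.source, ContinuousAt (fun z => (Φ z).1.2.1) z := fun z hz => by
    have := Φ.continuousAt hz
    fun_prop
  -- A point at which neither `|x|` nor `|x'|` is `1`.
  obtain ⟨z₀, hz₀, hz₀x, hz₀x'⟩ : ∃ z ∈ Φ.source, |z.1.2.1| ≠ 1 ∧ |(Φ z).1.2.1| ≠ 1 := by
    have hU : IsOpen (Φ.source ∩ {z | |z.1.2.1| ≠ 1}) :=
      hso.inter (isOpen_ne.preimage (f := fun z : TotalSpace => |z.1.2.1|) (by fun_prop))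
    obtain ⟨z, hz, hz1⟩ := exists_abs_x_ne_one hso h.nonempty
    obtain ⟨_, ⟨y, hy, rfl⟩, hy1⟩ := exists_abs_x_ne_one
      (Φ.isOpen_image_of_subset_source hU inter_subset_left) ⟨_, mem_image_of_mem _ ⟨hz, hz1⟩⟩
    exact ⟨y, hy.1, hy.2, hy1⟩
  have hX : ∀ z ∈ Φ.source, z.1.2.1 ≠ 0 := fun z hz => h.source_subset hz
  have hX' : ∀ z ∈ Φ.source, (Φ z).1.2.1 ≠ 0 := fun z hz => h.target_subset (Φ.map_source hz)
  -- A neighbourhood of it with the same properties, on which the sign `ε` of `x'` is constant.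
  obtain ⟨N, hN, hNo, hz₀N⟩ := eventually_nhds_iff.1
    (((hso.eventually_mem hz₀).and
      (((ContinuousAt.eventually_ne (g := fun z : TotalSpace => |z.1.2.1|) (by fun_prop) hz₀x)).and
        ((hcont z₀ hz₀).abs.eventually_ne hz₀x'))).and
      (((hcont z₀ hz₀).const_mul (Φ z₀).1.2.1).eventually_const_lt
        (mul_self_pos.2 (hX' z₀ hz₀))))
  have hNs : ∀ z ∈ N, z ∈ Φ.source := fun z hz => (hN z hz).1.1
  obtain ⟨ε, hε, hεN⟩ : ∃ ε : ℝ, ε ^ 2 = 1 ∧ ∀ z ∈ N, (Φ z).1.2.1 = ε * |(Φ z).1.2.1| := by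
    rcases lt_or_gt_of_ne (hX' z₀ hz₀) with hlt | hgt
    · refine ⟨-1, by norm_num, fun z hz => ?_⟩
      rw [abs_of_neg (neg_of_mul_pos_right (hN z hz).2 hlt.le)]
      ring
    · refine ⟨1, by norm_num, fun z hz => ?_⟩
      rw [abs_of_pos (pos_of_mul_pos_right (hN z hz).2 hgt.le), one_mul]
  have sΦ : ContDiffOn ℝ ∞ Φ N := h.smooth.mono hNs
  have sT : ContDiffOn ℝ ∞ (fun z => (Φ z).1.1) N := sΦ.fst.fst
  have sY : ContDiffOn ℝ ∞ (fun z => (Φ z).1.2.2) N := sΦ.fst.snd.snd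
  have hfd : ∀ z ∈ N, ∃ A : TotalSpace ≃L[ℝ] TotalSpace,
      (∀ ℓ e, (∀ w, e w = (A (w, ℓ w)).1) → JetRule A b z.1.2.1 (Φ z).1.2.1 ℓ e) ∧
      (∀ v, dd v (fun z => (Φ z).1.1) z = (A v).1.1) ∧
      (∀ v, dd v (fun z => (Φ z).1.2.1) z = (A v).1.2.1) ∧
      ∀ v, dd v (fun z => (Φ z).1.2.2) z = (A v).1.2.2 := by
    intro z hz
    obtain ⟨A, hA⟩ := h.exists_hasFDerivAt (hNs z hz)
    refine ⟨A, fun ℓ e he => h.jetRule (hNs z hz) hA he, fun v => ?_, fun v => ?_, fun v => ?_⟩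
    · rw [dd, hA.fst.fst.fderiv]; rfl
    · rw [dd, hA.fst.snd.fst.fderiv]; rfl
    · rw [dd, hA.fst.snd.snd.fderiv]; rfl
  -- `|x'|` is a power of `|x|`.
  have hpow : ∀ z ∈ N, ∀ β, |(Φ z).1.2.1| ^ b β = |(Φ z).1.2.1| ^ b 0 * |z.1.2.1| ^ β := by
    intro z hz
    obtain ⟨A, hA, -⟩ := hfd z hz
    exact (linear_part_of_jetRule hA (hX z (hNs z hz)) (hN z hz).1.2.1 (hX' z (hNs z hz))
      (hN z hz).1.2.2).2
  have hk : b 1 - b 0 ≠ 0 := sub_ne_zero.2 fun he => one_ne_zero (b.injective he)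
  set κ := (b 1 - b 0)⁻¹ with hκ
  have hκ0 : κ ≠ 0 := inv_ne_zero hk
  have habs : ∀ z ∈ N, |(Φ z).1.2.1| = |z.1.2.1| ^ κ := fun z hz => by
    have hp := abs_pos.2 (hX' z (hNs z hz))
    have h1 := hpow z hz 1
    rw [Real.rpow_one, mul_comm] at h1
    rw [hκ, ← mul_right_cancel₀ (Real.rpow_pos_of_pos hp _).ne' (a := |(Φ z).1.2.1| ^ (b 1 - b 0))
      (c := |z.1.2.1|) (by rw [← h1, ← Real.rpow_add hp, sub_add_cancel]), ← Real.rpow_mul hp.le,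
      mul_inv_cancel₀ hk, Real.rpow_one]
  have hb : ∀ β, κ * b β = κ * b 0 + β := by
    intro β
    have hp := abs_pos.2 (hX z₀ hz₀)
    have h1 := hpow z₀ hz₀N β
    rw [habs z₀ hz₀N, ← Real.rpow_mul hp.le, ← Real.rpow_mul hp.le, ← Real.rpow_add hp] at h1
    exact (Real.rpow_right_inj hp hz₀x).1 h1
  have hX'eq : ∀ z ∈ N, (Φ z).1.2.1 = ε * |z.1.2.1| ^ κ := fun z hz => by
    rw [hεN z hz, habs z hz]
  have hX'd : ∀ z ∈ N, ∀ v, z.1.2.1 * dd v (fun z => (Φ z).1.2.1) z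
      = ε * (κ * |z.1.2.1| ^ κ * v.1.2.1) := fun z hz v => by
    rw [dd_congr hNo hX'eq v hz, dd_const_mul _ _ (differentiableAt_abs_rpow (hX z (hNs z hz)) κ),
      mul_left_comm, mul_dd_abs_rpow (hX z (hNs z hz))]
  -- The derivatives of the other two components along `∂_x` and `∂_t + x ∂_y`.
  have hTY : ∀ z ∈ N, dd ((0, 1, 0), 0) (fun z => (Φ z).1.1) z = 0 ∧
      dd ((0, 1, 0), 0) (fun z => (Φ z).1.2.2) z = 0 ∧
      dd ((1, 0, z.1.2.1), 0) (fun z => (Φ z).1.1) z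
        = κ ^ 2 * |z.1.2.1| ^ (2 * κ - 2 - κ * b 0) ∧
      dd ((1, 0, z.1.2.1), 0) (fun z => (Φ z).1.2.2) z
        = ε * κ ^ 2 * |z.1.2.1| ^ (2 * κ - 2 - κ * b 0 + κ) := by
    intro z hz
    have hx := hX z (hNs z hz)
    have hx' := hX' z (hNs z hz)
    have hp := abs_pos.2 hx
    obtain ⟨A, hA, hAT, hAX, hAY⟩ := hfd z hz
    have h1 := (linear_part_of_jetRule hA hx (hN z hz).1.2.1 hx' (hN z hz).1.2.2).1
    have hv : (A (0, 1)).1 = 0 := by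
      have h2 := hX'd z hz (0, 1)
      rw [hAX] at h2
      have h3 : (A (0, 1)).1.2.1 = 0 := by simpa [hx] using h2
      exact Prod.ext (h1 _ (Or.inr rfl)).1 (Prod.ext h3 (h1 _ (Or.inr rfl)).2)
    obtain ⟨h2, h3⟩ := transport_of_jetRule hA hx (hN z hz).1.2.1 hx' (hN z hz).1.2.2 hv
    have h4 := hX'd z hz ((0, 1, 0), 0)
    rw [hAX] at h4
    have h5 : (A ((1, 0, z.1.2.1), 0)).1.1 = κ ^ 2 * |z.1.2.1| ^ (2 * κ - 2 - κ * b 0) := by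
      rw [habs z hz, ← Real.rpow_mul hp.le] at h2
      have e1 : |z.1.2.1| ^ (2 * κ - 2 - κ * b 0) * |z.1.2.1| ^ (κ * b 0) * z.1.2.1 ^ 2
          = (|z.1.2.1| ^ κ) ^ 2 := by
        rw [← sq_abs z.1.2.1, ← Real.rpow_natCast, ← Real.rpow_natCast (|z.1.2.1| ^ κ),
          ← Real.rpow_add hp, ← Real.rpow_add hp, ← Real.rpow_mul hp.le]
        congr 1
        push_cast
        ring
      have e2 : |z.1.2.1| ^ (κ * b 0) * z.1.2.1 ^ 2 ≠ 0 :=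
        mul_ne_zero (Real.rpow_pos_of_pos hp _).ne' (pow_ne_zero 2 hx)
      refine mul_right_cancel₀ e2 ?_
      simp only [mul_one] at h4
      have h6 := congrArg (· ^ 2) h4
      simp only [mul_pow, hε] at h6
      linear_combination z.1.2.1 ^ 2 * h2 + h6 - κ ^ 2 * e1
    refine ⟨by rw [hAT]; exact (h1 _ (Or.inl rfl)).1, by rw [hAY]; exact (h1 _ (Or.inl rfl)).2,
      by rw [hAT, h5], ?_⟩
    rw [hAY, h3, h5, hX'eq z hz, Real.rpow_add hp]
    ring
  have hsplit : ∀ (f : TotalSpace → ℝ) z, dd ((1, 0, z.1.2.1), 0) f z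
      = dd ((1, 0, 0), 0) f z + z.1.2.1 * dd ((0, 0, 1), 0) f z := by
    intro f z
    have : (((1, 0, z.1.2.1), 0) : TotalSpace)
        = ((1, 0, 0), 0) + z.1.2.1 • ((0, 0, 1), 0) := by simp
    simp only [dd]
    rw [this, map_add, map_smul, smul_eq_mul]
  have hNx : ∀ z ∈ N, z.1.2.1 ≠ 0 := fun z hz => hX z (hNs z hz)
  have hε0 : ε ≠ 0 := fun h0 => by simp [h0] at hε
  have exT := exponent_eq_zero_or_one hNo ⟨z₀, hz₀N⟩ hNx (ContDiffOn.dd sT hNo ((1, 0, 0), 0))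
    (ContDiffOn.dd sT hNo ((0, 0, 1), 0))
    (dd_dd_eq_zero hNo sT (fun z hz => (hTY z hz).1) _)
    (dd_dd_eq_zero hNo sT (fun z hz => (hTY z hz).1) _) (pow_ne_zero 2 hκ0)
    fun z hz => by rw [← hsplit, (hTY z hz).2.2.1]
  have exY := exponent_eq_zero_or_one hNo ⟨z₀, hz₀N⟩ hNx (ContDiffOn.dd sY hNo ((1, 0, 0), 0))
    (ContDiffOn.dd sY hNo ((0, 0, 1), 0))
    (dd_dd_eq_zero hNo sY (fun z hz => (hTY z hz).2.1) _)
    (dd_dd_eq_zero hNo sY (fun z hz => (hTY z hz).2.1) _) (mul_ne_zero hε0 (pow_ne_zero 2 hκ0))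
    fun z hz => by rw [← hsplit, (hTY z hz).2.2.2]
  rcases exT with h0 | h1
  · have h2 : κ = 1 := by
      rcases exY with h2 | h2
      · exact absurd (by linarith) hκ0
      · linarith
    rw [h2] at h0 hb
    exact Or.inl fun β => by linarith [hb β]
  · have h2 : κ = -1 := by
      rcases exY with h2 | h2
      · linarith
      · exact absurd (by linarith) hκ0
    rw [h2] at h1 hb
    exact Or.inr fun β => by linarith [hb β]

/-! ### The classification -/

lemma LocallyEquivalent.eq_or_eq_five_sub {β β' : ℝ} (h : LocallyEquivalent β β') :
    β' = β ∨ β' = 5 - β := by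
  obtain ⟨Φ, b, hΦ, rfl⟩ := h
  exact hΦ.eq_or_eq_five_sub.imp (fun h => h β) fun h => h β

lemma exists_unique_representative (β : ℝ) : ∃ β' : ℝ, β' ≤ 5 / 2 ∧ GloballyEquivalent β β' ∧
    ∀ β'' : ℝ, β'' ≤ 5 / 2 → LocallyEquivalent β β'' → β'' = β' := by
  rcases le_total β (5 / 2) with h | h
  · refine ⟨β, h, globallyEquivalent_refl β, fun β'' h' hl => ?_⟩
    rcases hl.eq_or_eq_five_sub with rfl | rfl <;> linarith
  · refine ⟨5 - β, by linarith, globallyEquivalent_five_sub β, fun β'' h' hl => ?_⟩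
    rcases hl.eq_or_eq_five_sub with rfl | rfl <;> linarith

lemma HasEssentialExtension.mem {β : ℝ} (h : HasEssentialExtension β) :
    β ∈ ({0, 2, 3, 5} : Set ℝ) := by
  obtain ⟨Ω, hΩ, hlt⟩ := h
  by_contra hβ
  exact hlt.ne (maxInvarianceAlgebra_eq_of_generic hβ hΩ.isConnected).symm

end Kolmogorov

theorem mainTheorem1 :
    -- the kernel Lie invariance algebra
    (∀ Ω : TopologicalSpace.Opens Kolmogorov.BaseSpace,
      IsConnected (Ω : Set Kolmogorov.BaseSpace) → (∀ p ∈ Ω, p.2.1 ≠ 0) →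
        (⨅ β : ℝ, Kolmogorov.maxInvarianceAlgebra β Ω) = Kolmogorov.kernelSpan Ω ∧
        Kolmogorov.IsLieClosed (Kolmogorov.kernelSpan Ω)) ∧
    -- the algebra admitted by an arbitrary equation of the class, and when it is maximal
    (∀ (β : ℝ) (Ω : TopologicalSpace.Opens Kolmogorov.BaseSpace), Kolmogorov.IsDomainFor β Ω →
      Kolmogorov.IsLieClosed (Kolmogorov.genAlgebra β Ω) ∧
      Kolmogorov.genAlgebra β Ω ≤ Kolmogorov.maxInvarianceAlgebra β Ω ∧
      (Kolmogorov.maxInvarianceAlgebra β Ω = Kolmogorov.genAlgebra β Ω ↔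
        β ∉ ({0, 2, 3, 5} : Set ℝ))) ∧
    -- modulo the equivalence, the parameter runs through `(-∞, 5/2]`
    (∀ β : ℝ, ∃ β' : ℝ, β' ≤ 5 / 2 ∧ Kolmogorov.GloballyEquivalent β β' ∧
      ∀ β'' : ℝ, β'' ≤ 5 / 2 → Kolmogorov.LocallyEquivalent β β'' → β'' = β') ∧
    -- the case `β = 2`
    (∀ Ω : TopologicalSpace.Opens Kolmogorov.BaseSpace, Kolmogorov.IsDomainFor 2 Ω →
      Kolmogorov.maxInvarianceAlgebra 2 Ω =
        Kolmogorov.genAlgebra 2 Ω ⊔ Submodule.span ℝ {Kolmogorov.K2 Ω} ∧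
      Disjoint (Kolmogorov.genAlgebra 2 Ω) (Submodule.span ℝ {Kolmogorov.K2 Ω}) ∧
      Kolmogorov.K2 Ω ≠ 0 ∧
      Kolmogorov.IsLieClosed (Kolmogorov.maxInvarianceAlgebra 2 Ω)) ∧
    -- the case `β = 0`
    (∀ Ω : TopologicalSpace.Opens Kolmogorov.BaseSpace, Kolmogorov.IsDomainFor 0 Ω →
      Kolmogorov.maxInvarianceAlgebra 0 Ω =
        Kolmogorov.genAlgebra 0 Ω ⊔ Submodule.span ℝ
          {Kolmogorov.K0 Ω, Kolmogorov.P3 Ω, Kolmogorov.P2 Ω, Kolmogorov.P1 Ω} ∧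
      Disjoint (Kolmogorov.genAlgebra 0 Ω) (Submodule.span ℝ
          {Kolmogorov.K0 Ω, Kolmogorov.P3 Ω, Kolmogorov.P2 Ω, Kolmogorov.P1 Ω}) ∧
      LinearIndependent ℝ
        ![Kolmogorov.K0 Ω, Kolmogorov.P3 Ω, Kolmogorov.P2 Ω, Kolmogorov.P1 Ω] ∧
      Kolmogorov.IsLieClosed (Kolmogorov.maxInvarianceAlgebra 0 Ω)) ∧
    -- the list of these two cases is complete and without repetition
    (∀ β : ℝ, Kolmogorov.HasEssentialExtension β →
      Kolmogorov.GloballyEquivalent β 0 ∨ Kolmogorov.GloballyEquivalent β 2) ∧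
    ¬ Kolmogorov.LocallyEquivalent 0 2 := by
  refine ⟨fun Ω hΩ _ =>
      ⟨Kolmogorov.iInf_maxInvarianceAlgebra hΩ, Kolmogorov.isLieClosed_kernelSpan Ω.isOpen⟩,
    fun β Ω hΩ => ⟨Kolmogorov.isLieClosed_genAlgebra hΩ, Kolmogorov.genAlgebra_le Ω,
      fun he hβ => Kolmogorov.genAlgebra_ne_of_mem hβ hΩ he,
      fun hβ => Kolmogorov.maxInvarianceAlgebra_eq_of_generic hβ hΩ.isConnected⟩,
    Kolmogorov.exists_unique_representative,
    fun Ω hΩ => ⟨Kolmogorov.maxInvarianceAlgebra_two hΩ.isConnected, ?_, ?_,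
      Kolmogorov.isLieClosed_two hΩ⟩,
    fun Ω hΩ => ⟨Kolmogorov.maxInvarianceAlgebra_zero hΩ.isConnected, ?_, ?_,
      Kolmogorov.isLieClosed_zero hΩ⟩, fun β h => ?_, fun h => ?_⟩
  · rw [Submodule.disjoint_def]
    intro V hV hV'
    obtain ⟨c, rfl⟩ := Submodule.mem_span_singleton.1 hV'
    rw [Kolmogorov.smul_K2_mem_genAlgebra hΩ.isConnected hV, zero_smul]
  · intro h0
    refine one_ne_zero (Kolmogorov.smul_K2_mem_genAlgebra hΩ.isConnected (c := 1) ?_)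
    rw [h0, smul_zero]
    exact zero_mem _
  · rw [Submodule.disjoint_def]
    intro V hV hV'
    obtain ⟨c₅, c₆, c₇, c₈, rfl⟩ := Kolmogorov.mem_span_zero.1 hV'
    obtain ⟨rfl, rfl, rfl, rfl⟩ :=
      Kolmogorov.coeffs_eq_zero_of_mem_genAlgebra_zero hΩ.isConnected hV
    simp
  · rw [Fintype.linearIndependent_iff]
    intro g hg
    have h0 : g 0 • Kolmogorov.K0 Ω + (g 1 • Kolmogorov.P3 Ω + (g 2 • Kolmogorov.P2 Ω
        + g 3 • Kolmogorov.P1 Ω)) = 0 := by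
      simpa [Fin.sum_univ_four, add_assoc] using hg
    obtain ⟨h1, h2, h3, h4⟩ := Kolmogorov.coeffs_eq_zero_of_mem_genAlgebra_zero hΩ.isConnected
      (h0 ▸ zero_mem _)
    intro i
    fin_cases i <;> assumption
  · rcases h.mem with rfl | rfl | rfl | rfl
    · exact Or.inl (Kolmogorov.globallyEquivalent_refl 0)
    · exact Or.inr (Kolmogorov.globallyEquivalent_refl 2)
    · have := Kolmogorov.globallyEquivalent_five_sub 3
      norm_num at this
      exact Or.inr this
    · have := Kolmogorov.globallyEquivalent_five_sub 5
      norm_num at this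
      exact Or.inl this
  · rcases h.eq_or_eq_five_sub with h | h <;> norm_num at h
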